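/- **Setting.** Let $K$ be a Gray-category, with interchange isomorphisms $\gamma_{\beta,\alpha}\colon(\beta\circ 1)\cdot(1\circ\alpha)\Rrightarrow(1\circ\alpha)\cdot(\beta\circ 1)$ for horizontally composable 2-cells $\alpha,\beta$. Let $\mathcal G$ be a pasting scheme, i.e. a finite acyclic directed plane graph with two distinct vertices $s\neq t$ (source and sink) on the boundary of the exterior face such that every vertex lies on a directed path from $s$ to $t$. The boundary of every interior face $F$ then consists of two directed paths with common endpoints, the upper one $\sigma_F$ and the lower one $\tau_F$; the boundary of the exterior face consists of the top path and the bottom path of $\mathcal G$, both from $s$ to $t$. A labelling $\mathcal L$ of $\mathcal G$ in $K$ assigns a 0-cell to every vertex, a 1-cell to every edge and a 2-cell to every interior face, compatibly with domains and codomains, where the 2-cell at $F$ goes from the composite of $\sigma_F$ to the composite of $\tau_F$. Write $S,T$ for the labels of $s,t$ and $p,q\colon S\to T$ for the composites of the top and of the bottom path, and $K(S,T)[p,q]$ for the category of 2-cells $p\Rightarrow q$ and the 3-cells between them. Write $F\lhd H$ if $\tau_F$ and $\sigma_H$ share an edge. Let $\mathcal C_{\mathcal G}$ be the groupoid whose objects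 are the strict linear extensions of $\lhd$ (orders $F_1\cdots F_n$ of all the interior faces in which $F$ precedes $H$ whenever $F\lhd H$), generated by the exchanges $\overline U\,\widehat{GH}\,\overline V\colon\overline U GH\overline V\to\overline U HG\overline V$ of two neighbouring faces, subject to the relations that exchanging the same two faces twice is the identity, that exchanges at disjoint places commute, and that the two ways of reversing three consecutive faces agree. The labelling $\mathcal L$ determines a canonical functor $\mathcal L\colon\mathcal C_{\mathcal G}\to K(S,T)[p,q]$, which sends an order of the faces to the corresponding composite 2-cell $p\Rightarrow q$, and sends the exchange of two neighbouring faces to the corresponding whiskered component of $\gamma$ or of $\gamma^{-1}$. Let $F_\alpha$ be an interior face with label $\alpha$ and let $\Gamma\colon\alpha\Rrightarrow\alpha'$ be a 3-cell. Write $\mathcal L^{\alpha'}$ for the labelling which has $\alpha'$ in place of $\alpha$ at $F_\alpha$ and agrees with $\mathcal L$ elsewhere. Then $\Gamma$ induces a natural transformation $\Gamma^*\colon\mathcal L\Rightarrow\mathcal L^{\alpha'}\colon\mathcal C_{\mathcal G}\to K(S,T)[p,q]$, whose component at $\overline H F_\alpha\overline K$ is $\Gamma$ whiskered first with 1-cells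 and then with the composite 2-cells which $\mathcal L$ assigns to $\overline H$ and to $\overline K$. **Theorem (generalised local interchange).** Let $F_\alpha\neq F_\beta$ be two distinct interior faces of $\mathcal G$ with labels $\alpha$ and $\beta$ in $\mathcal L$, and let $\Gamma\colon\alpha\Rrightarrow\alpha'$ and $\Delta\colon\beta\Rrightarrow\beta'$ be 3-cells of $K$. Put $\mathcal L^{\alpha',\beta'}:=(\mathcal L^{\alpha'})^{\beta'}=(\mathcal L^{\beta'})^{\alpha'}$. Then the two composite natural transformations $$\mathcal L\overset{\Gamma^*}{\Longrightarrow}\mathcal L^{\alpha'}\overset{\Delta^*}{\Longrightarrow}\mathcal L^{\alpha',\beta'}\qquad\text{and}\qquad\mathcal L\overset{\Delta^*}{\Longrightarrow}\mathcal L^{\beta'}\overset{\Gamma^*}{\Longrightarrow}\mathcal L^{\alpha',\beta'}$$ between functors $\mathcal C_{\mathcal G}\to K(S,T)[p,q]$ are equal. -/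

import Mathlib

universe u

/-- A finite directed multigraph together with a rotation system: the standard combinatorial form
of a drawing of the graph on an oriented surface, up to orientation preserving homeomorphism.
A dart `(e, true)` is the edge `e` traversed from its source to its target, and `(e, false)` is
`e` traversed backwards; a dart is attached to the vertex it leaves. The permutation `rot` sends a
dart to the next dart, counterclockwise, around the same vertex. -/
structure DirectedMap where
  V : Type u
  E : Type u
  [finV : Finite V]
  [finE : Finite E]
  src : E → V
  tgt : E → V
  rot : Equiv.Perm (E × Bool)
  rot_orbit : ∀ d d' : E × Bool, rot.SameCycle d d' ↔
    (if d.2 then src d.1 else tgt d.1) = (if d'.2 then src d'.1 else tgt d'.1)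

attribute [instance] DirectedMap.finV DirectedMap.finE

namespace DirectedMap

variable (M : DirectedMap.{u})

/-- The vertex which a dart leaves. -/
def origin (d : M.E × Bool) : M.V := if d.2 then M.src d.1 else M.tgt d.1

/-- The same edge traversed in the opposite direction. -/
def flip : Equiv.Perm (M.E × Bool) :=
  Equiv.prodCongr (Equiv.refl M.E) Equiv.boolNot

/-- Walking along the boundary of a face that lies on the left hand side: after traversing a dart
`d`, continue with the dart that comes next, clockwise, after the reverse of `d`. -/
def faceStep : Equiv.Perm (M.E × Bool) := M.flip.trans M.rot.symm

/-- The faces of the drawing: the orbits of `faceStep`. -/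
def Face : Type u := Quotient (Equiv.Perm.SameCycle.setoid M.faceStep)

/-- The face on the left hand side of a dart. -/
def face (d : M.E × Bool) : M.Face := Quotient.mk _ d

/-- The face on the left of an edge. With edges drawn from left to right it lies above the edge. -/
def left (e : M.E) : M.Face := M.face (e, true)

/-- The face on the right of an edge. With edges drawn from left to right it lies below it. -/
def right (e : M.E) : M.Face := M.face (e, false)

/-- `M.IsPath a l b`: the list of edges `l` is a (possibly empty) directed path from `a` to `b`. -/
def IsPath : M.V → List M.E → M.V → Prop
  | a, [], b => a = b
  | a, e :: l, b => M.src e = a ∧ IsPath (M.tgt e) l b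

end DirectedMap

/-- A pasting scheme: a finite plane directed graph which is acyclic, with distinct vertices `s`
and `t` on the exterior face `ext` such that every vertex lies on a directed path from `s` to `t`.
The graph is connected by `reach`, so Euler's formula `euler` says that the drawing is a drawing
on the sphere; the choice of the exterior face makes it a drawing in the plane. -/
structure PastingScheme extends DirectedMap.{u} where
  euler : Nat.card V + Nat.card toDirectedMap.Face = Nat.card E + 2
  ext : toDirectedMap.Face
  s : V
  t : V
  s_ne_t : s ≠ t
  s_ext : ∃ d, toDirectedMap.origin d = s ∧ toDirectedMap.face d = ext
  t_ext : ∃ d, toDirectedMap.origin d = t ∧ toDirectedMap.face d = ext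
  reach : ∀ w, (∃ l, toDirectedMap.IsPath s l w) ∧ (∃ l, toDirectedMap.IsPath w l t)
  acyclic : ∀ w l, toDirectedMap.IsPath w l w → l = []

namespace DirectedMap

variable (M : DirectedMap.{u})

theorem isPath_append (a b : M.V) (l m : List M.E) :
    M.IsPath a (l ++ m) b ↔ ∃ c, M.IsPath a l c ∧ M.IsPath c m b := by
  induction l generalizing a with
  | nil => simp [IsPath]
  | cons e l ih => simp [IsPath, ih, and_assoc]

theorem isPath_inj {a b c : M.V} {l : List M.E} (h : M.IsPath a l b) (h' : M.IsPath a l c) :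
    b = c := by
  induction l generalizing a with
  | nil => exact h.symm.trans h'
  | cons e l ih => exact ih h.2 h'.2

theorem isPath_rank {h : M.V → ℕ} (hh : ∀ e, h (M.src e) < h (M.tgt e)) {a b : M.V}
    {l : List M.E} (p : M.IsPath a l b) : h a + l.length ≤ h b := by
  induction l generalizing a with
  | nil => cases p; simp
  | cons e l ih =>
    have h1 := ih p.2
    have h2 := hh e
    have h3 := p.1
    subst h3
    simp only [List.length_cons]
    omega

theorem face_eq_iff {d d' : M.E × Bool} :
    M.face d = M.face d' ↔ M.faceStep.SameCycle d d' := by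
  unfold face
  exact Quotient.eq (r := Equiv.Perm.SameCycle.setoid M.faceStep)

theorem face_faceStep (d : M.E × Bool) : M.face (M.faceStep d) = M.face d := by
  rw [face_eq_iff]
  exact (Equiv.Perm.sameCycle_apply_left).2 (Equiv.Perm.SameCycle.refl _ _)

theorem origin_rot_symm (d : M.E × Bool) : M.origin (M.rot.symm d) = M.origin d := by
  refine (M.rot_orbit _ _).1 ?_
  refine ⟨1, ?_⟩
  simp

theorem origin_faceStep (d : M.E × Bool) :
    M.origin (M.faceStep d) = if d.2 then M.tgt d.1 else M.src d.1 := by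
  unfold faceStep
  rw [Equiv.trans_apply, origin_rot_symm]
  rcases d with ⟨e, b⟩
  cases b <;> simp [flip, origin]

/-- Along an orbit of a permutation on which a property changes, it changes from true to false. -/
theorem exists_change {α : Type*} [Finite α] (f : Equiv.Perm α) (P : α → Prop) {a b : α}
    (h : f.SameCycle a b) (ha : P a) (hb : ¬ P b) :
    ∃ d, f.SameCycle a d ∧ P d ∧ ¬ P (f d) := by
  obtain ⟨n, rfl⟩ := h.exists_nat_pow_eq
  by_contra hc
  push Not at hc
  have : ∀ n : ℕ, P ((f ^ n) a) := by
    intro n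
    induction n with
    | zero => simpa using ha
    | succ n ih =>
      rw [pow_succ']
      exact hc _ ⟨n, by simp⟩ ih
  exact hb (this n)

end DirectedMap

namespace PastingScheme

variable (G : PastingScheme.{u})

theorem exists_rank : ∃ h : G.V → ℕ, ∀ e, h (G.src e) < h (G.tgt e) := by
  refine ⟨fun w => {x | ∃ l, G.IsPath x l w}.ncard, fun e => ?_⟩
  apply Set.ncard_lt_ncard _ (Set.toFinite _)
  refine ⟨?_, fun hs => ?_⟩
  · rintro x ⟨l, hl⟩
    exact ⟨l ++ [e], (G.isPath_append _ _ _ _).2 ⟨_, hl, rfl, rfl⟩⟩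
  · obtain ⟨l, hl⟩ := hs ⟨[], rfl⟩
    have := G.acyclic (G.tgt e) (l ++ [e]) ((G.isPath_append _ _ _ _).2 ⟨_, hl, rfl, rfl⟩)
    simp at this

theorem tgt_ne_s (e : G.E) : G.tgt e ≠ G.s := by
  intro h
  obtain ⟨l, hl⟩ := (G.reach (G.src e)).1
  have := G.acyclic G.s (l ++ [e]) ((G.isPath_append _ _ _ _).2 ⟨_, hl, rfl, h⟩)
  simp at this

theorem src_ne_t (e : G.E) : G.src e ≠ G.t := by
  intro h
  obtain ⟨l, hl⟩ := (G.reach (G.tgt e)).2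
  have := G.acyclic G.t (e :: l) ⟨h, hl⟩
  simp at this

theorem exists_in {w : G.V} (hw : w ≠ G.s) : ∃ e, G.tgt e = w := by
  obtain ⟨l, hl⟩ := (G.reach w).1
  rcases l.eq_nil_or_concat' with rfl | ⟨l, e, rfl⟩
  · exact absurd hl.symm hw
  · obtain ⟨c, -, h⟩ := (G.isPath_append _ _ _ _).1 hl
    exact ⟨e, h.2⟩

theorem exists_out {w : G.V} (hw : w ≠ G.t) : ∃ e, G.src e = w := by
  obtain ⟨l, hl⟩ := (G.reach w).2
  cases l with
  | nil => exact absurd hl hw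
  | cons e l => exact ⟨e, hl.1⟩

theorem exists_dart (x : G.Face) (b : Bool) : ∃ e, G.face (e, b) = x := by
  obtain ⟨h, hh⟩ := G.exists_rank
  obtain ⟨d, rfl⟩ := Quotient.exists_rep x
  change ∃ e, G.face (e, b) = G.face d
  by_contra hc
  push Not at hc
  have key : ∀ n : ℕ, ((G.faceStep ^ n) d).2 = !b := by
    intro n
    have h1 : G.face ((G.faceStep ^ n) d) = G.face d :=
      (G.face_eq_iff).2 (Equiv.Perm.SameCycle.symm ⟨n, by simp⟩)
    by_contra h2
    apply hc ((G.faceStep ^ n) d).1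
    rw [← h1]
    congr
    revert h2
    cases b <;> cases ((G.faceStep ^ n) d).2 <;> simp
  have step : ∀ n : ℕ, if b then h (G.origin ((G.faceStep ^ (n+1)) d)) + n + 1 ≤ h (G.origin d)
      else h (G.origin d) + n + 1 ≤ h (G.origin ((G.faceStep ^ (n+1)) d)) := by
    intro n
    have aux : ∀ n : ℕ, if b then h (G.origin ((G.faceStep ^ (n+1)) d)) <
          h (G.origin ((G.faceStep ^ n) d))
        else h (G.origin ((G.faceStep ^ n) d)) < h (G.origin ((G.faceStep ^ (n+1)) d)) := by
      intro n
      have k1 := key n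
      rw [pow_succ']
      change if b then h (G.origin (G.faceStep ((G.faceStep ^ n) d))) < _
        else _ < h (G.origin (G.faceStep ((G.faceStep ^ n) d)))
      rw [G.origin_faceStep]
      unfold DirectedMap.origin
      rw [k1]
      have := hh ((G.faceStep ^ n) d).1
      cases b <;> simpa using this
    induction n with
    | zero =>
      have := aux 0
      cases b <;> simp at this ⊢ <;> omega
    | succ n ih =>
      have := aux (n+1)
      cases b <;> simp only [Bool.false_eq_true, if_true, if_false] at this ih ⊢ <;> omega
  obtain ⟨n, hn⟩ : ∃ n : ℕ, (G.faceStep ^ (n+1)) d = d := by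
    obtain ⟨m, hm, -, h⟩ := (Equiv.Perm.SameCycle.refl G.faceStep d).exists_pow_eq''
    exact ⟨m - 1, by rwa [Nat.sub_add_cancel hm]⟩
  have := step n
  rw [hn] at this
  cases b <;> simp at this

/-- Every face has, in its boundary walk, exactly one corner where the walk turns from going
along the edges to going against them, and exactly one corner of the opposite kind. -/
theorem turn_unique (b : Bool) (d d' : G.E × Bool) (h : G.face d = G.face d')
    (hd : d.2 = b ∧ (G.faceStep d).2 = !b) (hd' : d'.2 = b ∧ (G.faceStep d').2 = !b) :
    d = d' := by
  classical
  have := Fintype.ofFinite G.V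
  have := Fintype.ofFinite G.E
  have : Finite G.Face := by unfold DirectedMap.Face; infer_instance
  have := Fintype.ofFinite G.Face
  let T : Bool → Bool → Finset (G.E × Bool) := fun b c =>
    Finset.univ.filter (fun d => d.2 = b ∧ (G.faceStep d).2 = c)
  -- turns cover the faces
  have hsurj : ∀ b x, ∃ d ∈ T b (!b), G.face d = x := by
    intro b x
    obtain ⟨e, he⟩ := G.exists_dart x b
    obtain ⟨e', he'⟩ := G.exists_dart x (!b)
    have hs : G.faceStep.SameCycle (e, b) (e', !b) := (G.face_eq_iff).1 (he.trans he'.symm)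
    obtain ⟨d, h1, h2, h3⟩ := DirectedMap.exists_change G.faceStep (fun d => d.2 = b) hs rfl
      (by simp)
    refine ⟨d, by simp only [T, Finset.mem_filter, Finset.mem_univ, true_and]; exact ⟨h2, Bool.eq_not.2 h3⟩, ?_⟩
    rw [← he]
    exact ((G.face_eq_iff).2 h1).symm
  have hface : ∀ b, Fintype.card G.Face ≤ (T b (!b)).card := by
    intro b
    rw [← Finset.card_univ]
    refine Finset.card_le_card_of_surjOn (fun d => G.face d) ?_
    intro x _
    obtain ⟨d, h1, h2⟩ := hsurj b x
    exact ⟨d, h1, h2⟩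
  -- straight corners cover the inner vertices
  have hvert : ∀ b, Fintype.card G.V ≤ (T b b).card + 2 := by
    intro b
    have : (Finset.univ \ {G.s, G.t} : Finset G.V).card ≤ (T b b).card := by
      refine Finset.card_le_card_of_surjOn (fun d => G.origin (G.faceStep d)) ?_
      intro w hw
      simp only [Finset.coe_sdiff, Finset.coe_univ, Set.mem_sdiff, Set.mem_univ, true_and,
        Finset.coe_insert, Finset.coe_singleton, Set.mem_insert_iff, Set.mem_singleton_iff,
        not_or] at hw
      obtain ⟨e, he⟩ := G.exists_in hw.1
      obtain ⟨e', he'⟩ := G.exists_out hw.2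
      have ho : ∀ b, ∃ e, G.origin (e, b) = w := by
        intro b
        cases b
        · exact ⟨e, by simpa [DirectedMap.origin] using he⟩
        · exact ⟨e', by simpa [DirectedMap.origin] using he'⟩
      obtain ⟨f, hf⟩ := ho b
      obtain ⟨f', hf'⟩ := ho (!b)
      have hs : Equiv.Perm.SameCycle G.rot.symm (f', !b) (f, b) :=
        Equiv.Perm.SameCycle.inv ((G.rot_orbit _ _).2 (hf'.trans hf.symm))
      obtain ⟨d, h1, h2, h3⟩ := DirectedMap.exists_change G.rot.symm (fun d => d.2 = !b) hs rfl
        (by simp)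
      refine ⟨G.flip.symm d, ?_, ?_⟩
      · simp only [T, Finset.coe_filter, Finset.mem_univ, true_and, Set.mem_ofPred_eq]
        constructor
        · obtain ⟨x, c⟩ := d
          simp only at h2
          subst h2
          cases b <;> rfl
        · simpa [DirectedMap.faceStep] using h3
      · simp only [DirectedMap.faceStep, Equiv.trans_apply, Equiv.apply_symm_apply,
          G.origin_rot_symm]
        rw [← hf']
        exact ((G.rot_orbit _ _).1 (Equiv.Perm.SameCycle.of_inv h1)).symm
    have h2 : ({G.s, G.t} : Finset G.V).card = 2 := Finset.card_pair G.s_ne_t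
    rw [Finset.card_sdiff_of_subset (Finset.subset_univ _), h2, Finset.card_univ] at this
    omega
  have htot : ∀ b, (T b b).card + (T b (!b)).card = Fintype.card G.E := by
    intro b
    have h1 : T b b ∪ T b (!b) = Finset.univ.filter (fun d : G.E × Bool => d.2 = b) := by
      ext d
      simp only [T, Finset.mem_union, Finset.mem_filter, Finset.mem_univ, true_and]
      cases b <;> cases (G.faceStep d).2 <;> simp
    have h2 : Disjoint (T b b) (T b (!b)) := by
      rw [Finset.disjoint_left]
      intro d h1 h2
      simp only [T, Finset.mem_filter, Finset.mem_univ, true_and] at h1 h2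
      rw [h1.2] at h2
      cases b <;> simp at h2
    rw [← Finset.card_union_of_disjoint h2, h1, ← Finset.card_univ]
    symm
    refine Finset.card_bij (fun e _ => (e, b)) (by simp) (by simp) ?_
    rintro ⟨e, c⟩ h
    simp only [Finset.mem_filter, Finset.mem_univ, true_and] at h
    exact ⟨e, by simp, by rw [h]⟩
  have heuler := G.euler
  simp only [Nat.card_eq_fintype_card] at heuler
  have hcard : (T b (!b)).card ≤ (Finset.univ : Finset G.Face).card := by
    rw [Finset.card_univ]
    have h1 := htot true
    have h2 := htot false
    have h3 := hvert true
    have h4 := hvert false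
    have h5 := hface true
    have h6 := hface false
    cases b <;> omega
  refine Finset.inj_on_of_surj_on_of_card_le (s := T b (!b)) (t := Finset.univ)
    (fun d _ => G.face d) (by simp) (fun x _ => ?_) hcard
    (by simpa [T] using hd) (by simpa [T] using hd') h
  obtain ⟨d, h1, h2⟩ := hsurj b x
  exact ⟨d, h1, h2⟩

/-- The edges of a set `A` form a directed path, if each edge but `last` has a successor in `A`
and each edge but `first` is the successor of an edge in `A`. -/
theorem exists_chain (A : G.E → Prop) (R : G.E → G.E → Prop) (first last : G.E)
    (hR : ∀ a b, R a b → G.tgt a = G.src b)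
    (hfun : ∀ a b c, R a b → R a c → b = c)
    (hlast : ∀ b, ¬ R last b) (hfirst : A first)
    (hnext : ∀ a, A a → a ≠ last → ∃ b, A b ∧ R a b)
    (hprev : ∀ a, A a → a ≠ first → ∃ b, A b ∧ R b a) :
    ∃ l : List G.E, l ≠ [] ∧ G.IsPath (G.src first) l (G.tgt last) ∧ ∀ e, e ∈ l ↔ A e := by
  obtain ⟨h, hh⟩ := G.exists_rank
  have hbd : ∃ N, ∀ w, h w ≤ N := by
    obtain ⟨N, hN⟩ := (Set.finite_range h).bddAbove
    exact ⟨N, fun w => hN ⟨w, rfl⟩⟩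
  obtain ⟨N, hN⟩ := hbd
  have build : ∀ n a, A a → N - h (G.src a) = n → ∃ l : List G.E,
      G.IsPath (G.src a) (a :: l) (G.tgt last) ∧ (∀ e ∈ a :: l, A e) ∧
      ∀ e ∈ a :: l, ∀ e', R e e' → e' ∈ a :: l := by
    intro n
    induction n using Nat.strong_induction_on with
    | _ n ih =>
      intro a ha hn
      by_cases hal : a = last
      · subst hal
        refine ⟨[], ⟨rfl, rfl⟩, by simpa using ha, ?_⟩
        intro e he e' hee
        simp only [List.mem_singleton] at he
        subst he
        exact absurd hee (hlast e')
      · obtain ⟨b, hb, hab⟩ := hnext a ha hal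
        have h1 := hR a b hab
        have h2 := hh a
        rw [h1] at h2
        have h3 := hN (G.src b)
        obtain ⟨l, p1, p2, p3⟩ := ih (N - h (G.src b)) (by omega) b hb rfl
        refine ⟨b :: l, ⟨rfl, h1 ▸ p1⟩, ?_, ?_⟩
        · intro e he
          rcases List.mem_cons.1 he with rfl | he
          · exact ha
          · exact p2 e he
        · intro e he e' hee
          rcases List.mem_cons.1 he with rfl | he
          · rw [hfun _ _ _ hee hab]
            simp
          · exact List.mem_cons_of_mem _ (p3 e he e' hee)
  obtain ⟨l, p1, p2, p3⟩ := build _ first hfirst rfl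
  refine ⟨first :: l, by simp, p1, fun e => ⟨p2 e, ?_⟩⟩
  have : ∀ n a, h (G.src a) = n → A a → a ∈ first :: l := by
    intro n
    induction n using Nat.strong_induction_on with
    | _ n ih =>
      intro a hn ha
      by_cases haf : a = first
      · subst haf; simp
      · obtain ⟨b, hb, hba⟩ := hprev a ha haf
        have h1 := hR b a hba
        have h2 := hh b
        rw [h1] at h2
        exact p3 b (ih _ (by omega) b rfl hb) a hba
  exact this _ e rfl

/-- The boundary of every face consists of two directed paths with the same end points. For the
exterior face the end points are `s` and `t`. -/
theorem exists_boundary (x : G.Face) : ∃ (a b : G.V) (lo up : List G.E),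
    (lo ≠ [] ∧ G.IsPath a lo b ∧ ∀ e, e ∈ lo ↔ G.left e = x) ∧
    (up ≠ [] ∧ G.IsPath a up b ∧ ∀ e, e ∈ up ↔ G.right e = x) ∧
    (x = G.ext → a = G.s ∧ b = G.t) := by
  have turn : ∀ b, ∃ e e', G.face (e, b) = x ∧ G.face (e', !b) = x ∧
      G.faceStep (e, b) = (e', !b) := by
    intro b
    obtain ⟨e, he⟩ := G.exists_dart x b
    obtain ⟨e', he'⟩ := G.exists_dart x (!b)
    have hs : G.faceStep.SameCycle (e, b) (e', !b) := (G.face_eq_iff).1 (he.trans he'.symm)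
    obtain ⟨⟨d, c⟩, h1, h2, h3⟩ := DirectedMap.exists_change G.faceStep (fun d => d.2 = b) hs rfl
      (by simp)
    simp only at h2
    subst h2
    have h4 : G.face (d, c) = x := by
      rw [← he]
      exact ((G.face_eq_iff).2 h1).symm
    refine ⟨d, (G.faceStep (d, c)).1, h4, ?_, ?_⟩
    · rw [← h4, ← G.face_faceStep (d, c)]
      congr
      exact (Bool.eq_not.2 h3).symm
    · refine Prod.ext rfl (Bool.eq_not.2 h3)
  obtain ⟨d, d', hd, hd', hdd⟩ := turn true
  obtain ⟨c, c', hc, hc', hcc⟩ := turn false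
  simp only [Bool.not_true, Bool.not_false] at hd' hdd hc' hcc
  have hb : G.tgt d = G.tgt d' := by
    have := G.origin_faceStep (d, true)
    rw [hdd] at this
    simpa [DirectedMap.origin] using this.symm
  have ha : G.src c = G.src c' := by
    have := G.origin_faceStep (c, false)
    rw [hcc] at this
    simpa [DirectedMap.origin] using this.symm
  have uniqT : ∀ e e', G.face (e, true) = x → G.faceStep (e, true) = (e', false) → e = d := by
    intro e e' h1 h2
    have := G.turn_unique true (e, true) (d, true) (h1.trans hd.symm) ⟨rfl, by rw [h2]; rfl⟩
      ⟨rfl, by rw [hdd]; rfl⟩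
    exact congrArg Prod.fst this
  have uniqF : ∀ e e', G.face (e, false) = x → G.faceStep (e, false) = (e', true) → e = c := by
    intro e e' h1 h2
    have := G.turn_unique false (e, false) (c, false) (h1.trans hc.symm) ⟨rfl, by rw [h2]; rfl⟩
      ⟨rfl, by rw [hcc]; rfl⟩
    exact congrArg Prod.fst this
  have nextFace : ∀ f f', G.faceStep f = f' → G.face f' = G.face f := by
    rintro f f' rfl
    exact G.face_faceStep f
  obtain ⟨lo, lo1, lo2, lo3⟩ := G.exists_chain (fun e => G.left e = x)
    (fun e e' => G.faceStep (e, true) = (e', true)) c' d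
    (by
      intro e e' h
      have := G.origin_faceStep (e, true)
      rw [h] at this
      simpa [DirectedMap.origin] using this.symm)
    (by
      intro e e' e'' h1 h2
      exact congrArg Prod.fst (h1.symm.trans h2))
    (by
      intro e h
      rw [hdd] at h
      simpa using congrArg Prod.snd h)
    hc'
    (by
      intro e he hne
      rcases hfg : G.faceStep (e, true) with ⟨f, g⟩
      cases g
      · exact absurd (uniqT e f he hfg) hne
      · exact ⟨f, (nextFace _ _ hfg).trans he, rfl⟩)
    (by
      intro e he hne
      rcases hfg : G.faceStep.symm (e, true) with ⟨f, g⟩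
      have hfg' : G.faceStep (f, g) = (e, true) := by rw [← hfg]; simp
      have hx : G.face (f, g) = x := (nextFace _ _ hfg').symm.trans he
      cases g
      · have := uniqF f e hx hfg'
        subst this
        rw [hcc] at hfg'
        exact absurd (congrArg Prod.fst hfg').symm hne
      · exact ⟨f, hx, hfg'⟩)
  obtain ⟨up, up1, up2, up3⟩ := G.exists_chain (fun e => G.right e = x)
    (fun e e' => G.faceStep (e', false) = (e, false)) c d'
    (by
      intro e e' h
      have := G.origin_faceStep (e', false)
      rw [h] at this
      simpa [DirectedMap.origin] using this)
    (by
      intro e e' e'' h1 h2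
      exact congrArg Prod.fst (G.faceStep.injective (h1.trans h2.symm)))
    (by
      intro e h
      have := G.faceStep.injective (hdd.trans h.symm)
      simpa using congrArg Prod.snd this)
    hc
    (by
      intro e he hne
      rcases hfg : G.faceStep.symm (e, false) with ⟨f, g⟩
      have hfg' : G.faceStep (f, g) = (e, false) := by rw [← hfg]; simp
      have hx : G.face (f, g) = x := (nextFace _ _ hfg').symm.trans he
      cases g
      · exact ⟨f, hx, hfg'⟩
      · have := uniqT f e hx hfg'
        subst this
        rw [hdd] at hfg'
        exact absurd (congrArg Prod.fst hfg').symm hne)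
    (by
      intro e he hne
      rcases hfg : G.faceStep (e, false) with ⟨f, g⟩
      cases g
      · exact ⟨f, (nextFace _ _ hfg).trans he, rfl⟩
      · exact absurd (uniqF e f he hfg) hne)
  rw [← hb, ha] at up2
  refine ⟨_, _, lo, up, ⟨lo1, lo2, lo3⟩, ⟨up1, up2, up3⟩, ?_⟩
  rintro rfl
  constructor
  · obtain ⟨⟨e, g⟩, h1, h2⟩ := G.s_ext
    cases g
    · exact absurd (by simpa [DirectedMap.origin] using h1) (G.tgt_ne_s e)
    · rcases hfg : G.faceStep.symm (e, true) with ⟨f, g⟩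
      have hfg' : G.faceStep (f, g) = (e, true) := by rw [← hfg]; simp
      have hx : G.face (f, g) = G.ext := (nextFace _ _ hfg').symm.trans h2
      have ho := G.origin_faceStep (f, g)
      rw [hfg', h1] at ho
      cases g
      · have := uniqF f e hx hfg'
        subst this
        rw [hcc] at hfg'
        have := congrArg Prod.fst hfg'
        simp only at this
        rw [this]
        simpa [DirectedMap.origin] using h1
      · exact absurd (by simpa using ho.symm) (G.tgt_ne_s f)
  · obtain ⟨⟨e, g⟩, h1, h2⟩ := G.t_ext
    cases g
    · rcases hfg : G.faceStep.symm (e, false) with ⟨f, g⟩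
      have hfg' : G.faceStep (f, g) = (e, false) := by rw [← hfg]; simp
      have hx : G.face (f, g) = G.ext := (nextFace _ _ hfg').symm.trans h2
      have ho := G.origin_faceStep (f, g)
      rw [hfg', h1] at ho
      cases g
      · exact absurd (by simpa using ho.symm) (G.src_ne_t f)
      · have := uniqT f e hx hfg'
        subst this
        simpa using ho.symm
    · exact absurd (by simpa [DirectedMap.origin] using h1) (G.src_ne_t e)

end PastingScheme

universe w₀ w₁ w₂ w₃

/-- A Gray-category, i.e. a category enriched over 2-categories with the Gray tensor product, in
unpacked globular form. There are sets of `n`-cells for `n ≤ 3` with sources and targets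
`sₙ`, `tₙ` of dimension `n`. All compositions are written in diagrammatic order and are meaningful
for composable cells only (they are total functions for convenience; their values elsewhere
are subject to no law and play no role):
* `comp f g` composes 1-cells `f : X → Y`, `g : Y → Z`;
* `vcomp` composes 2-cells along a 1-cell, `hcomp` composes 3-cells along a 1-cell, and
  `tcomp` composes 3-cells along a 2-cell: these are the compositions of the 2-categories
  `K(X, Y)`, which have 1-cells of `K` as objects, 2-cells as arrows and 3-cells as 2-cells;
* `wl2 f`, `wl3 f` whisker 2-cells and 3-cells with the 1-cell `f` placed in front, and
  `wr2 _ g`, `wr3 _ g` with the 1-cell `g` placed behind; these are strict 2-functors;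
* `γ α β` is the interchange isomorphism
  `(α ∘ 1) ⬝ (1 ∘ β) ⇛ (1 ∘ β) ⬝ (α ∘ 1)` and `γinv α β` is its inverse. -/
structure GrayCategory where
  C0 : Type w₀
  C1 : Type w₁
  C2 : Type w₂
  C3 : Type w₃
  s0 : C1 → C0
  t0 : C1 → C0
  s1 : C2 → C1
  t1 : C2 → C1
  s2 : C3 → C2
  t2 : C3 → C2
  s0_t1 : ∀ α, s0 (t1 α) = s0 (s1 α)
  t0_t1 : ∀ α, t0 (t1 α) = t0 (s1 α)
  s1_t2 : ∀ Γ, s1 (t2 Γ) = s1 (s2 Γ)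
  t1_t2 : ∀ Γ, t1 (t2 Γ) = t1 (s2 Γ)
  id0 : C0 → C1
  id1 : C1 → C2
  id2 : C2 → C3
  s0_id0 : ∀ X, s0 (id0 X) = X
  t0_id0 : ∀ X, t0 (id0 X) = X
  s1_id1 : ∀ f, s1 (id1 f) = f
  t1_id1 : ∀ f, t1 (id1 f) = f
  s2_id2 : ∀ α, s2 (id2 α) = α
  t2_id2 : ∀ α, t2 (id2 α) = α
  -- the category of 0-cells and 1-cells
  comp : C1 → C1 → C1
  s0_comp : ∀ f g, t0 f = s0 g → s0 (comp f g) = s0 f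
  t0_comp : ∀ f g, t0 f = s0 g → t0 (comp f g) = t0 g
  comp_assoc : ∀ f g h, t0 f = s0 g → t0 g = s0 h → comp (comp f g) h = comp f (comp g h)
  id0_comp : ∀ f, comp (id0 (s0 f)) f = f
  comp_id0 : ∀ f, comp f (id0 (t0 f)) = f
  -- the hom 2-categories
  vcomp : C2 → C2 → C2
  s1_vcomp : ∀ α β, t1 α = s1 β → s1 (vcomp α β) = s1 α
  t1_vcomp : ∀ α β, t1 α = s1 β → t1 (vcomp α β) = t1 β
  vcomp_assoc : ∀ α β δ, t1 α = s1 β → t1 β = s1 δ →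
    vcomp (vcomp α β) δ = vcomp α (vcomp β δ)
  id1_vcomp : ∀ α, vcomp (id1 (s1 α)) α = α
  vcomp_id1 : ∀ α, vcomp α (id1 (t1 α)) = α
  tcomp : C3 → C3 → C3
  s2_tcomp : ∀ Γ Δ, t2 Γ = s2 Δ → s2 (tcomp Γ Δ) = s2 Γ
  t2_tcomp : ∀ Γ Δ, t2 Γ = s2 Δ → t2 (tcomp Γ Δ) = t2 Δ
  tcomp_assoc : ∀ Γ Δ Θ, t2 Γ = s2 Δ → t2 Δ = s2 Θ →
    tcomp (tcomp Γ Δ) Θ = tcomp Γ (tcomp Δ Θ)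
  id2_tcomp : ∀ Γ, tcomp (id2 (s2 Γ)) Γ = Γ
  tcomp_id2 : ∀ Γ, tcomp Γ (id2 (t2 Γ)) = Γ
  hcomp : C3 → C3 → C3
  s2_hcomp : ∀ Γ Δ, t1 (s2 Γ) = s1 (s2 Δ) → s2 (hcomp Γ Δ) = vcomp (s2 Γ) (s2 Δ)
  t2_hcomp : ∀ Γ Δ, t1 (s2 Γ) = s1 (s2 Δ) → t2 (hcomp Γ Δ) = vcomp (t2 Γ) (t2 Δ)
  hcomp_assoc : ∀ Γ Δ Θ, t1 (s2 Γ) = s1 (s2 Δ) → t1 (s2 Δ) = s1 (s2 Θ) →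
    hcomp (hcomp Γ Δ) Θ = hcomp Γ (hcomp Δ Θ)
  id_hcomp : ∀ Γ, hcomp (id2 (id1 (s1 (s2 Γ)))) Γ = Γ
  hcomp_id : ∀ Γ, hcomp Γ (id2 (id1 (t1 (s2 Γ)))) = Γ
  hcomp_id2 : ∀ α β, t1 α = s1 β → hcomp (id2 α) (id2 β) = id2 (vcomp α β)
  local_interchange : ∀ Γ Γ' Δ Δ', t2 Γ = s2 Γ' → t2 Δ = s2 Δ' → t1 (s2 Γ) = s1 (s2 Δ) →
    hcomp (tcomp Γ Γ') (tcomp Δ Δ') = tcomp (hcomp Γ Δ) (hcomp Γ' Δ')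
  -- whiskering with a 1-cell in front is a strict 2-functor
  wl2 : C1 → C2 → C2
  wl3 : C1 → C3 → C3
  s1_wl2 : ∀ f α, t0 f = s0 (s1 α) → s1 (wl2 f α) = comp f (s1 α)
  t1_wl2 : ∀ f α, t0 f = s0 (s1 α) → t1 (wl2 f α) = comp f (t1 α)
  s2_wl3 : ∀ f Γ, t0 f = s0 (s1 (s2 Γ)) → s2 (wl3 f Γ) = wl2 f (s2 Γ)
  t2_wl3 : ∀ f Γ, t0 f = s0 (s1 (s2 Γ)) → t2 (wl3 f Γ) = wl2 f (t2 Γ)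
  wl2_id1 : ∀ f g, t0 f = s0 g → wl2 f (id1 g) = id1 (comp f g)
  wl2_vcomp : ∀ f α β, t0 f = s0 (s1 α) → t1 α = s1 β →
    wl2 f (vcomp α β) = vcomp (wl2 f α) (wl2 f β)
  wl3_id2 : ∀ f α, t0 f = s0 (s1 α) → wl3 f (id2 α) = id2 (wl2 f α)
  wl3_tcomp : ∀ f Γ Δ, t0 f = s0 (s1 (s2 Γ)) → t2 Γ = s2 Δ →
    wl3 f (tcomp Γ Δ) = tcomp (wl3 f Γ) (wl3 f Δ)
  wl3_hcomp : ∀ f Γ Δ, t0 f = s0 (s1 (s2 Γ)) → t1 (s2 Γ) = s1 (s2 Δ) →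
    wl3 f (hcomp Γ Δ) = hcomp (wl3 f Γ) (wl3 f Δ)
  -- whiskering with a 1-cell behind is a strict 2-functor
  wr2 : C2 → C1 → C2
  wr3 : C3 → C1 → C3
  s1_wr2 : ∀ α g, t0 (s1 α) = s0 g → s1 (wr2 α g) = comp (s1 α) g
  t1_wr2 : ∀ α g, t0 (s1 α) = s0 g → t1 (wr2 α g) = comp (t1 α) g
  s2_wr3 : ∀ Γ g, t0 (s1 (s2 Γ)) = s0 g → s2 (wr3 Γ g) = wr2 (s2 Γ) g
  t2_wr3 : ∀ Γ g, t0 (s1 (s2 Γ)) = s0 g → t2 (wr3 Γ g) = wr2 (t2 Γ) g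
  wr2_id1 : ∀ f g, t0 f = s0 g → wr2 (id1 f) g = id1 (comp f g)
  wr2_vcomp : ∀ α β g, t0 (s1 α) = s0 g → t1 α = s1 β →
    wr2 (vcomp α β) g = vcomp (wr2 α g) (wr2 β g)
  wr3_id2 : ∀ α g, t0 (s1 α) = s0 g → wr3 (id2 α) g = id2 (wr2 α g)
  wr3_tcomp : ∀ Γ Δ g, t0 (s1 (s2 Γ)) = s0 g → t2 Γ = s2 Δ →
    wr3 (tcomp Γ Δ) g = tcomp (wr3 Γ g) (wr3 Δ g)
  wr3_hcomp : ∀ Γ Δ g, t0 (s1 (s2 Γ)) = s0 g → t1 (s2 Γ) = s1 (s2 Δ) →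
    wr3 (hcomp Γ Δ) g = hcomp (wr3 Γ g) (wr3 Δ g)
  -- whiskering is unital and associative
  wl2_id0 : ∀ α, wl2 (id0 (s0 (s1 α))) α = α
  wl3_id0 : ∀ Γ, wl3 (id0 (s0 (s1 (s2 Γ)))) Γ = Γ
  wr2_id0 : ∀ α, wr2 α (id0 (t0 (s1 α))) = α
  wr3_id0 : ∀ Γ, wr3 Γ (id0 (t0 (s1 (s2 Γ)))) = Γ
  wl2_comp : ∀ f g α, t0 f = s0 g → t0 g = s0 (s1 α) → wl2 (comp f g) α = wl2 f (wl2 g α)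
  wl3_comp : ∀ f g Γ, t0 f = s0 g → t0 g = s0 (s1 (s2 Γ)) →
    wl3 (comp f g) Γ = wl3 f (wl3 g Γ)
  wr2_comp : ∀ α g h, t0 (s1 α) = s0 g → t0 g = s0 h → wr2 α (comp g h) = wr2 (wr2 α g) h
  wr3_comp : ∀ Γ g h, t0 (s1 (s2 Γ)) = s0 g → t0 g = s0 h →
    wr3 Γ (comp g h) = wr3 (wr3 Γ g) h
  wl2_wr2 : ∀ f α g, t0 f = s0 (s1 α) → t0 (s1 α) = s0 g →
    wl2 f (wr2 α g) = wr2 (wl2 f α) g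
  wl3_wr3 : ∀ f Γ g, t0 f = s0 (s1 (s2 Γ)) → t0 (s1 (s2 Γ)) = s0 g →
    wl3 f (wr3 Γ g) = wr3 (wl3 f Γ) g
  -- the interchange isomorphisms
  γ : C2 → C2 → C3
  γinv : C2 → C2 → C3
  s2_γ : ∀ α β, t0 (s1 α) = s0 (s1 β) →
    s2 (γ α β) = vcomp (wr2 α (s1 β)) (wl2 (t1 α) β)
  t2_γ : ∀ α β, t0 (s1 α) = s0 (s1 β) →
    t2 (γ α β) = vcomp (wl2 (s1 α) β) (wr2 α (t1 β))
  s2_γinv : ∀ α β, t0 (s1 α) = s0 (s1 β) → s2 (γinv α β) = t2 (γ α β)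
  t2_γinv : ∀ α β, t0 (s1 α) = s0 (s1 β) → t2 (γinv α β) = s2 (γ α β)
  γ_γinv : ∀ α β, t0 (s1 α) = s0 (s1 β) → tcomp (γ α β) (γinv α β) = id2 (s2 (γ α β))
  γinv_γ : ∀ α β, t0 (s1 α) = s0 (s1 β) → tcomp (γinv α β) (γ α β) = id2 (t2 (γ α β))
  γ_natural_left : ∀ Γ β, t0 (s1 (s2 Γ)) = s0 (s1 β) →
    tcomp (hcomp (wr3 Γ (s1 β)) (id2 (wl2 (t1 (s2 Γ)) β))) (γ (t2 Γ) β) =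
      tcomp (γ (s2 Γ) β) (hcomp (id2 (wl2 (s1 (s2 Γ)) β)) (wr3 Γ (t1 β)))
  γ_natural_right : ∀ α Δ, t0 (s1 α) = s0 (s1 (s2 Δ)) →
    tcomp (hcomp (id2 (wr2 α (s1 (s2 Δ)))) (wl3 (t1 α) Δ)) (γ α (t2 Δ)) =
      tcomp (γ α (s2 Δ)) (hcomp (wl3 (s1 α) Δ) (id2 (wr2 α (t1 (s2 Δ)))))
  γ_id1_left : ∀ f β, t0 f = s0 (s1 β) → γ (id1 f) β = id2 (wl2 f β)
  γ_id1_right : ∀ α g, t0 (s1 α) = s0 g → γ α (id1 g) = id2 (wr2 α g)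
  γ_vcomp_left : ∀ α α' β, t1 α = s1 α' → t0 (s1 α) = s0 (s1 β) →
    γ (vcomp α α') β =
      tcomp (hcomp (id2 (wr2 α (s1 β))) (γ α' β)) (hcomp (γ α β) (id2 (wr2 α' (t1 β))))
  γ_vcomp_right : ∀ α β β', t1 β = s1 β' → t0 (s1 α) = s0 (s1 β) →
    γ α (vcomp β β') =
      tcomp (hcomp (γ α β) (id2 (wl2 (t1 α) β'))) (hcomp (id2 (wl2 (s1 α) β)) (γ α β'))
  γ_wl2_left : ∀ f α β, t0 f = s0 (s1 α) → t0 (s1 α) = s0 (s1 β) →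
    γ (wl2 f α) β = wl3 f (γ α β)
  γ_wr2_left : ∀ α g β, t0 (s1 α) = s0 g → t0 g = s0 (s1 β) →
    γ (wr2 α g) β = γ α (wl2 g β)
  γ_wr2_right : ∀ α β g, t0 (s1 α) = s0 (s1 β) → t0 (s1 β) = s0 g →
    γ α (wr2 β g) = wr3 (γ α β) g

namespace GrayCategory

attribute [simp] s0_t1 t0_t1 s1_t2 t1_t2 s0_id0 t0_id0 s1_id1 t1_id1 s2_id2 t2_id2 s0_comp t0_comp
  s1_vcomp t1_vcomp s2_tcomp t2_tcomp s2_hcomp t2_hcomp s1_wl2 t1_wl2 s2_wl3 t2_wl3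
  s1_wr2 t1_wr2 s2_wr3 t2_wr3 s2_γ t2_γ s2_γinv t2_γinv

variable (K : GrayCategory.{w₀, w₁, w₂, w₃})

/-- The objects of the hom-category `K(S, T)[p, q]`, for parallel 1-cells `p`, `q` from `S` to `T`:
the 2-cells from `p` to `q`. -/
structure HomCat (p q : K.C1) where
  cell : K.C2
  src : K.s1 cell = p
  tgt : K.t1 cell = q

/-- The category `K(S, T)[p, q]`: its arrows are the 3-cells. -/
instance (p q : K.C1) : CategoryTheory.Category (K.HomCat p q) where
  Hom α β := {Γ : K.C3 // K.s2 Γ = α.cell ∧ K.t2 Γ = β.cell}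
  id α := ⟨K.id2 α.cell, by simp, by simp⟩
  comp {α β δ} Γ Δ := ⟨K.tcomp Γ.1 Δ.1, by
    rw [K.s2_tcomp _ _ (Γ.2.2.trans Δ.2.1.symm), Γ.2.1], by
    rw [K.t2_tcomp _ _ (Γ.2.2.trans Δ.2.1.symm), Δ.2.2]⟩
  id_comp Γ := Subtype.ext ((congrArg (fun x => K.tcomp (K.id2 x) Γ.1) Γ.2.1.symm).trans
    (K.id2_tcomp _))
  comp_id Γ := Subtype.ext ((congrArg (fun x => K.tcomp Γ.1 (K.id2 x)) Γ.2.2.symm).trans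
    (K.tcomp_id2 _))
  assoc Γ Δ Θ := Subtype.ext (K.tcomp_assoc _ _ _ (Γ.2.2.trans Δ.2.1.symm)
    (Δ.2.2.trans Θ.2.1.symm))

/-- Whiskering of a 2-cell with 1-cells on both sides. -/
def whisk2 (f : K.C1) (α : K.C2) (g : K.C1) : K.C2 := K.wl2 f (K.wr2 α g)

/-- Whiskering of a 3-cell with 1-cells on both sides. -/
def whisk3 (f : K.C1) (Γ : K.C3) (g : K.C1) : K.C3 := K.wl3 f (K.wr3 Γ g)

variable {K}

theorem s1_whisk2 {f g : K.C1} {α : K.C2} (h1 : K.t0 f = K.s0 (K.s1 α))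
    (h2 : K.t0 (K.s1 α) = K.s0 g) :
    K.s1 (K.whisk2 f α g) = K.comp f (K.comp (K.s1 α) g) := by
  simp (maxDischargeDepth := 12) [whisk2, *]

theorem t1_whisk2 {f g : K.C1} {α : K.C2} (h1 : K.t0 f = K.s0 (K.s1 α))
    (h2 : K.t0 (K.s1 α) = K.s0 g) :
    K.t1 (K.whisk2 f α g) = K.comp f (K.comp (K.t1 α) g) := by
  simp (maxDischargeDepth := 12) [whisk2, *]

theorem s2_whisk3 {f g : K.C1} {Γ : K.C3} (h1 : K.t0 f = K.s0 (K.s1 (K.s2 Γ)))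
    (h2 : K.t0 (K.s1 (K.s2 Γ)) = K.s0 g) :
    K.s2 (K.whisk3 f Γ g) = K.whisk2 f (K.s2 Γ) g := by
  simp (maxDischargeDepth := 12) [whisk2, whisk3, *]

theorem t2_whisk3 {f g : K.C1} {Γ : K.C3} (h1 : K.t0 f = K.s0 (K.s1 (K.s2 Γ)))
    (h2 : K.t0 (K.s1 (K.s2 Γ)) = K.s0 g) :
    K.t2 (K.whisk3 f Γ g) = K.whisk2 f (K.t2 Γ) g := by
  simp (maxDischargeDepth := 12) [whisk2, whisk3, *]

theorem whisk3_id2 {f g : K.C1} {α : K.C2} (h1 : K.t0 f = K.s0 (K.s1 α))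
    (h2 : K.t0 (K.s1 α) = K.s0 g) :
    K.whisk3 f (K.id2 α) g = K.id2 (K.whisk2 f α g) := by
  simp (maxDischargeDepth := 12) [whisk2, whisk3, wl3_id2, wr3_id2, *]

theorem whisk3_tcomp {f g : K.C1} {Γ Δ : K.C3} (h1 : K.t0 f = K.s0 (K.s1 (K.s2 Γ)))
    (h2 : K.t0 (K.s1 (K.s2 Γ)) = K.s0 g) (h : K.t2 Γ = K.s2 Δ) :
    K.whisk3 f (K.tcomp Γ Δ) g = K.tcomp (K.whisk3 f Γ g) (K.whisk3 f Δ g) := by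
  have h3 : K.s1 (K.s2 Δ) = K.s1 (K.s2 Γ) := by rw [← h]; simp
  simp (maxDischargeDepth := 12) [whisk3, wl3_tcomp, wr3_tcomp, *]

theorem whisk3_hcomp {f g : K.C1} {Γ Δ : K.C3} (h1 : K.t0 f = K.s0 (K.s1 (K.s2 Γ)))
    (h2 : K.t0 (K.s1 (K.s2 Γ)) = K.s0 g) (h : K.t1 (K.s2 Γ) = K.s1 (K.s2 Δ)) :
    K.whisk3 f (K.hcomp Γ Δ) g = K.hcomp (K.whisk3 f Γ g) (K.whisk3 f Δ g) := by
  have h3 : K.s0 (K.s1 (K.s2 Δ)) = K.s0 (K.s1 (K.s2 Γ)) := by rw [← h]; simp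
  have h4 : K.t0 (K.s1 (K.s2 Δ)) = K.t0 (K.s1 (K.s2 Γ)) := by rw [← h]; simp
  simp (maxDischargeDepth := 12) [whisk3, wl3_hcomp, wr3_hcomp, *]

variable (K) in
/-- Two 2-cells `α`, `β` placed side by side with 1-cells in between: `u`, `α`, `v`, `β`, `w`. -/
structure Beside (u : K.C1) (α : K.C2) (v : K.C1) (β : K.C2) (w : K.C1) : Prop where
  hu : K.t0 u = K.s0 (K.s1 α)
  hα : K.t0 (K.s1 α) = K.s0 v
  hv : K.t0 v = K.s0 (K.s1 β)
  hβ : K.t0 (K.s1 β) = K.s0 w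

section

variable {u v w : K.C1} {α β : K.C2}

theorem s2_whisk3_γ (h : K.Beside u α v β w) :
    K.s2 (K.whisk3 u (K.γ α (K.wl2 v β)) w) =
      K.vcomp (K.whisk2 u α (K.comp v (K.comp (K.s1 β) w)))
        (K.whisk2 (K.comp u (K.comp (K.t1 α) v)) β w) := by
  obtain ⟨h1, h2, h3, h4⟩ := h
  simp (maxDischargeDepth := 12) [whisk2, whisk3, wl2_vcomp, wr2_vcomp, wl2_comp, wr2_comp, wl2_wr2, comp_assoc, *]

theorem t2_whisk3_γ (h : K.Beside u α v β w) :
    K.t2 (K.whisk3 u (K.γ α (K.wl2 v β)) w) =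
      K.vcomp (K.whisk2 (K.comp u (K.comp (K.s1 α) v)) β w)
        (K.whisk2 u α (K.comp v (K.comp (K.t1 β) w))) := by
  obtain ⟨h1, h2, h3, h4⟩ := h
  simp (maxDischargeDepth := 12) [whisk2, whisk3, wl2_vcomp, wr2_vcomp, wl2_comp, wr2_comp, wl2_wr2, comp_assoc, *]

theorem s2_whisk3_γinv (h : K.Beside u α v β w) :
    K.s2 (K.whisk3 u (K.γinv α (K.wl2 v β)) w) =
      K.vcomp (K.whisk2 (K.comp u (K.comp (K.s1 α) v)) β w)
        (K.whisk2 u α (K.comp v (K.comp (K.t1 β) w))) := by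
  obtain ⟨h1, h2, h3, h4⟩ := h
  simp (maxDischargeDepth := 12) [whisk2, whisk3, wl2_vcomp, wr2_vcomp, wl2_comp, wr2_comp, wl2_wr2, comp_assoc, *]

theorem t2_whisk3_γinv (h : K.Beside u α v β w) :
    K.t2 (K.whisk3 u (K.γinv α (K.wl2 v β)) w) =
      K.vcomp (K.whisk2 u α (K.comp v (K.comp (K.s1 β) w)))
        (K.whisk2 (K.comp u (K.comp (K.t1 α) v)) β w) := by
  obtain ⟨h1, h2, h3, h4⟩ := h
  simp (maxDischargeDepth := 12) [whisk2, whisk3, wl2_vcomp, wr2_vcomp, wl2_comp, wr2_comp, wl2_wr2, comp_assoc, *]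

theorem whisk3_γ_γinv (h : K.Beside u α v β w) :
    K.tcomp (K.whisk3 u (K.γ α (K.wl2 v β)) w) (K.whisk3 u (K.γinv α (K.wl2 v β)) w) =
      K.id2 (K.s2 (K.whisk3 u (K.γ α (K.wl2 v β)) w)) := by
  obtain ⟨h1, h2, h3, h4⟩ := h
  rw [← whisk3_tcomp (by simp (maxDischargeDepth := 12) [*]) (by simp (maxDischargeDepth := 12) [*]) (by simp (maxDischargeDepth := 12) [*]), K.γ_γinv _ _ (by simp (maxDischargeDepth := 12) [*]),
    whisk3_id2 (by simp (maxDischargeDepth := 12) [*]) (by simp (maxDischargeDepth := 12) [*]), s2_whisk3 (by simp (maxDischargeDepth := 12) [*]) (by simp (maxDischargeDepth := 12) [*])]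

theorem whisk3_γinv_γ (h : K.Beside u α v β w) :
    K.tcomp (K.whisk3 u (K.γinv α (K.wl2 v β)) w) (K.whisk3 u (K.γ α (K.wl2 v β)) w) =
      K.id2 (K.t2 (K.whisk3 u (K.γ α (K.wl2 v β)) w)) := by
  obtain ⟨h1, h2, h3, h4⟩ := h
  rw [← whisk3_tcomp (by simp (maxDischargeDepth := 12) [*]) (by simp (maxDischargeDepth := 12) [*]) (by simp (maxDischargeDepth := 12) [*]), K.γinv_γ _ _ (by simp (maxDischargeDepth := 12) [*]),
    whisk3_id2 (by simp (maxDischargeDepth := 12) [*]) (by simp (maxDischargeDepth := 12) [*]), t2_whisk3 (by simp (maxDischargeDepth := 12) [*]) (by simp (maxDischargeDepth := 12) [*])]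

/-- Naturality of the interchange isomorphism in both variables. -/
theorem γ_natural (Γ Δ : K.C3) (h : K.t0 (K.s1 (K.s2 Γ)) = K.s0 (K.s1 (K.s2 Δ))) :
    K.tcomp (K.hcomp (K.wr3 Γ (K.s1 (K.s2 Δ))) (K.wl3 (K.t1 (K.s2 Γ)) Δ)) (K.γ (K.t2 Γ) (K.t2 Δ)) =
      K.tcomp (K.γ (K.s2 Γ) (K.s2 Δ))
        (K.hcomp (K.wl3 (K.s1 (K.s2 Γ)) Δ) (K.wr3 Γ (K.t1 (K.s2 Δ)))) := by
  have e1 : K.hcomp (K.wr3 Γ (K.s1 (K.s2 Δ))) (K.wl3 (K.t1 (K.s2 Γ)) Δ) =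
      K.tcomp (K.hcomp (K.wr3 Γ (K.s1 (K.s2 Δ))) (K.id2 (K.wl2 (K.t1 (K.s2 Γ)) (K.s2 Δ))))
        (K.hcomp (K.id2 (K.wr2 (K.t2 Γ) (K.s1 (K.s2 Δ)))) (K.wl3 (K.t1 (K.s2 Γ)) Δ)) := by
    rw [← K.local_interchange _ _ _ _ (by simp (maxDischargeDepth := 12) [*]) (by simp (maxDischargeDepth := 12) [*]) (by simp (maxDischargeDepth := 12) [*])]
    congr 1
    · have := K.tcomp_id2 (K.wr3 Γ (K.s1 (K.s2 Δ)))
      rw [K.t2_wr3 _ _ h] at this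
      exact this.symm
    · have := K.id2_tcomp (K.wl3 (K.t1 (K.s2 Γ)) Δ)
      rw [K.s2_wl3 _ _ (by simp (maxDischargeDepth := 12) [*])] at this
      exact this.symm
  have e2 : K.hcomp (K.wl3 (K.s1 (K.s2 Γ)) Δ) (K.wr3 Γ (K.t1 (K.s2 Δ))) =
      K.tcomp (K.hcomp (K.id2 (K.wl2 (K.s1 (K.s2 Γ)) (K.s2 Δ))) (K.wr3 Γ (K.t1 (K.s2 Δ))))
        (K.hcomp (K.wl3 (K.s1 (K.s2 Γ)) Δ) (K.id2 (K.wr2 (K.t2 Γ) (K.t1 (K.s2 Δ))))) := by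
    rw [← K.local_interchange _ _ _ _ (by simp (maxDischargeDepth := 12) [*]) (by simp (maxDischargeDepth := 12) [*]) (by simp (maxDischargeDepth := 12) [*])]
    congr 1
    · have := K.id2_tcomp (K.wl3 (K.s1 (K.s2 Γ)) Δ)
      rw [K.s2_wl3 _ _ (by simp (maxDischargeDepth := 12) [*])] at this
      exact this.symm
    · have := K.tcomp_id2 (K.wr3 Γ (K.t1 (K.s2 Δ)))
      rw [K.t2_wr3 _ _ (by simp (maxDischargeDepth := 12) [*])] at this
      exact this.symm
  have n1 := K.γ_natural_right (K.t2 Γ) Δ (by simp (maxDischargeDepth := 12) [*])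
  have n2 := K.γ_natural_left Γ (K.s2 Δ) (by simp (maxDischargeDepth := 12) [*])
  simp only [s1_t2, t1_t2] at n1
  rw [e1, e2, K.tcomp_assoc _ _ _ (by simp (maxDischargeDepth := 12) [*]) (by simp (maxDischargeDepth := 12) [*]), n1,
    ← K.tcomp_assoc _ _ _ (by simp (maxDischargeDepth := 12) [*]) (by simp (maxDischargeDepth := 12) [*]), n2,
    K.tcomp_assoc _ _ _ (by simp (maxDischargeDepth := 12) [*]) (by simp (maxDischargeDepth := 12) [*])]

theorem whisk3_γ_natural {Γ Δ : K.C3} (h : K.Beside u (K.s2 Γ) v (K.s2 Δ) w) :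
    K.tcomp (K.hcomp (K.whisk3 u Γ (K.comp v (K.comp (K.s1 (K.s2 Δ)) w)))
        (K.whisk3 (K.comp u (K.comp (K.t1 (K.s2 Γ)) v)) Δ w))
        (K.whisk3 u (K.γ (K.t2 Γ) (K.wl2 v (K.t2 Δ))) w) =
      K.tcomp (K.whisk3 u (K.γ (K.s2 Γ) (K.wl2 v (K.s2 Δ))) w)
        (K.hcomp (K.whisk3 (K.comp u (K.comp (K.s1 (K.s2 Γ)) v)) Δ w)
        (K.whisk3 u Γ (K.comp v (K.comp (K.t1 (K.s2 Δ)) w)))) := by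
  obtain ⟨h1, h2, h3, h4⟩ := h
  have := congrArg (fun x => K.whisk3 u x w) (γ_natural Γ (K.wl3 v Δ) (by simp (maxDischargeDepth := 12) [*]))
  rw [whisk3_tcomp (by simp (maxDischargeDepth := 12) [*]) (by simp (maxDischargeDepth := 12) [*]) (by simp (maxDischargeDepth := 12) [*]),
    whisk3_tcomp (by simp (maxDischargeDepth := 12) [*]) (by simp (maxDischargeDepth := 12) [*]) (by simp (maxDischargeDepth := 12) [*])] at this
  simpa (maxDischargeDepth := 12) [whisk2, whisk3, wl3_hcomp, wr3_hcomp, wl3_comp, wr3_comp, wl3_wr3,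
    wl2_comp, wr2_comp, wl2_wr2, comp_assoc, *] using this

theorem whisk3_γ_vcomp {u z : K.C1} {α b d d' b' : K.C2} {Θ : K.C3}
    (hs : K.s2 Θ = K.vcomp b d) (ht : K.t2 Θ = K.vcomp d' b')
    (hb : K.t1 b = K.s1 d) (hd : K.t1 d' = K.s1 b') (hα : K.t0 (K.s1 α) = K.s0 (K.s1 b))
    (hu : K.t0 u = K.s0 (K.s1 α)) (hz : K.t0 (K.s1 b) = K.s0 z) :
    K.tcomp (K.hcomp (K.whisk3 u (K.γ α b) z) (K.id2 (K.whisk2 u (K.wl2 (K.t1 α) d) z)))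
      (K.tcomp (K.hcomp (K.id2 (K.whisk2 u (K.wl2 (K.s1 α) b) z)) (K.whisk3 u (K.γ α d) z))
        (K.hcomp (K.whisk3 u (K.wl3 (K.s1 α) Θ) z) (K.id2 (K.whisk2 u (K.wr2 α (K.t1 d)) z)))) =
    K.tcomp (K.hcomp (K.id2 (K.whisk2 u (K.wr2 α (K.s1 b)) z)) (K.whisk3 u (K.wl3 (K.t1 α) Θ) z))
      (K.tcomp (K.hcomp (K.whisk3 u (K.γ α d') z) (K.id2 (K.whisk2 u (K.wl2 (K.t1 α) b') z)))
        (K.hcomp (K.id2 (K.whisk2 u (K.wl2 (K.s1 α) d') z)) (K.whisk3 u (K.γ α b') z))) := by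
  have x0 : K.s1 (K.s2 Θ) = K.s1 b := by rw [hs, K.s1_vcomp _ _ hb]
  have x1 : K.t1 (K.s2 Θ) = K.t1 d := by rw [hs, K.t1_vcomp _ _ hb]
  have x2 : K.s1 d' = K.s1 b := by rw [← K.s1_vcomp _ _ hd, ← ht, K.s1_t2, x0]
  have x3 : K.t1 b' = K.t1 d := by rw [← K.t1_vcomp _ _ hd, ← ht, K.t1_t2, x1]
  have y1 : K.s0 (K.s1 d) = K.s0 (K.s1 b) := by rw [← hb]; simp
  have y2 : K.t0 (K.s1 d) = K.t0 (K.s1 b) := by rw [← hb]; simp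
  have y3 : K.s0 (K.s1 b') = K.s0 (K.s1 b) := by rw [← hd, K.s0_t1, x2]
  have y4 : K.t0 (K.s1 b') = K.t0 (K.s1 b) := by rw [← hd, K.t0_t1, x2]
  have n := K.γ_natural_right α Θ (by simp [*])
  rw [x0, x1, hs, ht, K.γ_vcomp_right _ _ _ hb hα, K.γ_vcomp_right _ _ _ hd (by simp [*]),
    K.tcomp_assoc _ _ _ (by simp (maxDischargeDepth := 12) [vcomp_assoc, *])
      (by simp (maxDischargeDepth := 12) [vcomp_assoc, wl2_vcomp, *])] at n
  have n' := congrArg (fun x => K.whisk3 u x z) n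
  rw [whisk3_tcomp, whisk3_tcomp, whisk3_tcomp, whisk3_tcomp, whisk3_hcomp, whisk3_hcomp,
    whisk3_hcomp, whisk3_hcomp, whisk3_hcomp, whisk3_hcomp, whisk3_id2, whisk3_id2, whisk3_id2,
    whisk3_id2, whisk3_id2, whisk3_id2] at n'
  · exact n'.symm
  all_goals simp (maxDischargeDepth := 12) [vcomp_assoc, wl2_vcomp, *]

theorem whisk3_γ_yangBaxter {u v w z : K.C1} {α β δ : K.C2} (h : K.Beside u α v β w)
    (h1 : K.t0 w = K.s0 (K.s1 δ)) (h2 : K.t0 (K.s1 δ) = K.s0 z) :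
    K.tcomp (K.hcomp (K.whisk3 u (K.γ α (K.wl2 v β)) (K.comp w (K.comp (K.s1 δ) z)))
          (K.id2 (K.whisk2 (K.comp u (K.comp (K.t1 α) (K.comp v (K.comp (K.t1 β) w)))) δ z)))
      (K.tcomp (K.hcomp (K.id2 (K.whisk2 (K.comp u (K.comp (K.s1 α) v)) β
            (K.comp w (K.comp (K.s1 δ) z))))
          (K.whisk3 u (K.γ α (K.wl2 (K.comp v (K.comp (K.t1 β) w)) δ)) z))
        (K.hcomp (K.whisk3 (K.comp u (K.comp (K.s1 α) v)) (K.γ β (K.wl2 w δ)) z)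
          (K.id2 (K.whisk2 u α (K.comp v (K.comp (K.t1 β) (K.comp w (K.comp (K.t1 δ) z)))))))) =
    K.tcomp (K.hcomp (K.id2 (K.whisk2 u α
            (K.comp v (K.comp (K.s1 β) (K.comp w (K.comp (K.s1 δ) z))))))
          (K.whisk3 (K.comp u (K.comp (K.t1 α) v)) (K.γ β (K.wl2 w δ)) z))
      (K.tcomp (K.hcomp (K.whisk3 u (K.γ α (K.wl2 (K.comp v (K.comp (K.s1 β) w)) δ)) z)
          (K.id2 (K.whisk2 (K.comp u (K.comp (K.t1 α) v)) β (K.comp w (K.comp (K.t1 δ) z)))))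
        (K.hcomp (K.id2 (K.whisk2 (K.comp u (K.comp (K.s1 α) (K.comp v (K.comp (K.s1 β) w)))) δ z))
          (K.whisk3 u (K.γ α (K.wl2 v β)) (K.comp w (K.comp (K.t1 δ) z))))) := by
  obtain ⟨h3, h4, h5, h6⟩ := h
  have key := whisk3_γ_vcomp (K := K) (u := u) (z := z) (α := α)
    (b := K.wl2 v (K.wr2 β (K.comp w (K.s1 δ)))) (d := K.wl2 v (K.wl2 (K.comp (K.t1 β) w) δ))
    (d' := K.wl2 v (K.wl2 (K.comp (K.s1 β) w) δ)) (b' := K.wl2 v (K.wr2 β (K.comp w (K.t1 δ))))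
    (Θ := K.wl3 v (K.γ β (K.wl2 w δ)))
    (by simp (maxDischargeDepth := 12) [wl2_vcomp, wl2_comp, *])
    (by simp (maxDischargeDepth := 12) [wl2_vcomp, wl2_comp, *])
    (by simp (maxDischargeDepth := 12) [comp_assoc, *])
    (by simp (maxDischargeDepth := 12) [comp_assoc, *])
    (by simp (maxDischargeDepth := 12) [*])
    (by simp (maxDischargeDepth := 12) [*])
    (by simp (maxDischargeDepth := 12) [*])
  convert key using 3 <;> clear key <;>
    simp (maxDischargeDepth := 12) [whisk2, whisk3, wl3_comp, wr3_comp, wl3_wr3, wl2_comp,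
      wr2_comp, wl2_wr2, γ_wr2_right, comp_assoc, *]

end

end GrayCategory

namespace PastingScheme

variable (G : PastingScheme.{u})

/-- The vertex `s_x` at which the boundary of the face `x` starts. -/
noncomputable def faceSrc (x : G.Face) : G.V := (G.exists_boundary x).choose

/-- The vertex `t_x` at which the boundary of the face `x` ends. -/
noncomputable def faceTgt (x : G.Face) : G.V := (G.exists_boundary x).choose_spec.choose

/-- The directed path of all edges which have the face `x` on their left (above them); for an
interior face this is the lowermost path `τ_x` of its boundary. -/
noncomputable def lower (x : G.Face) : List G.E :=
  (G.exists_boundary x).choose_spec.choose_spec.choose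

/-- The directed path of all edges which have the face `x` on their right (below them); for an
interior face this is the uppermost path `σ_x` of its boundary. -/
noncomputable def upper (x : G.Face) : List G.E :=
  (G.exists_boundary x).choose_spec.choose_spec.choose_spec.choose

theorem boundary_spec (x : G.Face) :
    (G.lower x ≠ [] ∧ G.IsPath (G.faceSrc x) (G.lower x) (G.faceTgt x) ∧
      ∀ e, e ∈ G.lower x ↔ G.left e = x) ∧
    (G.upper x ≠ [] ∧ G.IsPath (G.faceSrc x) (G.upper x) (G.faceTgt x) ∧
      ∀ e, e ∈ G.upper x ↔ G.right e = x) ∧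
    (x = G.ext → G.faceSrc x = G.s ∧ G.faceTgt x = G.t) :=
  (G.exists_boundary x).choose_spec.choose_spec.choose_spec.choose_spec

theorem isPath_lower (x : G.Face) : G.IsPath (G.faceSrc x) (G.lower x) (G.faceTgt x) :=
  (G.boundary_spec x).1.2.1

theorem isPath_upper (x : G.Face) : G.IsPath (G.faceSrc x) (G.upper x) (G.faceTgt x) :=
  (G.boundary_spec x).2.1.2.1

variable {G} in
theorem mem_lower {x : G.Face} {e : G.E} : e ∈ G.lower x ↔ G.left e = x :=
  (G.boundary_spec x).1.2.2 e

variable {G} in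
theorem mem_upper {x : G.Face} {e : G.E} : e ∈ G.upper x ↔ G.right e = x :=
  (G.boundary_spec x).2.1.2.2 e

theorem upper_ne_nil (x : G.Face) : G.upper x ≠ [] := (G.boundary_spec x).2.1.1

/-- The interior faces. -/
abbrev IFace : Type u := {x : G.Face // x ≠ G.ext}

/-- The top path of the pasting scheme: the edges below the exterior face. -/
noncomputable def top : List G.E := G.lower G.ext

/-- The bottom path of the pasting scheme: the edges above the exterior face. -/
noncomputable def bot : List G.E := G.upper G.ext

/-- The relation `F ◁ H`: the paths `τ_F` and `σ_H` share an edge. -/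
def Precedes (F H : G.IFace) : Prop := ∃ e, e ∈ G.lower F.1 ∧ e ∈ G.upper H.1

/-- Strict linear extensions of `◁`, as lists of all interior faces: everything that precedes a
face `F` stands strictly before `F` in the list. -/
@[ext]
structure LinExt where
  toList : List G.IFace
  nodup : toList.Nodup
  mem_all : ∀ F, F ∈ toList
  order : ∀ U F V, toList = U ++ F :: V → ∀ H, G.Precedes H F → H ∈ U

open Classical in
/-- The part of a path in front of the uppermost path of `F`. -/
noncomputable def before (p : List G.E) (F : G.IFace) : List G.E :=
  p.takeWhile (fun e => decide (G.right e ≠ F.1))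

/-- The part of a path behind the uppermost path of `F`. -/
noncomputable def after (p : List G.E) (F : G.IFace) : List G.E :=
  p.drop ((G.before p F).length + (G.upper F.1).length)

/-- Replace the uppermost path of `F` by the lowermost path of `F` in a path `p`. -/
noncomputable def cross (p : List G.E) (F : G.IFace) : List G.E :=
  G.before p F ++ (G.lower F.1 ++ G.after p F)

variable {G}

theorem isPath_nodup {a b : G.V} {p : List G.E} (h : G.IsPath a p b) : p.Nodup := by
  induction p generalizing a with
  | nil => simp
  | cons e p ih =>
    refine List.nodup_cons.2 ⟨fun he => ?_, ih h.2⟩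
    obtain ⟨x, y, rfl⟩ := List.append_of_mem he
    obtain ⟨c, h1, h2⟩ := (G.isPath_append _ _ _ _).1 h.2
    have : G.IsPath (G.src e) (e :: x) (G.src e) := ⟨rfl, h2.1 ▸ h1⟩
    simpa using G.acyclic _ _ this

theorem isPath_ext {a b c : G.V} {p q : List G.E} (hp : G.IsPath a p b) (hq : G.IsPath a q c)
    (h : ∀ e, e ∈ p ↔ e ∈ q) : p = q := by
  induction p generalizing a q with
  | nil =>
    cases q with
    | nil => rfl
    | cons e q => simpa using (h e).2 (by simp)
  | cons e p ih =>
    cases q with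
    | nil => simpa using (h e).1 (by simp)
    | cons e' q =>
      have hee : e = e' := by
        by_contra hne
        have he : e ∈ q := by
          rcases List.mem_cons.1 ((h e).1 (by simp)) with h1 | h1
          · exact absurd h1 hne
          · exact h1
        obtain ⟨x, y, rfl⟩ := List.append_of_mem he
        obtain ⟨d, h1, h2⟩ := (G.isPath_append _ _ _ _).1 hq.2
        have hd : d = a := h2.1.symm.trans hp.1
        subst hd
        have : G.IsPath d (e' :: x) d := ⟨hq.1, h1⟩
        simpa using G.acyclic _ _ this
      subst hee
      have n1 := List.nodup_cons.1 (isPath_nodup hp)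
      have n2 := List.nodup_cons.1 (isPath_nodup hq)
      congr 1
      refine ih hp.2 hq.2 fun f => ?_
      have := h f
      by_cases hf : f = e
      · subst hf
        simp [n1.1, n2.1]
      · simpa [hf] using this

theorem isPath_infix {a b c d : G.V} {p q : List G.E} (hp : G.IsPath a p b)
    (hq : G.IsPath c q d) (hne : q ≠ []) (h : ∀ e ∈ q, e ∈ p) : ∃ u w, p = u ++ (q ++ w) := by
  have key : ∀ (q : List G.E) (c : G.V) (u p' : List G.E), G.IsPath c q d →
      G.IsPath a (u ++ p') b → G.IsPath c p' b → (∀ e ∈ q, e ∈ u ++ p') → ∃ w, p' = q ++ w := by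
    intro q
    induction q with
    | nil => intro c u p' _ _ _ _; exact ⟨p', rfl⟩
    | cons e q ih =>
      intro c u p' hq hup hp' h
      have hep : e ∈ p' := by
        rcases List.mem_append.1 (h e (by simp)) with h1 | h1
        · exfalso
          obtain ⟨x, y, rfl⟩ := List.append_of_mem h1
          obtain ⟨m, h2, h3⟩ := (G.isPath_append _ _ _ _).1 hup
          obtain ⟨n, -, h5⟩ := (G.isPath_append _ _ _ _).1 h2
          have hmc : m = c := by
            cases p' with
            | nil =>
              exact (h3 : m = b).trans (hp' : c = b).symm
            | cons f p' => exact h3.1.symm.trans hp'.1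
          have : G.IsPath c (e :: y) c := ⟨hq.1, hmc ▸ h5.2⟩
          simpa using G.acyclic _ _ this
        · exact h1
      obtain ⟨x, y, rfl⟩ := List.append_of_mem hep
      obtain ⟨m, h2, h3⟩ := (G.isPath_append _ _ _ _).1 hp'
      have hm : m = c := h3.1.symm.trans hq.1
      subst hm
      have hx := G.acyclic _ _ h2
      subst hx
      obtain ⟨w, hw⟩ := ih (G.tgt e) (u ++ [e]) y hq.2 (by simpa using hup) h3.2
        (fun f hf => by simpa using h f (List.mem_cons_of_mem _ hf))
      exact ⟨w, by simp [hw]⟩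
  cases q with
  | nil => exact absurd rfl hne
  | cons e q =>
    obtain ⟨u, y, hu⟩ := List.append_of_mem (h e (by simp))
    rw [hu] at hp h
    obtain ⟨m, h2, h3⟩ := (G.isPath_append _ _ _ _).1 hp
    have hm : m = c := h3.1.symm.trans hq.1
    subst hm
    obtain ⟨w, hw⟩ := key (e :: q) m u (e :: y) hq hp h3 h
    exact ⟨u, w, by rw [hu, hw]⟩

theorem before_eq {a b : G.V} {u w : List G.E} {F : G.IFace}
    (h : G.IsPath a (u ++ (G.upper F.1 ++ w)) b) : G.before (u ++ (G.upper F.1 ++ w)) F = u := by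
  have hn := isPath_nodup h
  obtain ⟨e, l, hl⟩ := List.exists_cons_of_ne_nil (G.upper_ne_nil F.1)
  have he : G.right e = F.1 := mem_upper.1 (by rw [hl]; simp)
  unfold before
  rw [List.takeWhile_append_of_pos, hl]
  · simp [he]
  · intro f hf
    simp only [decide_eq_true_eq]
    intro hfF
    have := mem_upper.2 hfF
    exact (List.disjoint_of_nodup_append hn) hf (List.mem_append_left _ this)

theorem after_eq {a b : G.V} {u w : List G.E} {F : G.IFace}
    (h : G.IsPath a (u ++ (G.upper F.1 ++ w)) b) : G.after (u ++ (G.upper F.1 ++ w)) F = w := by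
  unfold after
  rw [before_eq h, ← List.append_assoc, ← List.length_append, List.drop_left]

theorem cross_eq {a b : G.V} {u w : List G.E} {F : G.IFace}
    (h : G.IsPath a (u ++ (G.upper F.1 ++ w)) b) :
    G.cross (u ++ (G.upper F.1 ++ w)) F = u ++ (G.lower F.1 ++ w) := by
  unfold cross
  rw [before_eq h, after_eq h]

theorem isPath_split {a b : G.V} {u w : List G.E} {F : G.Face}
    (h : G.IsPath a (u ++ (G.upper F ++ w)) b) :
    G.IsPath a u (G.faceSrc F) ∧ G.IsPath (G.faceTgt F) w b := by
  obtain ⟨c, h1, h2⟩ := (G.isPath_append _ _ _ _).1 h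
  obtain ⟨d, h3, h4⟩ := (G.isPath_append _ _ _ _).1 h2
  have hc : c = G.faceSrc F := by
    have h5 := G.isPath_upper F
    obtain ⟨e, l, hl⟩ := List.exists_cons_of_ne_nil (G.upper_ne_nil F)
    rw [hl] at h3 h5
    exact h3.1.symm.trans h5.1
  subst hc
  rw [G.isPath_inj h3 (G.isPath_upper F)] at h4
  exact ⟨h1, h4⟩

theorem isPath_cross {a b : G.V} {u w : List G.E} {F : G.Face}
    (h : G.IsPath a (u ++ (G.upper F ++ w)) b) : G.IsPath a (u ++ (G.lower F ++ w)) b :=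
  (G.isPath_append _ _ _ _).2 ⟨_, (isPath_split h).1,
    (G.isPath_append _ _ _ _).2 ⟨_, G.isPath_lower F, (isPath_split h).2⟩⟩

/-- `p` is the path reached from the top path after the faces in the list `U` were crossed. -/
structure Front (U : List G.IFace) (p : List G.E) : Prop where
  path : G.IsPath G.s p G.t
  mem : ∀ e, e ∈ p ↔ (G.left e = G.ext ∨ ∃ F ∈ U, G.left e = F.1) ∧ ¬ ∃ F ∈ U, G.right e = F.1

/-- The face `F` can be crossed directly after the faces in the list `U`. -/
structure Enabled (U : List G.IFace) (F : G.IFace) : Prop where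
  notMem : F ∉ U
  up : ∀ H, G.Precedes H F → H ∈ U
  down : ∀ H ∈ U, ¬ G.Precedes F H
  irrefl : ¬ G.Precedes F F

theorem front_nil : Front [] G.top := by
  obtain ⟨h1, h2⟩ := (G.boundary_spec G.ext).2.2 rfl
  have := G.isPath_lower G.ext
  rw [h1, h2] at this
  exact ⟨this, fun e => by simp [top, mem_lower]⟩

theorem Front.upper_subset {U : List G.IFace} {p : List G.E} {F : G.IFace} (hp : Front U p)
    (hF : Enabled U F) : ∀ e ∈ G.upper F.1, e ∈ p := by
  intro e he
  refine (hp.mem e).2 ⟨?_, ?_⟩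
  · by_cases h : G.left e = G.ext
    · exact Or.inl h
    · exact Or.inr ⟨⟨G.left e, h⟩, hF.up _ ⟨e, mem_lower.2 rfl, he⟩, rfl⟩
  · rintro ⟨H, hH, h⟩
    rw [mem_upper.1 he] at h
    exact hF.notMem ((Subtype.ext h : F = H) ▸ hH)

theorem Front.split {U : List G.IFace} {p : List G.E} {F : G.IFace} (hp : Front U p)
    (hF : Enabled U F) : ∃ u w, p = u ++ (G.upper F.1 ++ w) :=
  isPath_infix hp.path (G.isPath_upper F.1) (G.upper_ne_nil F.1) (hp.upper_subset hF)

theorem Front.cross {U : List G.IFace} {p : List G.E} {F : G.IFace} (hp : Front U p)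
    (hF : Enabled U F) : Front (U ++ [F]) (G.cross p F) := by
  obtain ⟨u, w, rfl⟩ := hp.split hF
  rw [cross_eq hp.path]
  refine ⟨isPath_cross hp.path, fun e => ?_⟩
  have hm := hp.mem e
  have hn := isPath_nodup hp.path
  have hu : e ∈ G.lower F.1 ↔ G.left e = F.1 := mem_lower
  have hu' : e ∈ G.upper F.1 ↔ G.right e = F.1 := mem_upper
  simp only [List.mem_append] at hm ⊢
  have e1 : (∃ H, (H ∈ U ∨ H ∈ [F]) ∧ G.left e = H.1) ↔
      (∃ H ∈ U, G.left e = H.1) ∨ G.left e = F.1 := by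
    simp [or_and_right, exists_or]
  have e2 : (∃ H, (H ∈ U ∨ H ∈ [F]) ∧ G.right e = H.1) ↔
      (∃ H ∈ U, G.right e = H.1) ∨ G.right e = F.1 := by
    simp [or_and_right, exists_or]
  rw [e1, e2]
  have d1 : e ∈ u → ¬ G.right e = F.1 := fun h h' =>
    (List.disjoint_of_nodup_append hn) h (List.mem_append_left _ (hu'.2 h'))
  have d2 : e ∈ w → ¬ G.right e = F.1 := fun h h' =>
    (List.disjoint_of_nodup_append (List.nodup_append.1 hn).2.1) (hu'.2 h') h
  have d3 : G.left e = F.1 → ¬ G.right e = F.1 := fun h h' =>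
    hF.irrefl ⟨e, hu.2 h, hu'.2 h'⟩
  have d4 : G.left e = F.1 → ¬ ∃ H ∈ U, G.right e = H.1 := by
    rintro h ⟨H, hH, h'⟩
    exact hF.down H hH ⟨e, hu.2 h, mem_upper.2 h'⟩
  rw [hu'] at hm
  rw [hu]
  clear hu hu' e1 e2
  generalize (e ∈ u) = p1 at *
  generalize (e ∈ w) = p2 at *
  generalize (G.left e = F.1) = p3 at *
  generalize (G.right e = F.1) = p4 at *
  generalize (G.left e = G.ext) = p5 at *
  generalize (∃ H ∈ U, G.left e = H.1) = p6 at *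
  generalize (∃ H ∈ U, G.right e = H.1) = p7 at *
  clear hn hp hF
  tauto

theorem LinExt.enabled (x : G.LinExt) {U V : List G.IFace} {F : G.IFace}
    (h : x.toList = U ++ F :: V) : Enabled U F := by
  have hn := x.nodup
  rw [h] at hn
  have hF : F ∉ U := fun hF => (List.disjoint_of_nodup_append hn) hF (by simp)
  refine ⟨hF, fun H hH => x.order U F V h H hH, fun H hH hFH => ?_,
    fun hFF => hF (x.order U F V h F hFF)⟩
  obtain ⟨U₁, U₂, rfl⟩ := List.append_of_mem hH
  exact hF (List.mem_append_left _ (x.order U₁ H (U₂ ++ F :: V) (by rw [h]; simp) F hFH))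

/-- `l` is a sequence of faces that can be crossed one after the other, beginning from `p`. -/
def Valid : List G.E → List G.IFace → Prop
  | p, [] => G.IsPath G.s p G.t
  | p, F :: l => (∃ u w, p = u ++ (G.upper F.1 ++ w)) ∧ G.IsPath G.s p G.t ∧ Valid (G.cross p F) l

theorem Valid.path {p : List G.E} {l : List G.IFace} (h : Valid p l) : G.IsPath G.s p G.t := by
  cases l with
  | nil => exact h
  | cons F l => exact h.2.1

theorem valid_append {p : List G.E} {l m : List G.IFace} :
    Valid p (l ++ m) ↔ Valid p l ∧ Valid (l.foldl G.cross p) m := by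
  induction l generalizing p with
  | nil => exact ⟨fun h => ⟨h.path, h⟩, fun h => h.2⟩
  | cons F l ih => simp [Valid, ih, and_assoc]

theorem LinExt.front (x : G.LinExt) {U V : List G.IFace} (h : x.toList = U ++ V) :
    Front U (U.foldl G.cross G.top) := by
  induction U using List.reverseRecOn generalizing V with
  | nil => exact front_nil
  | append_singleton U F ih =>
    have h' : x.toList = U ++ F :: V := by simpa using h
    simpa using (ih h').cross (x.enabled h')

theorem LinExt.valid_aux (x : G.LinExt) {U V : List G.IFace} (h : x.toList = U ++ V) :
    Valid (U.foldl G.cross G.top) V := by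
  induction V generalizing U with
  | nil => exact (x.front h).path
  | cons F V ih =>
    refine ⟨(x.front h).split (x.enabled h), (x.front h).path, ?_⟩
    simpa using ih (U := U ++ [F]) (by simpa using h)

theorem LinExt.valid (x : G.LinExt) : Valid G.top x.toList :=
  x.valid_aux (U := []) rfl

theorem LinExt.foldl_eq_bot (x : G.LinExt) : x.toList.foldl G.cross G.top = G.bot := by
  have hf := x.front (U := x.toList) (V := []) (by simp)
  obtain ⟨h1, h2⟩ := (G.boundary_spec G.ext).2.2 rfl
  have h3 := G.isPath_upper G.ext
  rw [h1, h2] at h3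
  refine isPath_ext hf.path h3 fun e => ?_
  rw [hf.mem, bot, mem_upper]
  constructor
  · rintro ⟨-, h⟩
    by_contra hc
    exact h ⟨⟨G.right e, hc⟩, x.mem_all _, rfl⟩
  · intro h
    refine ⟨?_, ?_⟩
    · by_cases hl : G.left e = G.ext
      · exact Or.inl hl
      · exact Or.inr ⟨⟨G.left e, hl⟩, x.mem_all _, rfl⟩
    · rintro ⟨F, -, hF⟩
      exact F.2 (hF.symm.trans h)

theorem infix_disjoint {α : Type*} {u A r u' q w' : List α}
    (h : u' ++ (q ++ w') = u ++ (A ++ r)) (hA : A ≠ []) (hq : q ≠ []) (hd : ∀ e ∈ q, e ∉ A) :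
    (∃ m, u = u' ++ (q ++ m)) ∨ ∃ m, r = m ++ (q ++ w') := by
  obtain ⟨a, A', rfl⟩ := List.exists_cons_of_ne_nil hA
  obtain ⟨b, q', rfl⟩ := List.exists_cons_of_ne_nil hq
  rcases List.append_eq_append_iff.1 h with ⟨m, h1, h2⟩ | ⟨m, h1, h2⟩
  · rcases List.append_eq_append_iff.1 h2 with ⟨k, h3, h4⟩ | ⟨k, h3, h4⟩
    · exact Or.inl ⟨k, by rw [h1, h3]⟩
    · cases k with
      | nil => exact Or.inl ⟨[], by rw [h1]; simpa using h3.symm⟩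
      | cons c k =>
        have hc : a = c := by simpa using congrArg List.head? h4
        subst hc
        exact absurd (by simp) (hd a (by rw [h3]; simp))
  · rcases List.append_eq_append_iff.1 h2 with ⟨k, h3, h4⟩ | ⟨k, h3, h4⟩
    · exact Or.inr ⟨k, h4⟩
    · cases k with
      | nil => exact Or.inr ⟨[], by simpa using h4.symm⟩
      | cons c k =>
        have hc : b = c := by simpa using congrArg List.head? h4
        subst hc
        exact absurd (by rw [h3]; simp) (hd b (by simp))

theorem upper_disjoint {F H : G.IFace} (h : F ≠ H) : ∀ e ∈ G.upper H.1, e ∉ G.upper F.1 := by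
  intro e h1 h2
  exact h (Subtype.ext ((mem_upper.1 h2).symm.trans (mem_upper.1 h1)))

/-- Two faces which can both be crossed from the path `p` lie side by side along `p`. -/
theorem Front.two {U : List G.IFace} {p : List G.E} {F H : G.IFace} (hp : Front U p)
    (hF : Enabled U F) (hH : Enabled U H) (hne : F ≠ H) :
    (∃ u v w, p = u ++ (G.upper F.1 ++ (v ++ (G.upper H.1 ++ w)))) ∨
    (∃ u v w, p = u ++ (G.upper H.1 ++ (v ++ (G.upper F.1 ++ w)))) := by
  obtain ⟨u, w, h1⟩ := hp.split hF
  obtain ⟨u', w', h2⟩ := hp.split hH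
  rcases infix_disjoint (h2.symm.trans h1) (G.upper_ne_nil _) (G.upper_ne_nil _)
    (upper_disjoint hne) with ⟨m, hm⟩ | ⟨m, hm⟩
  · exact Or.inr ⟨u', m, w, by rw [h1, hm]; simp⟩
  · exact Or.inl ⟨u, m, w', by rw [h1, hm]⟩

end PastingScheme

namespace GrayCategory

variable {K : GrayCategory.{w₀, w₁, w₂, w₃}}

/-- Inverses of naturality squares of 3-cells. -/
theorem tcomp_inv_square {X Y γ γ' δ δ' : K.C3} (h : K.tcomp X γ' = K.tcomp γ Y)
    (h1 : K.tcomp δ γ = K.id2 (K.t2 γ)) (h2 : K.tcomp γ' δ' = K.id2 (K.s2 γ'))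
    (h3 : K.t2 X = K.s2 γ') (h4 : K.t2 γ = K.s2 Y) (h5 : K.t2 δ = K.s2 γ)
    (h6 : K.t2 γ' = K.s2 δ') :
    K.tcomp Y δ' = K.tcomp δ X := by
  have e1 : K.tcomp δ (K.tcomp X γ') = Y := by
    rw [h, ← K.tcomp_assoc _ _ _ h5 h4, h1, h4, K.id2_tcomp]
  have hX : K.s2 X = K.s2 γ := by
    rw [← K.s2_tcomp _ _ h3, h, K.s2_tcomp _ _ h4]
  rw [← e1, K.tcomp_assoc _ _ _ (by rw [h5, K.s2_tcomp _ _ h3, hX]) (by rw [K.t2_tcomp _ _ h3, h6]),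
    K.tcomp_assoc _ _ _ h3 h6, h2, ← h3, K.tcomp_id2]

variable (K) in
/-- Whiskering of a 3-cell with 2-cells on both sides. -/
def sand (A : K.C2) (Γ : K.C3) (B : K.C2) : K.C3 := K.hcomp (K.id2 A) (K.hcomp Γ (K.id2 B))

theorem s2_sand {A B : K.C2} {Γ : K.C3} (h1 : K.t1 A = K.s1 (K.s2 Γ))
    (h2 : K.t1 (K.s2 Γ) = K.s1 B) : K.s2 (K.sand A Γ B) = K.vcomp A (K.vcomp (K.s2 Γ) B) := by
  simp (maxDischargeDepth := 12) [sand, *]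

theorem t2_sand {A B : K.C2} {Γ : K.C3} (h1 : K.t1 A = K.s1 (K.s2 Γ))
    (h2 : K.t1 (K.s2 Γ) = K.s1 B) : K.t2 (K.sand A Γ B) = K.vcomp A (K.vcomp (K.t2 Γ) B) := by
  simp (maxDischargeDepth := 12) [sand, *]

theorem id2_tcomp_id2 (A : K.C2) : K.tcomp (K.id2 A) (K.id2 A) = K.id2 A := by
  have := K.id2_tcomp (K.id2 A)
  rwa [K.s2_id2] at this

theorem sand_tcomp {A B : K.C2} {Γ Δ : K.C3} (h1 : K.t1 A = K.s1 (K.s2 Γ))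
    (h2 : K.t1 (K.s2 Γ) = K.s1 B) (h : K.t2 Γ = K.s2 Δ) :
    K.sand A (K.tcomp Γ Δ) B = K.tcomp (K.sand A Γ B) (K.sand A Δ B) := by
  have h3 : K.s1 (K.s2 Δ) = K.s1 (K.s2 Γ) := by rw [← h]; simp
  have h4 : K.t1 (K.s2 Δ) = K.t1 (K.s2 Γ) := by rw [← h]; simp
  unfold sand
  rw [← K.local_interchange, id2_tcomp_id2, ← K.local_interchange, id2_tcomp_id2]
  all_goals simp (maxDischargeDepth := 12) [*]

theorem sand_id2 {A B D : K.C2} (h1 : K.t1 A = K.s1 D) (h2 : K.t1 D = K.s1 B) :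
    K.sand A (K.id2 D) B = K.id2 (K.vcomp A (K.vcomp D B)) := by
  simp (maxDischargeDepth := 12) [sand, hcomp_id2, *]

theorem sand_natural {A A' B B' : K.C2} {ΘA ΘB X Y γ γ' : K.C3} (h : K.tcomp X γ' = K.tcomp γ Y)
    (a : K.s2 ΘA = A) (a' : K.t2 ΘA = A') (b : K.s2 ΘB = B) (b' : K.t2 ΘB = B')
    (h1 : K.t2 X = K.s2 γ') (h2 : K.t2 γ = K.s2 Y) (h3 : K.t1 A = K.s1 (K.s2 X))
    (h4 : K.t1 (K.s2 X) = K.s1 B) :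
    K.tcomp (K.hcomp ΘA (K.hcomp X ΘB)) (K.sand A' γ' B') =
      K.tcomp (K.sand A γ B) (K.hcomp ΘA (K.hcomp Y ΘB)) := by
  subst a a' b b'
  have h5 : K.s2 X = K.s2 γ := by rw [← K.s2_tcomp _ _ h1, h, K.s2_tcomp _ _ h2]
  have h6 : K.s1 (K.s2 γ') = K.s1 (K.s2 X) := by rw [← h1]; simp
  have h7 : K.t1 (K.s2 γ') = K.t1 (K.s2 X) := by rw [← h1]; simp
  have h8 : K.s1 (K.s2 Y) = K.s1 (K.s2 X) := by rw [← h2, h5]; simp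
  have h9 : K.t1 (K.s2 Y) = K.t1 (K.s2 X) := by rw [← h2, h5]; simp
  have h10 : K.s1 (K.s2 γ) = K.s1 (K.s2 X) := by rw [h5]
  have h11 : K.t1 (K.s2 γ) = K.t1 (K.s2 X) := by rw [h5]
  unfold sand
  rw [← K.local_interchange, ← K.local_interchange, ← K.local_interchange, ← K.local_interchange,
    K.tcomp_id2, K.tcomp_id2, K.id2_tcomp, K.id2_tcomp, h]
  all_goals clear h h5
  all_goals simp (maxDischargeDepth := 12) [*]

theorem sand_far {A B C : K.C2} {S T : K.C3} (h1 : K.t1 A = K.s1 (K.s2 S))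
    (h2 : K.t1 (K.s2 S) = K.s1 B) (h3 : K.t1 B = K.s1 (K.s2 T)) (h4 : K.t1 (K.s2 T) = K.s1 C) :
    K.tcomp (K.sand A S (K.vcomp B (K.vcomp (K.s2 T) C)))
        (K.sand (K.vcomp A (K.vcomp (K.t2 S) B)) T C) =
      K.tcomp (K.sand (K.vcomp A (K.vcomp (K.s2 S) B)) T C)
        (K.sand A S (K.vcomp B (K.vcomp (K.t2 T) C))) := by
  have e1 : K.sand A S (K.vcomp B (K.vcomp (K.s2 T) C)) = K.hcomp (K.id2 A) (K.hcomp S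
      (K.hcomp (K.id2 B) (K.hcomp (K.id2 (K.s2 T)) (K.id2 C)))) := by
    simp (maxDischargeDepth := 12) [sand, hcomp_id2, *]
  have e2 : K.sand A S (K.vcomp B (K.vcomp (K.t2 T) C)) = K.hcomp (K.id2 A) (K.hcomp S
      (K.hcomp (K.id2 B) (K.hcomp (K.id2 (K.t2 T)) (K.id2 C)))) := by
    simp (maxDischargeDepth := 12) [sand, hcomp_id2, *]
  have e3 : K.sand (K.vcomp A (K.vcomp (K.t2 S) B)) T C = K.hcomp (K.id2 A)
      (K.hcomp (K.id2 (K.t2 S)) (K.hcomp (K.id2 B) (K.hcomp T (K.id2 C)))) := by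
    unfold sand
    rw [← K.hcomp_id2, ← K.hcomp_id2, K.hcomp_assoc, K.hcomp_assoc]
    all_goals simp (maxDischargeDepth := 12) [*]
  have e4 : K.sand (K.vcomp A (K.vcomp (K.s2 S) B)) T C = K.hcomp (K.id2 A)
      (K.hcomp (K.id2 (K.s2 S)) (K.hcomp (K.id2 B) (K.hcomp T (K.id2 C)))) := by
    unfold sand
    rw [← K.hcomp_id2, ← K.hcomp_id2, K.hcomp_assoc, K.hcomp_assoc]
    all_goals simp (maxDischargeDepth := 12) [*]
  rw [e1, e2, e3, e4]
  rw [← K.local_interchange, ← K.local_interchange, ← K.local_interchange, ← K.local_interchange,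
    ← K.local_interchange, ← K.local_interchange, ← K.local_interchange, ← K.local_interchange,
    K.tcomp_id2, K.id2_tcomp, K.tcomp_id2, K.id2_tcomp]
  all_goals clear e1 e2 e3 e4
  all_goals simp (maxDischargeDepth := 12) [*]

/-- The composite 1-cell of a directed path of labelled edges that starts at the vertex `a`. -/
def compPath (K : GrayCategory.{w₀, w₁, w₂, w₃}) {M : DirectedMap.{u}} (vert : M.V → K.C0)
    (edge : M.E → K.C1) : M.V → List M.E → K.C1
  | a, [] => K.id0 (vert a)
  | _, e :: l => K.comp (edge e) (compPath K vert edge (M.tgt e) l)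

end GrayCategory

/-- A labelling of a pasting scheme in a Gray-category: 0-cells on the vertices, 1-cells on the
edges and 2-cells on the interior faces, with matching sources and targets. The 2-cell of a face
goes from the composite of its uppermost path to the composite of its lowermost path. -/
structure Labelling (G : PastingScheme.{u}) (K : GrayCategory.{w₀, w₁, w₂, w₃}) where
  vert : G.V → K.C0
  edge : G.E → K.C1
  cell : G.IFace → K.C2
  edge_src : ∀ e, K.s0 (edge e) = vert (G.src e)
  edge_tgt : ∀ e, K.t0 (edge e) = vert (G.tgt e)
  cell_src : ∀ F, K.s1 (cell F) = K.compPath vert edge (G.faceSrc F.1) (G.upper F.1)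
  cell_tgt : ∀ F, K.t1 (cell F) = K.compPath vert edge (G.faceSrc F.1) (G.lower F.1)

open PastingScheme GrayCategory

namespace Labelling

variable {G : PastingScheme.{u}} {K : GrayCategory.{w₀, w₁, w₂, w₃}} (L : Labelling G K)

/-- The composite 1-cell of a directed path from `a`. -/
abbrev path (a : G.V) (l : List G.E) : K.C1 := K.compPath L.vert L.edge a l

theorem s0_path {a b : G.V} {l : List G.E} (h : G.IsPath a l b) :
    K.s0 (L.path a l) = L.vert a := by
  induction l generalizing a with
  | nil => exact K.s0_id0 _
  | cons e l ih =>
    change K.s0 (K.comp (L.edge e) (L.path (G.tgt e) l)) = _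
    rw [K.s0_comp _ _ (by rw [L.edge_tgt, ih h.2]), L.edge_src, h.1]

theorem t0_path {a b : G.V} {l : List G.E} (h : G.IsPath a l b) :
    K.t0 (L.path a l) = L.vert b := by
  induction l generalizing a with
  | nil => exact (K.t0_id0 _).trans (congrArg L.vert h)
  | cons e l ih =>
    change K.t0 (K.comp (L.edge e) (L.path (G.tgt e) l)) = _
    rw [K.t0_comp _ _ (by rw [L.edge_tgt, L.s0_path h.2]), ih h.2]

theorem path_append {a b c : G.V} {l m : List G.E} (h : G.IsPath a l b) (h' : G.IsPath b m c) :
    L.path a (l ++ m) = K.comp (L.path a l) (L.path b m) := by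
  induction l generalizing a with
  | nil =>
    have hab : a = b := h
    subst hab
    change L.path a m = K.comp (K.id0 (L.vert a)) (L.path a m)
    rw [← L.s0_path h', K.id0_comp]
  | cons e l ih =>
    change K.comp (L.edge e) (L.path (G.tgt e) (l ++ m)) =
      K.comp (K.comp (L.edge e) (L.path (G.tgt e) l)) (L.path b m)
    rw [ih h.2, K.comp_assoc]
    · rw [L.edge_tgt, L.s0_path h.2]
    · rw [L.t0_path h.2, L.s0_path h']

theorem s1_cell (F : G.IFace) : K.s1 (L.cell F) = L.path (G.faceSrc F.1) (G.upper F.1) :=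
  L.cell_src F

theorem t1_cell (F : G.IFace) : K.t1 (L.cell F) = L.path (G.faceSrc F.1) (G.lower F.1) :=
  L.cell_tgt F

/-- The 2-cell of the face `F`, whiskered with the rest of the path `p`. -/
noncomputable def step (p : List G.E) (F : G.IFace) : K.C2 :=
  K.whisk2 (L.path G.s (G.before p F)) (L.cell F) (L.path (G.faceTgt F.1) (G.after p F))

/-- The composite 2-cell which crosses the faces in the list one after the other, starting with
the composite of the path `p`. -/
noncomputable def eval : List G.E → List G.IFace → K.C2
  | p, [] => K.id1 (L.path G.s p)
  | p, F :: l => K.vcomp (L.step p F) (eval (G.cross p F) l)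

/-- Whiskering of a 3-cell between 2-cells for the face `F` with the rest of the path `p`. -/
noncomputable def step3 (p : List G.E) (F : G.IFace) (Γ : K.C3) : K.C3 :=
  K.whisk3 (L.path G.s (G.before p F)) Γ (L.path (G.faceTgt F.1) (G.after p F))

/-- The composite 3-cell of a family `Θ` of 3-cells, one for each face, along `eval`. -/
noncomputable def evalHom (Θ : G.IFace → K.C3) : List G.E → List G.IFace → K.C3
  | p, [] => K.id2 (K.id1 (L.path G.s p))
  | p, F :: l => K.hcomp (L.step3 p F (Θ F)) (evalHom Θ (G.cross p F) l)

section step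

variable {L} {u w : List G.E} {F : G.IFace}

theorem t0_before (h : G.IsPath G.s (u ++ (G.upper F.1 ++ w)) G.t) :
    K.t0 (L.path G.s u) = K.s0 (K.s1 (L.cell F)) := by
  rw [L.t0_path (isPath_split h).1, L.s1_cell, L.s0_path (G.isPath_upper F.1)]

theorem s0_after (h : G.IsPath G.s (u ++ (G.upper F.1 ++ w)) G.t) :
    K.t0 (K.s1 (L.cell F)) = K.s0 (L.path (G.faceTgt F.1) w) := by
  rw [L.s0_path (isPath_split h).2, L.s1_cell, L.t0_path (G.isPath_upper F.1)]

theorem step_eq (h : G.IsPath G.s (u ++ (G.upper F.1 ++ w)) G.t) :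
    L.step (u ++ (G.upper F.1 ++ w)) F =
      K.whisk2 (L.path G.s u) (L.cell F) (L.path (G.faceTgt F.1) w) := by
  unfold step
  rw [before_eq h, after_eq h]

theorem step3_eq (h : G.IsPath G.s (u ++ (G.upper F.1 ++ w)) G.t) (Γ : K.C3) :
    L.step3 (u ++ (G.upper F.1 ++ w)) F Γ =
      K.whisk3 (L.path G.s u) Γ (L.path (G.faceTgt F.1) w) := by
  unfold step3
  rw [before_eq h, after_eq h]

theorem path_upper (h : G.IsPath G.s (u ++ (G.upper F.1 ++ w)) G.t) :
    L.path G.s (u ++ (G.upper F.1 ++ w)) =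
      K.comp (L.path G.s u) (K.comp (K.s1 (L.cell F)) (L.path (G.faceTgt F.1) w)) := by
  rw [L.s1_cell, ← L.path_append (G.isPath_upper F.1) (isPath_split h).2,
    ← L.path_append (isPath_split h).1]
  exact (G.isPath_append _ _ _ _).2 ⟨_, G.isPath_upper F.1, (isPath_split h).2⟩

theorem path_lower (h : G.IsPath G.s (u ++ (G.upper F.1 ++ w)) G.t) :
    L.path G.s (u ++ (G.lower F.1 ++ w)) =
      K.comp (L.path G.s u) (K.comp (K.t1 (L.cell F)) (L.path (G.faceTgt F.1) w)) := by
  rw [L.t1_cell, ← L.path_append (G.isPath_lower F.1) (isPath_split h).2,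
    ← L.path_append (isPath_split h).1]
  exact (G.isPath_append _ _ _ _).2 ⟨_, G.isPath_lower F.1, (isPath_split h).2⟩

theorem s1_step {p : List G.E} (h : G.IsPath G.s p G.t)
    (hs : ∃ u w, p = u ++ (G.upper F.1 ++ w)) : K.s1 (L.step p F) = L.path G.s p := by
  obtain ⟨u, w, rfl⟩ := hs
  rw [step_eq h, path_upper h, s1_whisk2 (t0_before h) (s0_after h)]

theorem t1_step {p : List G.E} (h : G.IsPath G.s p G.t)
    (hs : ∃ u w, p = u ++ (G.upper F.1 ++ w)) : K.t1 (L.step p F) = L.path G.s (G.cross p F) := by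
  obtain ⟨u, w, rfl⟩ := hs
  rw [step_eq h, cross_eq h, path_lower h, t1_whisk2 (t0_before h) (s0_after h)]

theorem s2_step3 {p : List G.E} {Γ : K.C3} (h : G.IsPath G.s p G.t)
    (hs : ∃ u w, p = u ++ (G.upper F.1 ++ w)) (hΓ : K.s2 Γ = L.cell F) :
    K.s2 (L.step3 p F Γ) = L.step p F := by
  obtain ⟨u, w, rfl⟩ := hs
  rw [step_eq h, step3_eq h, s2_whisk3 (by rw [hΓ, t0_before h]) (by rw [hΓ, s0_after h]), hΓ]

theorem s1_eval {p : List G.E} {l : List G.IFace} (h : Valid p l) :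
    K.s1 (L.eval p l) = L.path G.s p ∧ K.t1 (L.eval p l) = L.path G.s (l.foldl G.cross p) := by
  induction l generalizing p with
  | nil => exact ⟨K.s1_id1 _, K.t1_id1 _⟩
  | cons F l ih =>
    obtain ⟨i1, i2⟩ := ih h.2.2
    have e : K.t1 (L.step p F) = K.s1 (L.eval (G.cross p F) l) := by rw [t1_step h.2.1 h.1, i1]
    exact ⟨by rw [eval, K.s1_vcomp _ _ e, s1_step h.2.1 h.1], by
      rw [eval, K.t1_vcomp _ _ e, i2]; rfl⟩

theorem eval_append {p : List G.E} {l m : List G.IFace} (h : Valid p (l ++ m)) :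
    L.eval p (l ++ m) = K.vcomp (L.eval p l) (L.eval (l.foldl G.cross p) m) := by
  induction l generalizing p with
  | nil =>
    have := (s1_eval (L := L) h).1
    change L.eval p m = K.vcomp (K.id1 (L.path G.s p)) (L.eval p m)
    rw [List.nil_append] at this
    rw [← this, K.id1_vcomp]
  | cons F l ih =>
    have h1 := valid_append.1 h.2.2
    have i1 := s1_eval (L := L) h1.1
    have i2 := s1_eval (L := L) h1.2
    change K.vcomp (L.step p F) (L.eval (G.cross p F) (l ++ m)) =
      K.vcomp (K.vcomp (L.step p F) (L.eval (G.cross p F) l)) _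
    rw [ih h.2.2, K.vcomp_assoc]
    · rfl
    · rw [t1_step h.2.1 h.1, i1.1]
    · rw [i1.2, List.foldl_cons, i2.1]

end step

end Labelling

namespace GrayCategory

variable {K : GrayCategory.{w₀, w₁, w₂, w₃}}

theorem sand_vcomp_right {A D B : K.C2} {S : K.C3} (h1 : K.t1 A = K.s1 (K.s2 S))
    (h2 : K.t1 (K.s2 S) = K.s1 D) (h3 : K.t1 D = K.s1 B) :
    K.sand A S (K.vcomp D B) = K.sand A (K.hcomp S (K.id2 D)) B := by
  unfold sand
  rw [← K.hcomp_id2 _ _ h3, K.hcomp_assoc]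
  all_goals simp (maxDischargeDepth := 12) [*]

theorem sand_vcomp_left {A D B : K.C2} {S : K.C3} (h1 : K.t1 A = K.s1 D)
    (h2 : K.t1 D = K.s1 (K.s2 S)) (h3 : K.t1 (K.s2 S) = K.s1 B) :
    K.sand (K.vcomp A D) S B = K.sand A (K.hcomp (K.id2 D) S) B := by
  unfold sand
  rw [← K.hcomp_id2 _ _ h1, K.hcomp_assoc, K.hcomp_assoc]
  all_goals simp (maxDischargeDepth := 12) [*]

end GrayCategory

namespace Labelling

variable {G : PastingScheme.{u}} {K : GrayCategory.{w₀, w₁, w₂, w₃}} (L : Labelling G K)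

open Classical in
/-- The interchange isomorphism which exchanges two neighbouring steps, crossing first `F` and
then `H`, beginning from the path `p`. If `F` lies before `H` along the path `p` this is a whiskered
instance of `γ`, and if `F` lies behind `H` it is a whiskered instance of the inverse of `γ`. -/
noncomputable def swapCell (p : List G.E) (F H : G.IFace) : K.C3 :=
  if ∃ e ∈ G.after p F, e ∈ G.upper H.1 then
    K.whisk3 (L.path G.s (G.before p F))
      (K.γ (L.cell F) (K.wl2 (L.path (G.faceTgt F.1) (G.before (G.after p F) H)) (L.cell H)))
      (L.path (G.faceTgt H.1) (G.after (G.after p F) H))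
  else
    K.whisk3 (L.path G.s (G.before p H))
      (K.γinv (L.cell H) (K.wl2 (L.path (G.faceTgt H.1) (G.before (G.after p H) F)) (L.cell F)))
      (L.path (G.faceTgt F.1) (G.after (G.after p H) F))

section swap

variable {L} {u v w : List G.E} {F H : G.IFace}

theorem regroup {α : Type*} (u a v b w : List α) :
    u ++ (a ++ (v ++ (b ++ w))) = (u ++ (a ++ v)) ++ (b ++ w) := by simp

theorem path_mid (h : G.IsPath G.s (u ++ (G.upper F.1 ++ (v ++ (G.upper H.1 ++ w)))) G.t) :
    G.IsPath (G.faceTgt F.1) v (G.faceSrc H.1) :=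
  (isPath_split (isPath_split h).2).1

theorem path_tail (h : G.IsPath G.s (u ++ (G.upper F.1 ++ (v ++ (G.upper H.1 ++ w)))) G.t) :
    L.path (G.faceTgt F.1) (v ++ (G.upper H.1 ++ w)) =
      K.comp (L.path (G.faceTgt F.1) v)
        (K.comp (K.s1 (L.cell H)) (L.path (G.faceTgt H.1) w)) := by
  have h' := isPath_split (isPath_split h).2
  rw [L.s1_cell, ← L.path_append (G.isPath_upper H.1) h'.2, ← L.path_append h'.1]
  exact (G.isPath_append _ _ _ _).2 ⟨_, G.isPath_upper H.1, h'.2⟩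

theorem path_tail_lower
    (h : G.IsPath G.s (u ++ (G.upper F.1 ++ (v ++ (G.upper H.1 ++ w)))) G.t) :
    L.path (G.faceTgt F.1) (v ++ (G.lower H.1 ++ w)) =
      K.comp (L.path (G.faceTgt F.1) v)
        (K.comp (K.t1 (L.cell H)) (L.path (G.faceTgt H.1) w)) := by
  have h' := isPath_split (isPath_split h).2
  rw [L.t1_cell, ← L.path_append (G.isPath_lower H.1) h'.2, ← L.path_append h'.1]
  exact (G.isPath_append _ _ _ _).2 ⟨_, G.isPath_lower H.1, h'.2⟩

theorem path_head (h : G.IsPath G.s (u ++ (G.upper F.1 ++ (v ++ (G.upper H.1 ++ w)))) G.t) :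
    L.path G.s (u ++ (G.upper F.1 ++ v)) =
      K.comp (L.path G.s u) (K.comp (K.s1 (L.cell F)) (L.path (G.faceTgt F.1) v)) := by
  have h' := path_mid h
  rw [L.s1_cell, ← L.path_append (G.isPath_upper F.1) h', ← L.path_append (isPath_split h).1]
  exact (G.isPath_append _ _ _ _).2 ⟨_, G.isPath_upper F.1, h'⟩

theorem path_head_lower
    (h : G.IsPath G.s (u ++ (G.upper F.1 ++ (v ++ (G.upper H.1 ++ w)))) G.t) :
    L.path G.s (u ++ (G.lower F.1 ++ v)) =
      K.comp (L.path G.s u) (K.comp (K.t1 (L.cell F)) (L.path (G.faceTgt F.1) v)) := by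
  have h' := path_mid h
  rw [L.t1_cell, ← L.path_append (G.isPath_lower F.1) h', ← L.path_append (isPath_split h).1]
  exact (G.isPath_append _ _ _ _).2 ⟨_, G.isPath_lower F.1, h'⟩

theorem beside (h : G.IsPath G.s (u ++ (G.upper F.1 ++ (v ++ (G.upper H.1 ++ w)))) G.t) :
    K.Beside (L.path G.s u) (L.cell F) (L.path (G.faceTgt F.1) v) (L.cell H)
      (L.path (G.faceTgt H.1) w) := by
  have h1 := isPath_split h
  have h2 := isPath_split h1.2
  refine ⟨?_, ?_, ?_, ?_⟩
  · rw [L.t0_path h1.1, L.s1_cell, L.s0_path (G.isPath_upper F.1)]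
  · rw [L.s0_path h2.1, L.s1_cell, L.t0_path (G.isPath_upper F.1)]
  · rw [L.t0_path h2.1, L.s1_cell, L.s0_path (G.isPath_upper H.1)]
  · rw [L.s0_path h2.2, L.s1_cell, L.t0_path (G.isPath_upper H.1)]

theorem cross_left (h : G.IsPath G.s (u ++ (G.upper F.1 ++ (v ++ (G.upper H.1 ++ w)))) G.t) :
    G.cross (u ++ (G.upper F.1 ++ (v ++ (G.upper H.1 ++ w)))) F =
      u ++ (G.lower F.1 ++ (v ++ (G.upper H.1 ++ w))) := cross_eq h

theorem cross_right (h : G.IsPath G.s (u ++ (G.upper F.1 ++ (v ++ (G.upper H.1 ++ w)))) G.t) :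
    G.cross (u ++ (G.upper F.1 ++ (v ++ (G.upper H.1 ++ w)))) H =
      u ++ (G.upper F.1 ++ (v ++ (G.lower H.1 ++ w))) := by
  rw [regroup] at h ⊢
  rw [cross_eq h, regroup]

theorem isPath_cross_left
    (h : G.IsPath G.s (u ++ (G.upper F.1 ++ (v ++ (G.upper H.1 ++ w)))) G.t) :
    G.IsPath G.s (u ++ (G.lower F.1 ++ (v ++ (G.upper H.1 ++ w)))) G.t := isPath_cross h

theorem isPath_cross_right
    (h : G.IsPath G.s (u ++ (G.upper F.1 ++ (v ++ (G.upper H.1 ++ w)))) G.t) :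
    G.IsPath G.s (u ++ (G.upper F.1 ++ (v ++ (G.lower H.1 ++ w)))) G.t := by
  rw [regroup] at h ⊢
  exact isPath_cross h

theorem cross_left_right
    (h : G.IsPath G.s (u ++ (G.upper F.1 ++ (v ++ (G.upper H.1 ++ w)))) G.t) :
    G.cross (u ++ (G.lower F.1 ++ (v ++ (G.upper H.1 ++ w)))) H =
      u ++ (G.lower F.1 ++ (v ++ (G.lower H.1 ++ w))) := by
  have h := isPath_cross_left h
  rw [regroup] at h ⊢
  rw [cross_eq h, regroup]

theorem cross_right_left
    (h : G.IsPath G.s (u ++ (G.upper F.1 ++ (v ++ (G.upper H.1 ++ w)))) G.t) :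
    G.cross (u ++ (G.upper F.1 ++ (v ++ (G.lower H.1 ++ w)))) F =
      u ++ (G.lower F.1 ++ (v ++ (G.lower H.1 ++ w))) :=
  cross_eq (isPath_cross_right h)

variable {p : List G.E}

theorem cross_comm (hp : G.IsPath G.s p G.t)
    (h : p = u ++ (G.upper F.1 ++ (v ++ (G.upper H.1 ++ w)))) :
    G.cross (G.cross p F) H = G.cross (G.cross p H) F := by
  subst h
  rw [cross_left hp, cross_right hp, cross_left_right hp, cross_right_left hp]

/-- The 1-cells by which the two steps across `F` and `H` are whiskered, in either order. -/
theorem wings (hp : G.IsPath G.s p G.t)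
    (h : p = u ++ (G.upper F.1 ++ (v ++ (G.upper H.1 ++ w)))) :
    ((L.path G.s (G.before p F) = L.path G.s u) ∧
      L.path (G.faceTgt F.1) (G.after p F) = K.comp (L.path (G.faceTgt F.1) v)
        (K.comp (K.s1 (L.cell H)) (L.path (G.faceTgt H.1) w))) ∧
    ((L.path G.s (G.before (G.cross p F) H) =
        K.comp (L.path G.s u) (K.comp (K.t1 (L.cell F)) (L.path (G.faceTgt F.1) v))) ∧
      L.path (G.faceTgt H.1) (G.after (G.cross p F) H) = L.path (G.faceTgt H.1) w) ∧
    ((L.path G.s (G.before p H) =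
        K.comp (L.path G.s u) (K.comp (K.s1 (L.cell F)) (L.path (G.faceTgt F.1) v))) ∧
      L.path (G.faceTgt H.1) (G.after p H) = L.path (G.faceTgt H.1) w) ∧
    ((L.path G.s (G.before (G.cross p H) F) = L.path G.s u) ∧
      L.path (G.faceTgt F.1) (G.after (G.cross p H) F) = K.comp (L.path (G.faceTgt F.1) v)
        (K.comp (K.t1 (L.cell H)) (L.path (G.faceTgt H.1) w))) := by
  subst h
  have hl := isPath_cross_left hp
  have hr := isPath_cross_right hp
  refine ⟨⟨?_, ?_⟩, ⟨?_, ?_⟩, ⟨?_, ?_⟩, ⟨?_, ?_⟩⟩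
  · rw [before_eq hp]
  · rw [after_eq hp, path_tail hp]
  · rw [cross_left hp, regroup, before_eq (by rwa [regroup] at hl), path_head_lower hp]
  · rw [cross_left hp, regroup, after_eq (by rwa [regroup] at hl)]
  · rw [regroup, before_eq (by rwa [regroup] at hp), path_head hp]
  · rw [regroup, after_eq (by rwa [regroup] at hp)]
  · rw [cross_right hp, before_eq hr]
  · rw [cross_right hp, after_eq hr, path_tail_lower hp]

theorem swapCell_pos (hp : G.IsPath G.s p G.t)
    (h : p = u ++ (G.upper F.1 ++ (v ++ (G.upper H.1 ++ w)))) :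
    L.swapCell p F H = K.whisk3 (L.path G.s u)
      (K.γ (L.cell F) (K.wl2 (L.path (G.faceTgt F.1) v) (L.cell H)))
      (L.path (G.faceTgt H.1) w) := by
  subst h
  have h2 := (isPath_split hp).2
  unfold swapCell
  rw [after_eq hp, before_eq hp, after_eq h2, before_eq h2, if_pos]
  obtain ⟨e, l, hl⟩ := List.exists_cons_of_ne_nil (G.upper_ne_nil H.1)
  exact ⟨e, by simp [hl], by simp [hl]⟩

theorem swapCell_neg (hp : G.IsPath G.s p G.t)
    (h : p = u ++ (G.upper F.1 ++ (v ++ (G.upper H.1 ++ w)))) :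
    L.swapCell p H F = K.whisk3 (L.path G.s u)
      (K.γinv (L.cell F) (K.wl2 (L.path (G.faceTgt F.1) v) (L.cell H)))
      (L.path (G.faceTgt H.1) w) := by
  have hn := isPath_nodup hp
  have hw : G.after p H = w := by
    subst h
    rw [regroup, after_eq (by rwa [regroup] at hp)]
  unfold swapCell
  rw [if_neg]
  · subst h
    have h2 := (isPath_split hp).2
    rw [after_eq hp, before_eq hp, after_eq h2, before_eq h2]
  · rw [hw]
    rintro ⟨e, he, he'⟩
    subst h
    rw [List.nodup_append] at hn
    exact (List.disjoint_of_nodup_append hn.2.1) he' (by simp [he])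

theorem step_left (hp : G.IsPath G.s p G.t)
    (h : p = u ++ (G.upper F.1 ++ (v ++ (G.upper H.1 ++ w)))) :
    K.vcomp (L.step p F) (L.step (G.cross p F) H) =
      K.s2 (K.whisk3 (L.path G.s u)
        (K.γ (L.cell F) (K.wl2 (L.path (G.faceTgt F.1) v) (L.cell H)))
        (L.path (G.faceTgt H.1) w)) := by
  obtain ⟨⟨a1, a2⟩, ⟨b1, b2⟩, -, -⟩ := wings (L := L) hp h
  unfold step
  subst h
  rw [s2_whisk3_γ (beside hp), a1, a2, b1, b2]

theorem step_right (hp : G.IsPath G.s p G.t)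
    (h : p = u ++ (G.upper F.1 ++ (v ++ (G.upper H.1 ++ w)))) :
    K.vcomp (L.step p H) (L.step (G.cross p H) F) =
      K.t2 (K.whisk3 (L.path G.s u)
        (K.γ (L.cell F) (K.wl2 (L.path (G.faceTgt F.1) v) (L.cell H)))
        (L.path (G.faceTgt H.1) w)) := by
  obtain ⟨-, -, ⟨a1, a2⟩, ⟨b1, b2⟩⟩ := wings (L := L) hp h
  unfold step
  subst h
  rw [t2_whisk3_γ (beside hp), a1, a2, b1, b2]

/-- The faces `F` and `H` lie side by side along the path `p`. -/
def Apart (p : List G.E) (F H : G.IFace) : Prop :=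
  (∃ u v w, p = u ++ (G.upper F.1 ++ (v ++ (G.upper H.1 ++ w)))) ∨
    (∃ u v w, p = u ++ (G.upper H.1 ++ (v ++ (G.upper F.1 ++ w))))

theorem Apart.symm (h : Apart p F H) : Apart p H F := Or.symm h

theorem Apart.cross_comm (h : Apart p F H) (hp : G.IsPath G.s p G.t) :
    G.cross (G.cross p F) H = G.cross (G.cross p H) F := by
  rcases h with ⟨u, v, w, h⟩ | ⟨u, v, w, h⟩
  · exact Labelling.cross_comm hp h
  · exact (Labelling.cross_comm hp h).symm

theorem s2_swapCell (hp : G.IsPath G.s p G.t) (h : Apart p F H) :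
    K.s2 (L.swapCell p F H) = K.vcomp (L.step p F) (L.step (G.cross p F) H) := by
  rcases h with ⟨u, v, w, h⟩ | ⟨u, v, w, h⟩
  · rw [swapCell_pos hp h, step_left hp h]
  · rw [swapCell_neg hp h, step_right hp h]
    subst h
    rw [s2_whisk3_γinv (beside hp), t2_whisk3_γ (beside hp)]

theorem t2_swapCell (hp : G.IsPath G.s p G.t) (h : Apart p F H) :
    K.t2 (L.swapCell p F H) = K.vcomp (L.step p H) (L.step (G.cross p H) F) := by
  rcases h with ⟨u, v, w, h⟩ | ⟨u, v, w, h⟩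
  · rw [swapCell_pos hp h, step_right hp h]
  · rw [swapCell_neg hp h, step_left hp h]
    subst h
    rw [t2_whisk3_γinv (beside hp), s2_whisk3_γ (beside hp)]

theorem swapCell_swapCell (hp : G.IsPath G.s p G.t) (h : Apart p F H) :
    K.tcomp (L.swapCell p F H) (L.swapCell p H F) = K.id2 (K.s2 (L.swapCell p F H)) := by
  rcases h with ⟨u, v, w, h⟩ | ⟨u, v, w, h⟩
  · rw [swapCell_pos hp h, swapCell_neg hp h]
    subst h
    exact whisk3_γ_γinv (beside hp)
  · rw [swapCell_pos hp h, swapCell_neg hp h]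
    subst h
    rw [whisk3_γinv_γ (beside hp), s2_whisk3_γinv (beside hp), t2_whisk3_γ (beside hp)]

end swap

end Labelling

namespace PastingScheme

variable {G : PastingScheme.{u}}

/-- The generating arrows of `𝒞_𝒢`: two neighbouring faces `F`, `H` in a linear extension `x` are
exchanged, and this results in the linear extension `y`. -/
@[ext]
structure Swap (x y : G.LinExt) where
  pre : List G.IFace
  F : G.IFace
  H : G.IFace
  post : List G.IFace
  hx : x.toList = pre ++ F :: H :: post
  hy : y.toList = pre ++ H :: F :: post

/-- The exchange in the opposite direction. -/
def Swap.symm {x y : G.LinExt} (g : Swap x y) : Swap y x := ⟨g.pre, g.H, g.F, g.post, g.hy, g.hx⟩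

instance : Quiver G.LinExt := ⟨Swap⟩

/-- An exchange as an arrow of the free category. -/
def Swap.toPath {x y : G.LinExt} (g : Swap x y) :
    (CategoryTheory.Paths.of G.LinExt).obj x ⟶ (CategoryTheory.Paths.of G.LinExt).obj y :=
  (CategoryTheory.Paths.of G.LinExt).map g

open CategoryTheory in
/-- The relations between the generating arrows of `𝒞_𝒢`: exchanging the same two faces twice is the
identity, exchanges in two disjoint places commute, and the two ways to reverse three
consecutive faces agree. -/
inductive OrderRel : HomRel (Paths G.LinExt)
  | inv {x y : G.LinExt} (g : Swap x y) : OrderRel (g.toPath ≫ g.symm.toPath) (𝟙 _)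
  | far {x₁ x₂ x₃ x₄ : G.LinExt} (U V W : List G.IFace) (F H J M : G.IFace)
      (h₁ : x₁.toList = U ++ F :: H :: (V ++ J :: M :: W))
      (h₂ : x₂.toList = U ++ H :: F :: (V ++ J :: M :: W))
      (h₃ : x₃.toList = U ++ F :: H :: (V ++ M :: J :: W))
      (h₄ : x₄.toList = U ++ H :: F :: (V ++ M :: J :: W)) :
      OrderRel
        (Swap.toPath (x := x₁) (y := x₂) ⟨U, F, H, V ++ J :: M :: W, h₁, h₂⟩ ≫
          Swap.toPath (x := x₂) (y := x₄)
            ⟨U ++ H :: F :: V, J, M, W, by simp [h₂], by simp [h₄]⟩)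
        (Swap.toPath (x := x₁) (y := x₃)
            ⟨U ++ F :: H :: V, J, M, W, by simp [h₁], by simp [h₃]⟩ ≫
          Swap.toPath (x := x₃) (y := x₄) ⟨U, F, H, V ++ M :: J :: W, h₃, h₄⟩)
  | braid {x₁ x₂ x₃ x₄ x₅ x₆ : G.LinExt} (U V : List G.IFace) (F H J : G.IFace)
      (h₁ : x₁.toList = U ++ F :: H :: J :: V) (h₂ : x₂.toList = U ++ H :: F :: J :: V)
      (h₃ : x₃.toList = U ++ H :: J :: F :: V) (h₄ : x₄.toList = U ++ J :: H :: F :: V)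
      (h₅ : x₅.toList = U ++ F :: J :: H :: V) (h₆ : x₆.toList = U ++ J :: F :: H :: V) :
      OrderRel
        (Swap.toPath (x := x₁) (y := x₂) ⟨U, F, H, J :: V, h₁, h₂⟩ ≫
          Swap.toPath (x := x₂) (y := x₃) ⟨U ++ [H], F, J, V, by simp [h₂], by simp [h₃]⟩ ≫
          Swap.toPath (x := x₃) (y := x₄) ⟨U, H, J, F :: V, h₃, h₄⟩)
        (Swap.toPath (x := x₁) (y := x₅) ⟨U ++ [F], H, J, V, by simp [h₁], by simp [h₅]⟩ ≫
          Swap.toPath (x := x₅) (y := x₆) ⟨U, F, J, H :: V, h₅, h₆⟩ ≫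
          Swap.toPath (x := x₆) (y := x₄) ⟨U ++ [J], F, H, V, by simp [h₆], by simp [h₄]⟩)

variable (G) in
/-- The groupoid `𝒞_𝒢` of the orders in which the faces of the pasting scheme can be composed. -/
abbrev Orders : Type u := CategoryTheory.Quotient (OrderRel (G := G))

theorem Swap.ne {x y : G.LinExt} (g : Swap x y) : g.F ≠ g.H := by
  intro h
  have h' := x.nodup
  rw [g.hx, h] at h'
  simpa using (List.nodup_append.1 h').2.1

/-- The path reached before the exchange takes place. -/
noncomputable def Swap.front {x y : G.LinExt} (g : Swap x y) : List G.E := g.pre.foldl G.cross G.top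

theorem Swap.isPath {x y : G.LinExt} (g : Swap x y) : G.IsPath G.s g.front G.t :=
  (x.front g.hx).path

theorem Swap.apart {x y : G.LinExt} (g : Swap x y) : Labelling.Apart g.front g.F g.H :=
  (x.front g.hx).two (x.enabled g.hx) (y.enabled g.hy) g.ne

theorem Swap.valid_pre {x y : G.LinExt} (g : Swap x y) : Valid G.top g.pre :=
  (valid_append.1 (g.hx ▸ x.valid)).1

theorem Swap.valid {x y : G.LinExt} (g : Swap x y) : Valid g.front (g.F :: g.H :: g.post) :=
  (valid_append.1 (g.hx ▸ x.valid)).2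

end PastingScheme

namespace Labelling

variable {G : PastingScheme.{u}} {K : GrayCategory.{w₀, w₁, w₂, w₃}} (L : Labelling G K)

/-- The interchange isomorphism for an exchange of two neighbouring faces, whiskered with the
2-cells of all the other faces. -/
noncomputable def genCell {x y : G.LinExt} (g : Swap x y) : K.C3 :=
  K.sand (L.eval G.top g.pre) (L.swapCell g.front g.F g.H)
    (L.eval (G.cross (G.cross g.front g.F) g.H) g.post)

variable {L}

theorem eval_cons_cons {p : List G.E} {F H : G.IFace} {l : List G.IFace}
    (h : Valid p (F :: H :: l)) :
    L.eval p (F :: H :: l) = K.vcomp (K.vcomp (L.step p F) (L.step (G.cross p F) H))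
      (L.eval (G.cross (G.cross p F) H) l) := by
  rw [K.vcomp_assoc]
  · rfl
  · rw [t1_step h.2.1 h.1, s1_step h.2.2.2.1 h.2.2.1]
  · rw [t1_step h.2.2.2.1 h.2.2.1, (s1_eval h.2.2.2.2).1]

theorem t1_pre {x y : G.LinExt} (g : Swap x y) :
    K.t1 (L.eval G.top g.pre) = L.path G.s g.front := (s1_eval g.valid_pre).2

theorem s1_post {x y : G.LinExt} (g : Swap x y) :
    K.s1 (L.eval (G.cross (G.cross g.front g.F) g.H) g.post) =
      L.path G.s (G.cross (G.cross g.front g.F) g.H) := (s1_eval g.valid.2.2.2.2).1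

theorem s1_two {p : List G.E} {F H : G.IFace} {l : List G.IFace} (h : Valid p (F :: H :: l)) :
    K.s1 (K.vcomp (L.step p F) (L.step (G.cross p F) H)) = L.path G.s p ∧
    K.t1 (K.vcomp (L.step p F) (L.step (G.cross p F) H)) =
      L.path G.s (G.cross (G.cross p F) H) := by
  have e : K.t1 (L.step p F) = K.s1 (L.step (G.cross p F) H) := by
    rw [t1_step h.2.1 h.1, s1_step h.2.2.2.1 h.2.2.1]
  rw [K.s1_vcomp _ _ e, K.t1_vcomp _ _ e, s1_step h.2.1 h.1, t1_step h.2.2.2.1 h.2.2.1]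
  exact ⟨rfl, rfl⟩

theorem s1_swap {x y : G.LinExt} (g : Swap x y) :
    K.s1 (K.s2 (L.swapCell g.front g.F g.H)) = L.path G.s g.front := by
  rw [s2_swapCell g.isPath g.apart]
  exact (s1_two g.valid).1

theorem t1_swap {x y : G.LinExt} (g : Swap x y) :
    K.t1 (K.s2 (L.swapCell g.front g.F g.H)) =
      L.path G.s (G.cross (G.cross g.front g.F) g.H) := by
  rw [s2_swapCell g.isPath g.apart]
  exact (s1_two g.valid).2

theorem s2_genCell {x y : G.LinExt} (g : Swap x y) :
    K.s2 (L.genCell g) = L.eval G.top x.toList := by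
  unfold genCell
  have h := x.valid
  rw [g.hx] at h
  rw [s2_sand (by rw [t1_pre, s1_swap]) (by rw [t1_swap, s1_post]), g.hx, eval_append h]
  rw [s2_swapCell g.isPath g.apart]
  exact congrArg _ (eval_cons_cons g.valid).symm

theorem t2_genCell {x y : G.LinExt} (g : Swap x y) :
    K.t2 (L.genCell g) = L.eval G.top y.toList := by
  unfold genCell
  have h := y.valid
  rw [g.hy] at h
  rw [t2_sand (by rw [t1_pre, s1_swap]) (by rw [t1_swap, s1_post]), g.hy, eval_append h]
  rw [t2_swapCell g.isPath g.apart, g.apart.cross_comm g.isPath]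
  exact congrArg _ (eval_cons_cons g.symm.valid).symm

theorem genCell_symm {x y : G.LinExt} (g : Swap x y) :
    K.tcomp (L.genCell g) (L.genCell g.symm) = K.id2 (L.eval G.top x.toList) := by
  have e : L.genCell g.symm = K.sand (L.eval G.top g.pre) (L.swapCell g.front g.H g.F)
      (L.eval (G.cross (G.cross g.front g.F) g.H) g.post) := by
    rw [g.apart.cross_comm g.isPath]
    rfl
  rw [e, ← s2_genCell g]
  unfold genCell
  have a1 : K.t1 (L.eval G.top g.pre) = K.s1 (K.s2 (L.swapCell g.front g.F g.H)) := by
    rw [t1_pre, s1_swap]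
  have a2 : K.t1 (K.s2 (L.swapCell g.front g.F g.H)) =
      K.s1 (L.eval (G.cross (G.cross g.front g.F) g.H) g.post) := by rw [t1_swap, s1_post]
  rw [← sand_tcomp a1 a2, swapCell_swapCell g.isPath g.apart, sand_id2 a1 a2, s2_sand a1 a2]
  rw [t2_swapCell g.isPath g.apart, s2_swapCell g.isPath g.apart.symm]

theorem far_aux {A : K.C2} {p q : List G.E} {F H J M : G.IFace} {V W : List G.IFace}
    (hp : Valid p (F :: H :: (V ++ J :: M :: W))) (hp' : Valid p (H :: F :: (V ++ J :: M :: W)))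
    (hq' : Valid q (M :: J :: W)) (hq : V.foldl G.cross (G.cross (G.cross p F) H) = q)
    (h1 : Apart p F H) (h2 : Apart q J M) (hA : K.t1 A = L.path G.s p) :
    K.tcomp (K.sand A (L.swapCell p F H)
          (L.eval (G.cross (G.cross p F) H) (V ++ J :: M :: W)))
        (K.sand (K.vcomp A (L.eval p (H :: F :: V))) (L.swapCell q J M)
          (L.eval (G.cross (G.cross q J) M) W)) =
      K.tcomp (K.sand (K.vcomp A (L.eval p (F :: H :: V))) (L.swapCell q J M)
          (L.eval (G.cross (G.cross q J) M) W))
        (K.sand A (L.swapCell p F H)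
          (L.eval (G.cross (G.cross p F) H) (V ++ M :: J :: W))) := by
  have c1 := h1.cross_comm hp.2.1
  have hV := valid_append.1 hp.2.2.2.2
  rw [hq] at hV
  have c2 := h2.cross_comm hV.2.path
  have hVM : Valid (G.cross (G.cross p F) H) (V ++ M :: J :: W) :=
    valid_append.2 ⟨hV.1, hq ▸ hq'⟩
  have hpV : Valid p (F :: H :: V) := (valid_append (l := F :: H :: V)).1 hp |>.1
  have hpV' : Valid p (H :: F :: V) := (valid_append (l := H :: F :: V)).1 hp' |>.1
  have sS := s2_swapCell (L := L) hp.2.1 h1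
  have tS := t2_swapCell (L := L) hp.2.1 h1
  have sT := s2_swapCell (L := L) hV.2.path h2
  have tT := t2_swapCell (L := L) hV.2.path h2
  have e1 : L.eval (G.cross (G.cross p F) H) (V ++ J :: M :: W) =
      K.vcomp (L.eval (G.cross (G.cross p F) H) V)
        (K.vcomp (K.s2 (L.swapCell q J M)) (L.eval (G.cross (G.cross q J) M) W)) := by
    rw [eval_append hp.2.2.2.2, hq, sT, eval_cons_cons hV.2]
  have e2 : L.eval (G.cross (G.cross p F) H) (V ++ M :: J :: W) =
      K.vcomp (L.eval (G.cross (G.cross p F) H) V)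
        (K.vcomp (K.t2 (L.swapCell q J M)) (L.eval (G.cross (G.cross q J) M) W)) := by
    rw [eval_append hVM, hq, tT, eval_cons_cons hq', c2]
  have e3 : L.eval p (F :: H :: V) = K.vcomp (K.s2 (L.swapCell p F H))
      (L.eval (G.cross (G.cross p F) H) V) := by
    rw [eval_cons_cons hpV, sS]
  have e4 : L.eval p (H :: F :: V) = K.vcomp (K.t2 (L.swapCell p F H))
      (L.eval (G.cross (G.cross p F) H) V) := by
    rw [eval_cons_cons hpV', tS, c1]
  rw [e1, e2, e3, e4]
  refine sand_far ?_ ?_ ?_ ?_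
  · rw [hA, sS, (s1_two hp).1]
  · rw [sS, (s1_two hp).2, (s1_eval hV.1).1]
  · rw [(s1_eval hV.1).2, hq, sT, (s1_two hV.2).1]
  · rw [sT, (s1_two hV.2).2, (s1_eval hV.2.2.2.2.2).1]

theorem genCell_far {x₁ x₂ x₃ x₄ : G.LinExt} (U V W : List G.IFace) (F H J M : G.IFace)
    (h₁ : x₁.toList = U ++ F :: H :: (V ++ J :: M :: W))
    (h₂ : x₂.toList = U ++ H :: F :: (V ++ J :: M :: W))
    (h₃ : x₃.toList = U ++ F :: H :: (V ++ M :: J :: W))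
    (h₄ : x₄.toList = U ++ H :: F :: (V ++ M :: J :: W)) :
    K.tcomp (L.genCell (x := x₁) (y := x₂) ⟨U, F, H, V ++ J :: M :: W, h₁, h₂⟩)
        (L.genCell (x := x₂) (y := x₄)
          ⟨U ++ H :: F :: V, J, M, W, by simp [h₂], by simp [h₄]⟩) =
      K.tcomp (L.genCell (x := x₁) (y := x₃)
          ⟨U ++ F :: H :: V, J, M, W, by simp [h₁], by simp [h₃]⟩)
        (L.genCell (x := x₃) (y := x₄) ⟨U, F, H, V ++ M :: J :: W, h₃, h₄⟩) := by
  let g12 : Swap x₁ x₂ := ⟨U, F, H, V ++ J :: M :: W, h₁, h₂⟩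
  let g13 : Swap x₁ x₃ := ⟨U ++ F :: H :: V, J, M, W, by simp [h₁], by simp [h₃]⟩
  have hU := g12.valid_pre
  have hfoldl : V.foldl G.cross (G.cross (G.cross g12.front F) H) = g13.front := by
    simp [g12, g13, Swap.front]
  have hfoldl' : V.foldl G.cross (G.cross (G.cross g12.front H) F) = g13.front := by
    rw [← hfoldl, g12.apart.cross_comm g12.isPath]
  have key := far_aux (L := L) g12.valid g12.symm.valid g13.symm.valid hfoldl g12.apart g13.apart
    (t1_pre g12)
  have k1 := eval_append (L := L) (l := U) (m := F :: H :: V) g13.valid_pre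
  have k2 := eval_append (L := L) (l := U) (m := H :: F :: V)
    (Swap.valid_pre (x := x₂) (y := x₄)
      ⟨U ++ H :: F :: V, J, M, W, by simp [h₂], by simp [h₄]⟩)
  have k3 : (U ++ H :: F :: V).foldl G.cross G.top = g13.front := by
    rw [← hfoldl']
    simp [g12, Swap.front]
  change K.tcomp (K.sand (L.eval G.top U) (L.swapCell g12.front F H) _)
    (K.sand (L.eval G.top (U ++ H :: F :: V))
      (L.swapCell ((U ++ H :: F :: V).foldl G.cross G.top) J M)
      (L.eval (G.cross (G.cross ((U ++ H :: F :: V).foldl G.cross G.top) J) M) W)) =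
    K.tcomp (K.sand (L.eval G.top (U ++ F :: H :: V)) _ _) _
  rw [k1, k2, k3]
  exact key

end Labelling

namespace Labelling

variable {G : PastingScheme.{u}} {K : GrayCategory.{w₀, w₁, w₂, w₃}} (L : Labelling G K)

theorem isPath_trans {a b c : G.V} {l m : List G.E} (h : G.IsPath a l b) (h' : G.IsPath b m c) :
    G.IsPath a (l ++ m) c :=
  (G.isPath_append _ _ _ _).2 ⟨_, h, h'⟩

/-- A path which passes along three faces `F`, `H`, `J`, in this order. -/
structure Trio (u : List G.E) (F : G.IFace) (a v : List G.E) (H : G.IFace) (b w : List G.E)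
    (J : G.IFace) (c z : List G.E) : Prop where
  hu : G.IsPath G.s u (G.faceSrc F.1)
  ha : G.IsPath (G.faceSrc F.1) a (G.faceTgt F.1)
  hv : G.IsPath (G.faceTgt F.1) v (G.faceSrc H.1)
  hb : G.IsPath (G.faceSrc H.1) b (G.faceTgt H.1)
  hw : G.IsPath (G.faceTgt H.1) w (G.faceSrc J.1)
  hc : G.IsPath (G.faceSrc J.1) c (G.faceTgt J.1)
  hz : G.IsPath (G.faceTgt J.1) z G.t

section trio

variable {L} {u v w z a b c : List G.E} {F H J : G.IFace}

theorem trio_of_isPath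
    (h : G.IsPath G.s (u ++ (G.upper F.1 ++ (v ++ (G.upper H.1 ++ (w ++ (G.upper J.1 ++ z)))))) G.t) :
    Trio u F (G.upper F.1) v H (G.upper H.1) w J (G.upper J.1) z := by
  have h1 := isPath_split h
  have h2 := isPath_split h1.2
  have h3 := isPath_split h2.2
  exact ⟨h1.1, G.isPath_upper _, h2.1, G.isPath_upper _, h3.1, G.isPath_upper _, h3.2⟩

theorem Trio.isPath (h : Trio u F a v H b w J c z) :
    G.IsPath G.s (u ++ (a ++ (v ++ (b ++ (w ++ (c ++ z)))))) G.t :=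
  isPath_trans h.hu (isPath_trans h.ha (isPath_trans h.hv (isPath_trans h.hb (isPath_trans h.hw
    (isPath_trans h.hc h.hz)))))

theorem Trio.path₁ (h : Trio u F a v H b w J c z) :
    L.path G.s (u ++ (a ++ v)) = K.comp (L.path G.s u)
      (K.comp (L.path (G.faceSrc F.1) a) (L.path (G.faceTgt F.1) v)) := by
  rw [L.path_append h.hu (isPath_trans h.ha h.hv), L.path_append h.ha h.hv]

theorem Trio.path₂ (h : Trio u F a v H b w J c z) :
    L.path (G.faceTgt F.1) (v ++ (b ++ w)) = K.comp (L.path (G.faceTgt F.1) v)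
      (K.comp (L.path (G.faceSrc H.1) b) (L.path (G.faceTgt H.1) w)) := by
  rw [L.path_append h.hv (isPath_trans h.hb h.hw), L.path_append h.hb h.hw]

theorem Trio.path₃ (h : Trio u F a v H b w J c z) :
    L.path (G.faceTgt H.1) (w ++ (c ++ z)) = K.comp (L.path (G.faceTgt H.1) w)
      (K.comp (L.path (G.faceSrc J.1) c) (L.path (G.faceTgt J.1) z)) := by
  rw [L.path_append h.hw (isPath_trans h.hc h.hz), L.path_append h.hc h.hz]

theorem Trio.path₁₂ (h : Trio u F a v H b w J c z) :
    L.path G.s (u ++ (a ++ (v ++ (b ++ w)))) = K.comp (L.path G.s u)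
      (K.comp (L.path (G.faceSrc F.1) a) (K.comp (L.path (G.faceTgt F.1) v)
        (K.comp (L.path (G.faceSrc H.1) b) (L.path (G.faceTgt H.1) w)))) := by
  rw [L.path_append h.hu (isPath_trans h.ha (isPath_trans h.hv (isPath_trans h.hb h.hw))),
    L.path_append h.ha (isPath_trans h.hv (isPath_trans h.hb h.hw)), h.path₂]

theorem Trio.path₂₃ (h : Trio u F a v H b w J c z) :
    L.path (G.faceTgt F.1) (v ++ (b ++ (w ++ (c ++ z)))) = K.comp (L.path (G.faceTgt F.1) v)
      (K.comp (L.path (G.faceSrc H.1) b) (K.comp (L.path (G.faceTgt H.1) w)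
        (K.comp (L.path (G.faceSrc J.1) c) (L.path (G.faceTgt J.1) z)))) := by
  rw [L.path_append h.hv (isPath_trans h.hb (isPath_trans h.hw (isPath_trans h.hc h.hz))),
    L.path_append h.hb (isPath_trans h.hw (isPath_trans h.hc h.hz)), h.path₃]

theorem regroup₂ {α : Type*} (u a v b w c z : List α) :
    u ++ (a ++ (v ++ (b ++ (w ++ (c ++ z))))) = (u ++ (a ++ (v ++ (b ++ w)))) ++ (c ++ z) := by
  simp

theorem Trio.step_F (h : Trio u F (G.upper F.1) v H b w J c z) :
    L.step (u ++ (G.upper F.1 ++ (v ++ (b ++ (w ++ (c ++ z)))))) F =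
      K.whisk2 (L.path G.s u) (L.cell F) (K.comp (L.path (G.faceTgt F.1) v)
        (K.comp (L.path (G.faceSrc H.1) b) (K.comp (L.path (G.faceTgt H.1) w)
          (K.comp (L.path (G.faceSrc J.1) c) (L.path (G.faceTgt J.1) z))))) := by
  rw [step_eq h.isPath, h.path₂₃]

theorem Trio.step_H (h : Trio u F a v H (G.upper H.1) w J c z) :
    L.step (u ++ (a ++ (v ++ (G.upper H.1 ++ (w ++ (c ++ z)))))) H =
      K.whisk2 (K.comp (L.path G.s u) (K.comp (L.path (G.faceSrc F.1) a)
        (L.path (G.faceTgt F.1) v))) (L.cell H) (K.comp (L.path (G.faceTgt H.1) w)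
          (K.comp (L.path (G.faceSrc J.1) c) (L.path (G.faceTgt J.1) z))) := by
  have := h.isPath
  rw [regroup] at this ⊢
  rw [step_eq this, h.path₃, h.path₁]

theorem Trio.step_J (h : Trio u F a v H b w J (G.upper J.1) z) :
    L.step (u ++ (a ++ (v ++ (b ++ (w ++ (G.upper J.1 ++ z)))))) J =
      K.whisk2 (K.comp (L.path G.s u) (K.comp (L.path (G.faceSrc F.1) a)
        (K.comp (L.path (G.faceTgt F.1) v) (K.comp (L.path (G.faceSrc H.1) b)
          (L.path (G.faceTgt H.1) w))))) (L.cell J) (L.path (G.faceTgt J.1) z) := by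
  have := h.isPath
  rw [regroup₂] at this ⊢
  rw [step_eq this, h.path₁₂]

theorem Trio.cross_F (h : Trio u F (G.upper F.1) v H b w J c z) :
    G.cross (u ++ (G.upper F.1 ++ (v ++ (b ++ (w ++ (c ++ z)))))) F =
      u ++ (G.lower F.1 ++ (v ++ (b ++ (w ++ (c ++ z))))) := cross_eq h.isPath

theorem Trio.cross_H (h : Trio u F a v H (G.upper H.1) w J c z) :
    G.cross (u ++ (a ++ (v ++ (G.upper H.1 ++ (w ++ (c ++ z)))))) H =
      u ++ (a ++ (v ++ (G.lower H.1 ++ (w ++ (c ++ z))))) := by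
  have := h.isPath
  rw [regroup] at this ⊢
  rw [cross_eq this]
  simp

theorem Trio.cross_J (h : Trio u F a v H b w J (G.upper J.1) z) :
    G.cross (u ++ (a ++ (v ++ (b ++ (w ++ (G.upper J.1 ++ z)))))) J =
      u ++ (a ++ (v ++ (b ++ (w ++ (G.lower J.1 ++ z))))) := by
  have := h.isPath
  rw [regroup₂] at this ⊢
  rw [cross_eq this, regroup₂]

theorem Trio.swap_FH (h : Trio u F (G.upper F.1) v H (G.upper H.1) w J c z) :
    L.swapCell (u ++ (G.upper F.1 ++ (v ++ (G.upper H.1 ++ (w ++ (c ++ z)))))) F H =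
      K.whisk3 (L.path G.s u) (K.γ (L.cell F) (K.wl2 (L.path (G.faceTgt F.1) v) (L.cell H)))
        (K.comp (L.path (G.faceTgt H.1) w)
          (K.comp (L.path (G.faceSrc J.1) c) (L.path (G.faceTgt J.1) z))) := by
  rw [swapCell_pos h.isPath rfl, h.path₃]

theorem Trio.swap_FJ (h : Trio u F (G.upper F.1) v H b w J (G.upper J.1) z) :
    L.swapCell (u ++ (G.upper F.1 ++ (v ++ (b ++ (w ++ (G.upper J.1 ++ z)))))) F J =
      K.whisk3 (L.path G.s u) (K.γ (L.cell F) (K.wl2 (K.comp (L.path (G.faceTgt F.1) v)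
        (K.comp (L.path (G.faceSrc H.1) b) (L.path (G.faceTgt H.1) w))) (L.cell J)))
        (L.path (G.faceTgt J.1) z) := by
  rw [swapCell_pos (u := u) (v := v ++ (b ++ w)) (w := z) h.isPath (by simp), h.path₂]

theorem Trio.swap_HJ (h : Trio u F a v H (G.upper H.1) w J (G.upper J.1) z) :
    L.swapCell (u ++ (a ++ (v ++ (G.upper H.1 ++ (w ++ (G.upper J.1 ++ z)))))) H J =
      K.whisk3 (K.comp (L.path G.s u) (K.comp (L.path (G.faceSrc F.1) a)
        (L.path (G.faceTgt F.1) v))) (K.γ (L.cell H) (K.wl2 (L.path (G.faceTgt H.1) w) (L.cell J)))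
        (L.path (G.faceTgt J.1) z) := by
  rw [swapCell_pos (u := u ++ (a ++ v)) (v := w) (w := z) h.isPath (by simp), h.path₁]

variable {p : List G.E}

theorem braid_aux (hp : G.IsPath G.s p G.t)
    (h : p = u ++ (G.upper F.1 ++ (v ++ (G.upper H.1 ++ (w ++ (G.upper J.1 ++ z)))))) :
    K.tcomp (K.hcomp (L.swapCell p F H) (K.id2 (L.step (G.cross (G.cross p F) H) J)))
      (K.tcomp (K.hcomp (K.id2 (L.step p H)) (L.swapCell (G.cross p H) F J))
        (K.hcomp (L.swapCell p H J) (K.id2 (L.step (G.cross (G.cross p H) J) F)))) =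
    K.tcomp (K.hcomp (K.id2 (L.step p F)) (L.swapCell (G.cross p F) H J))
      (K.tcomp (K.hcomp (L.swapCell p F J) (K.id2 (L.step (G.cross (G.cross p F) J) H)))
        (K.hcomp (K.id2 (L.step p J)) (L.swapCell (G.cross p J) F H))) := by
  subst h
  have T := trio_of_isPath hp
  have iF := G.isPath_lower F.1
  have iH := G.isPath_lower H.1
  have iJ := G.isPath_lower J.1
  have TF : Trio u F (G.lower F.1) v H (G.upper H.1) w J (G.upper J.1) z := { T with ha := iF }
  have TH : Trio u F (G.upper F.1) v H (G.lower H.1) w J (G.upper J.1) z := { T with hb := iH }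
  have TJ : Trio u F (G.upper F.1) v H (G.upper H.1) w J (G.lower J.1) z := { T with hc := iJ }
  have TFH : Trio u F (G.lower F.1) v H (G.lower H.1) w J (G.upper J.1) z := { TF with hb := iH }
  have THJ : Trio u F (G.upper F.1) v H (G.lower H.1) w J (G.lower J.1) z := { TH with hc := iJ }
  have TFJ : Trio u F (G.lower F.1) v H (G.upper H.1) w J (G.lower J.1) z := { TF with hc := iJ }
  have key := whisk3_γ_yangBaxter (K := K) (u := L.path G.s u) (v := L.path (G.faceTgt F.1) v)
    (w := L.path (G.faceTgt H.1) w) (z := L.path (G.faceTgt J.1) z)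
    (α := L.cell F) (β := L.cell H) (δ := L.cell J)
    ⟨by rw [L.t0_path T.hu, L.s1_cell, L.s0_path T.ha],
      by rw [L.s0_path T.hv, L.s1_cell, L.t0_path T.ha],
      by rw [L.t0_path T.hv, L.s1_cell, L.s0_path T.hb],
      by rw [L.s0_path T.hw, L.s1_cell, L.t0_path T.hb]⟩
    (by rw [L.t0_path T.hw, L.s1_cell, L.s0_path T.hc])
    (by rw [L.s0_path T.hz, L.s1_cell, L.t0_path T.hc])
  simp only [L.s1_cell, L.t1_cell] at key
  rw [T.cross_F, T.cross_H, T.cross_J, TF.cross_H, TH.cross_J, TF.cross_J, T.swap_FH, TFH.step_J,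
    T.step_H, TH.swap_FJ, T.swap_HJ, THJ.step_F, T.step_F, TF.swap_HJ, T.swap_FJ, TFJ.step_H,
    T.step_J, TJ.swap_FH]
  exact key

end trio

end Labelling

namespace Labelling

variable {G : PastingScheme.{u}} {K : GrayCategory.{w₀, w₁, w₂, w₃}} {L : Labelling G K}

section braid

variable {p : List G.E} {F H J : G.IFace} {V : List G.IFace}

variable (L) in
/-- Three steps in succession. -/
noncomputable def three (p : List G.E) (F H J : G.IFace) : K.C2 :=
  K.vcomp (L.step p F) (K.vcomp (L.step (G.cross p F) H) (L.step (G.cross (G.cross p F) H) J))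

theorem link₁ (h : Valid p (F :: H :: V)) : K.t1 (L.step p F) = K.s1 (L.step (G.cross p F) H) := by
  rw [t1_step h.2.1 h.1, s1_step h.2.2.2.1 h.2.2.1]

theorem s1_three (h : Valid p (F :: H :: J :: V)) :
    K.s1 (L.three p F H J) = L.path G.s p ∧ K.t1 (L.three p F H J) =
      L.path G.s (G.cross (G.cross (G.cross p F) H) J) := by
  have e1 := link₁ (L := L) h
  have e2 := link₁ (L := L) h.2.2
  have e3 : K.t1 (L.step p F) = K.s1 (K.vcomp (L.step (G.cross p F) H)
      (L.step (G.cross (G.cross p F) H) J)) := by rw [K.s1_vcomp _ _ e2, e1]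
  unfold three
  rw [K.s1_vcomp _ _ e3, K.t1_vcomp _ _ e3, K.t1_vcomp _ _ e2, s1_step h.2.1 h.1,
    t1_step h.2.2.2.2.2.1 h.2.2.2.2.1]
  exact ⟨rfl, rfl⟩

theorem three_eq (h : Valid p (F :: H :: J :: V)) :
    L.three p F H J = K.vcomp (K.vcomp (L.step p F) (L.step (G.cross p F) H))
      (L.step (G.cross (G.cross p F) H) J) := by
  rw [K.vcomp_assoc _ _ _ (link₁ h) (link₁ h.2.2)]
  rfl

theorem left_link (h : Valid p (F :: H :: J :: V)) (ha : Apart p F H) :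
    K.t1 (K.s2 (L.swapCell p F H)) = K.s1 (L.step (G.cross (G.cross p F) H) J) := by
  rw [s2_swapCell h.2.1 ha, (s1_two h).2, s1_step h.2.2.2.2.2.1 h.2.2.2.2.1]

theorem right_link (h : Valid p (F :: H :: J :: V)) (ha : Apart (G.cross p F) H J) :
    K.t1 (L.step p F) = K.s1 (K.s2 (L.swapCell (G.cross p F) H J)) := by
  rw [s2_swapCell h.2.2.2.1 ha, (s1_two h.2.2).1, t1_step h.2.1 h.1]

theorem s2_left (h : Valid p (F :: H :: J :: V)) (ha : Apart p F H) :
    K.s2 (K.hcomp (L.swapCell p F H) (K.id2 (L.step (G.cross (G.cross p F) H) J))) =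
      L.three p F H J := by
  rw [K.s2_hcomp _ _ (by rw [K.s2_id2, left_link h ha]), K.s2_id2, s2_swapCell h.2.1 ha,
    three_eq h]

theorem t2_left (h : Valid p (F :: H :: J :: V)) (h' : Valid p (H :: F :: J :: V))
    (ha : Apart p F H) :
    K.t2 (K.hcomp (L.swapCell p F H) (K.id2 (L.step (G.cross (G.cross p F) H) J))) =
      L.three p H F J := by
  rw [K.t2_hcomp _ _ (by rw [K.s2_id2, left_link h ha]), K.t2_id2, t2_swapCell h.2.1 ha,
    three_eq h', ha.cross_comm h.2.1]

theorem s2_right (h : Valid p (F :: H :: J :: V)) (ha : Apart (G.cross p F) H J) :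
    K.s2 (K.hcomp (K.id2 (L.step p F)) (L.swapCell (G.cross p F) H J)) = L.three p F H J := by
  rw [K.s2_hcomp _ _ (by rw [K.s2_id2, right_link h ha]), K.s2_id2, s2_swapCell h.2.2.2.1 ha]
  rfl

theorem t2_right (h : Valid p (F :: H :: J :: V)) (ha : Apart (G.cross p F) H J) :
    K.t2 (K.hcomp (K.id2 (L.step p F)) (L.swapCell (G.cross p F) H J)) = L.three p F J H := by
  rw [K.t2_hcomp _ _ (by rw [K.s2_id2, right_link h ha]), K.t2_id2, t2_swapCell h.2.2.2.1 ha]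
  rfl

theorem genCell_left {x y : G.LinExt} (g : Swap x y) (hg : g.post = J :: V) :
    L.genCell g = K.sand (L.eval G.top g.pre)
      (K.hcomp (L.swapCell g.front g.F g.H)
        (K.id2 (L.step (G.cross (G.cross g.front g.F) g.H) J)))
      (L.eval (G.cross (G.cross (G.cross g.front g.F) g.H) J) V) := by
  have hv := g.valid
  rw [hg] at hv
  rw [← sand_vcomp_right (by rw [t1_pre, s1_swap]) (left_link hv g.apart)
    (by rw [t1_step hv.2.2.2.2.2.1 hv.2.2.2.2.1, (s1_eval hv.2.2.2.2.2.2).1])]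
  unfold genCell
  rw [hg]
  rfl

theorem genCell_right {x y : G.LinExt} (g : Swap x y) {U : List G.IFace}
    (hg : g.pre = U ++ [J]) :
    L.genCell g = K.sand (L.eval G.top U)
      (K.hcomp (K.id2 (L.step (U.foldl G.cross G.top) J))
        (L.swapCell (G.cross (U.foldl G.cross G.top) J) g.F g.H))
      (L.eval (G.cross (G.cross (G.cross (U.foldl G.cross G.top) J) g.F) g.H) g.post) := by
  have hf : g.front = G.cross (U.foldl G.cross G.top) J := by
    simp [Swap.front, hg]
  have hp := g.valid_pre
  rw [hg] at hp
  have hp' := valid_append.1 hp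
  have e : L.eval G.top (U ++ [J]) = K.vcomp (L.eval G.top U)
      (L.step (U.foldl G.cross G.top) J) := by
    rw [eval_append hp]
    have h1 : K.t1 (L.step (U.foldl G.cross G.top) J) =
        L.path G.s (G.cross (U.foldl G.cross G.top) J) := t1_step hp'.2.2.1 hp'.2.1
    have h2 := K.vcomp_id1 (L.step (U.foldl G.cross G.top) J)
    rw [h1] at h2
    exact congrArg _ h2
  have hs := s1_swap (L := L) g
  have ht := t1_swap (L := L) g
  have hq := s1_post (L := L) g
  unfold genCell
  rw [hf] at hs ht hq ⊢
  rw [hg, e, sand_vcomp_left]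
  · rw [(s1_eval hp'.1).2, s1_step hp'.2.2.1 hp'.2.1]
  · rw [hs, t1_step hp'.2.2.1 hp'.2.1]
  · rw [ht, hq]

theorem sand_three {A B : K.C2} {X Y Z : K.C3} (h1 : K.t1 A = K.s1 (K.s2 X))
    (h2 : K.t1 (K.s2 X) = K.s1 B) (h3 : K.t2 X = K.s2 Y) (h4 : K.t2 Y = K.s2 Z) :
    K.tcomp (K.sand A X B) (K.tcomp (K.sand A Y B) (K.sand A Z B)) =
      K.sand A (K.tcomp X (K.tcomp Y Z)) B := by
  have e1 : K.s1 (K.s2 Y) = K.s1 (K.s2 X) := by rw [← h3]; simp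
  have e2 : K.t1 (K.s2 Y) = K.t1 (K.s2 X) := by rw [← h3]; simp
  rw [← sand_tcomp (by rw [e1, h1]) (by rw [e2, h2]) h4, ← sand_tcomp h1 h2]
  rw [h3, K.s2_tcomp _ _ h4]

variable {x₁ x₂ x₃ x₄ x₅ x₆ : G.LinExt} {U : List G.IFace}

theorem genCell_braid (h₁ : x₁.toList = U ++ F :: H :: J :: V)
    (h₂ : x₂.toList = U ++ H :: F :: J :: V)
    (h₃ : x₃.toList = U ++ H :: J :: F :: V) (h₄ : x₄.toList = U ++ J :: H :: F :: V)
    (h₅ : x₅.toList = U ++ F :: J :: H :: V) (h₆ : x₆.toList = U ++ J :: F :: H :: V)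
    (hpos : ∃ u v w z, U.foldl G.cross G.top =
      u ++ (G.upper F.1 ++ (v ++ (G.upper H.1 ++ (w ++ (G.upper J.1 ++ z)))))) :
    K.tcomp (L.genCell (x := x₁) (y := x₂) ⟨U, F, H, J :: V, h₁, h₂⟩)
      (K.tcomp (L.genCell (x := x₂) (y := x₃) ⟨U ++ [H], F, J, V, by simp [h₂], by simp [h₃]⟩)
        (L.genCell (x := x₃) (y := x₄) ⟨U, H, J, F :: V, h₃, h₄⟩)) =
    K.tcomp (L.genCell (x := x₁) (y := x₅) ⟨U ++ [F], H, J, V, by simp [h₁], by simp [h₅]⟩)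
      (K.tcomp (L.genCell (x := x₅) (y := x₆) ⟨U, F, J, H :: V, h₅, h₆⟩)
        (L.genCell (x := x₆) (y := x₄) ⟨U ++ [J], F, H, V, by simp [h₆], by simp [h₄]⟩)) := by
  obtain ⟨u, v, w, z, hpos⟩ := hpos
  let g12 : Swap x₁ x₂ := ⟨U, F, H, J :: V, h₁, h₂⟩
  let g23 : Swap x₂ x₃ := ⟨U ++ [H], F, J, V, by simp [h₂], by simp [h₃]⟩
  let g34 : Swap x₃ x₄ := ⟨U, H, J, F :: V, h₃, h₄⟩
  let g15 : Swap x₁ x₅ := ⟨U ++ [F], H, J, V, by simp [h₁], by simp [h₅]⟩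
  let g56 : Swap x₅ x₆ := ⟨U, F, J, H :: V, h₅, h₆⟩
  let g64 : Swap x₆ x₄ := ⟨U ++ [J], F, H, V, by simp [h₆], by simp [h₄]⟩
  have hp := g12.isPath
  have key := braid_aux (L := L) hp hpos
  have f23 : g23.front = G.cross g12.front H := by simp [g23, g12, Swap.front]
  have f15 : g15.front = G.cross g12.front F := by simp [g15, g12, Swap.front]
  have f64 : g64.front = G.cross g12.front J := by simp [g64, g12, Swap.front]
  have a12 : Apart g12.front F H := g12.apart
  have a34 : Apart g12.front H J := g34.apart
  have a56 : Apart g12.front F J := g56.apart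
  have a23 : Apart (G.cross g12.front H) F J := f23 ▸ g23.apart
  have a15 : Apart (G.cross g12.front F) H J := f15 ▸ g15.apart
  have a64 : Apart (G.cross g12.front J) F H := f64 ▸ g64.apart
  have v1 : Valid g12.front (F :: H :: J :: V) := g12.valid
  have v2 : Valid g12.front (H :: F :: J :: V) := g12.symm.valid
  have v3 : Valid g12.front (H :: J :: F :: V) := g34.valid
  have v4 : Valid g12.front (J :: H :: F :: V) := g34.symm.valid
  have v5 : Valid g12.front (F :: J :: H :: V) := g56.valid
  have v6 : Valid g12.front (J :: F :: H :: V) := g56.symm.valid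
  have c12 := a12.cross_comm hp
  have c34 := a34.cross_comm hp
  have c56 := a56.cross_comm hp
  have c23 := a23.cross_comm v2.2.2.2.1
  have c15 := a15.cross_comm v1.2.2.2.1
  have c64 := a64.cross_comm v4.2.2.2.1
  change K.tcomp (L.genCell g12) (K.tcomp (L.genCell g23) (L.genCell g34)) =
    K.tcomp (L.genCell g15) (K.tcomp (L.genCell g56) (L.genCell g64))
  rw [genCell_left g12 (J := J) (V := V) rfl, genCell_right g23 (U := U) (J := H) rfl,
    genCell_left g34 (J := F) (V := V) rfl, genCell_right g15 (U := U) (J := F) rfl,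
    genCell_left g56 (J := H) (V := V) rfl, genCell_right g64 (U := U) (J := J) rfl]
  change K.tcomp (K.sand (L.eval G.top U) (K.hcomp (L.swapCell g12.front F H)
      (K.id2 (L.step (G.cross (G.cross g12.front F) H) J)))
      (L.eval (G.cross (G.cross (G.cross g12.front F) H) J) V))
    (K.tcomp (K.sand (L.eval G.top U) (K.hcomp (K.id2 (L.step g12.front H))
        (L.swapCell (G.cross g12.front H) F J))
        (L.eval (G.cross (G.cross (G.cross g12.front H) F) J) V))
      (K.sand (L.eval G.top U) (K.hcomp (L.swapCell g12.front H J)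
        (K.id2 (L.step (G.cross (G.cross g12.front H) J) F)))
        (L.eval (G.cross (G.cross (G.cross g12.front H) J) F) V))) =
    K.tcomp (K.sand (L.eval G.top U) (K.hcomp (K.id2 (L.step g12.front F))
        (L.swapCell (G.cross g12.front F) H J))
        (L.eval (G.cross (G.cross (G.cross g12.front F) H) J) V))
    (K.tcomp (K.sand (L.eval G.top U) (K.hcomp (L.swapCell g12.front F J)
        (K.id2 (L.step (G.cross (G.cross g12.front F) J) H)))
        (L.eval (G.cross (G.cross (G.cross g12.front F) J) H) V))
      (K.sand (L.eval G.top U) (K.hcomp (K.id2 (L.step g12.front J))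
        (L.swapCell (G.cross g12.front J) F H))
        (L.eval (G.cross (G.cross (G.cross g12.front J) F) H) V)))
  have b1 : L.eval (G.cross (G.cross (G.cross g12.front H) F) J) V =
      L.eval (G.cross (G.cross (G.cross g12.front F) H) J) V := by rw [c12]
  have b2 : L.eval (G.cross (G.cross (G.cross g12.front H) J) F) V =
      L.eval (G.cross (G.cross (G.cross g12.front F) H) J) V := by rw [← c23, c12]
  have b3 : L.eval (G.cross (G.cross (G.cross g12.front F) J) H) V =
      L.eval (G.cross (G.cross (G.cross g12.front F) H) J) V := by rw [c15]
  have b4 : L.eval (G.cross (G.cross (G.cross g12.front J) F) H) V =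
      L.eval (G.cross (G.cross (G.cross g12.front F) H) J) V := by rw [c15, c56]
  have hA : K.t1 (L.eval G.top U) = L.path G.s g12.front := t1_pre g12
  have hB : K.s1 (L.eval (G.cross (G.cross (G.cross g12.front F) H) J) V) =
      L.path G.s (G.cross (G.cross (G.cross g12.front F) H) J) := (s1_eval v1.2.2.2.2.2.2).1
  rw [b1, b2, b3, b4, sand_three, sand_three, key]
  · rw [hA, s2_right v1 a15, (s1_three v1).1]
  · rw [hB, s2_right v1 a15, (s1_three v1).2]
  · rw [t2_right v1 a15, s2_left v5 a56]
  · rw [t2_left v5 v6 a56, s2_right v6 a64]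
  · rw [hA, s2_left v1 a12, (s1_three v1).1]
  · rw [hB, s2_left v1 a12, (s1_three v1).2]
  · rw [t2_left v1 v2 a12, s2_right v2 a23]
  · rw [t2_right v2 a23, s2_left v3 a34]

end braid

end Labelling

namespace Labelling

open CategoryTheory

variable {G : PastingScheme.{u}} {K : GrayCategory.{w₀, w₁, w₂, w₃}} (L : Labelling G K)

/-- The hom-category `K(S, T)[p, q]`, where `S`, `T` are the labels of the source and the sink of the
pasting scheme and `p`, `q` are the composites of its top path and its bottom path. -/
abbrev Target : Type w₂ := K.HomCat (L.path G.s G.top) (L.path G.s G.bot)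

/-- The composite 2-cell of the labelling for a given order of the faces. -/
noncomputable def obj (x : G.LinExt) : L.Target where
  cell := L.eval G.top x.toList
  src := (s1_eval x.valid).1
  tgt := by rw [(s1_eval x.valid).2, x.foldl_eq_bot]

/-- The interchange isomorphism between the composites before and after an exchange. -/
noncomputable def genHom {x y : G.LinExt} (g : Swap x y) : L.obj x ⟶ L.obj y :=
  ⟨L.genCell g, s2_genCell g, t2_genCell g⟩

theorem genHom_symm {x y : G.LinExt} (g : Swap x y) :
    L.genHom g ≫ L.genHom g.symm = 𝟙 (L.obj x) :=
  Subtype.ext (genCell_symm g)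

section braid

variable {x₁ x₂ x₃ x₄ x₅ x₆ : G.LinExt} {U V : List G.IFace} {F H J : G.IFace}

/-- The two ways to reverse three consecutive faces lead to the same 3-cell. -/
def Hexagon (h₁ : x₁.toList = U ++ F :: H :: J :: V) (h₂ : x₂.toList = U ++ H :: F :: J :: V)
    (h₃ : x₃.toList = U ++ H :: J :: F :: V) (h₄ : x₄.toList = U ++ J :: H :: F :: V)
    (h₅ : x₅.toList = U ++ F :: J :: H :: V) (h₆ : x₆.toList = U ++ J :: F :: H :: V) : Prop :=
  L.genHom (x := x₁) (y := x₂) ⟨U, F, H, J :: V, h₁, h₂⟩ ≫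
      L.genHom (x := x₂) (y := x₃) ⟨U ++ [H], F, J, V, by simp [h₂], by simp [h₃]⟩ ≫
      L.genHom (x := x₃) (y := x₄) ⟨U, H, J, F :: V, h₃, h₄⟩ =
    L.genHom (x := x₁) (y := x₅) ⟨U ++ [F], H, J, V, by simp [h₁], by simp [h₅]⟩ ≫
      L.genHom (x := x₅) (y := x₆) ⟨U, F, J, H :: V, h₅, h₆⟩ ≫
      L.genHom (x := x₆) (y := x₄) ⟨U ++ [J], F, H, V, by simp [h₆], by simp [h₄]⟩

variable {L} {h₁ : x₁.toList = U ++ F :: H :: J :: V} {h₂ : x₂.toList = U ++ H :: F :: J :: V}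
    {h₃ : x₃.toList = U ++ H :: J :: F :: V} {h₄ : x₄.toList = U ++ J :: H :: F :: V}
    {h₅ : x₅.toList = U ++ F :: J :: H :: V} {h₆ : x₆.toList = U ++ J :: F :: H :: V}

theorem hexagon_aux₁ {C : Type*} [Category* C] {X₁ X₂ X₃ X₄ X₅ X₆ : C} {a : X₁ ⟶ X₂}
    {a' : X₂ ⟶ X₁} {b : X₂ ⟶ X₃} {c : X₃ ⟶ X₄} {d : X₁ ⟶ X₅} {e : X₅ ⟶ X₆} {f : X₆ ⟶ X₄}
    {f' : X₄ ⟶ X₆} (h : a ≫ b ≫ c = d ≫ e ≫ f) (ha : a' ≫ a = 𝟙 _) (hf : f ≫ f' = 𝟙 _) :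
    a' ≫ d ≫ e = b ≫ c ≫ f' := by
  have h1 : a' ≫ (a ≫ b ≫ c) ≫ f' = a' ≫ (d ≫ e ≫ f) ≫ f' := by rw [h]
  simp only [Category.assoc, hf, Category.comp_id] at h1
  rw [← h1, ← Category.assoc a' a, ha, Category.id_comp]

theorem hexagon_aux₂ {C : Type*} [Category* C] {X₁ X₂ X₃ X₄ X₅ X₆ : C} {a : X₁ ⟶ X₂}
    {b : X₂ ⟶ X₃} {c : X₃ ⟶ X₄} {d : X₁ ⟶ X₅} {e : X₅ ⟶ X₆} {f : X₆ ⟶ X₄}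
    {a' : X₂ ⟶ X₁} {b' : X₃ ⟶ X₂} {c' : X₄ ⟶ X₃} {d' : X₅ ⟶ X₁} {e' : X₆ ⟶ X₅} {f' : X₄ ⟶ X₆}
    (h : a ≫ b ≫ c = d ≫ e ≫ f) (ha : a ≫ a' = 𝟙 _) (hb : b ≫ b' = 𝟙 _) (hc : c ≫ c' = 𝟙 _)
    (hd : d' ≫ d = 𝟙 _) (he : e' ≫ e = 𝟙 _) (hf : f' ≫ f = 𝟙 _) :
    f' ≫ e' ≫ d' = c' ≫ b' ≫ a' := by
  have h1 : (a ≫ b ≫ c) ≫ c' ≫ b' ≫ a' = 𝟙 _ := by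
    simp only [Category.assoc]
    rw [← Category.assoc c c', hc, Category.id_comp, ← Category.assoc b b', hb, Category.id_comp,
      ha]
  have h2 : (f' ≫ e' ≫ d') ≫ d ≫ e ≫ f = 𝟙 _ := by
    simp only [Category.assoc]
    rw [← Category.assoc d' d, hd, Category.id_comp, ← Category.assoc e' e, he, Category.id_comp,
      hf]
  calc f' ≫ e' ≫ d' = (f' ≫ e' ≫ d') ≫ (a ≫ b ≫ c) ≫ c' ≫ b' ≫ a' := by
        rw [h1, Category.comp_id]
    _ = ((f' ≫ e' ≫ d') ≫ d ≫ e ≫ f) ≫ c' ≫ b' ≫ a' := by rw [h, ← Category.assoc]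
    _ = c' ≫ b' ≫ a' := by rw [h2, Category.id_comp]

theorem Hexagon.swap (h : L.Hexagon h₁ h₂ h₃ h₄ h₅ h₆) : L.Hexagon h₂ h₁ h₅ h₆ h₃ h₄ :=
  hexagon_aux₁ h (L.genHom_symm (x := x₂) (y := x₁) ⟨U, H, F, J :: V, h₂, h₁⟩)
    (L.genHom_symm (x := x₆) (y := x₄) ⟨U ++ [J], F, H, V, by simp [h₆], by simp [h₄]⟩)

theorem Hexagon.reverse (h : L.Hexagon h₁ h₂ h₃ h₄ h₅ h₆) : L.Hexagon h₄ h₃ h₂ h₁ h₆ h₅ :=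
  (hexagon_aux₂ h
    (L.genHom_symm (x := x₁) (y := x₂) ⟨U, F, H, J :: V, h₁, h₂⟩)
    (L.genHom_symm (x := x₂) (y := x₃) ⟨U ++ [H], F, J, V, by simp [h₂], by simp [h₃]⟩)
    (L.genHom_symm (x := x₃) (y := x₄) ⟨U, H, J, F :: V, h₃, h₄⟩)
    (L.genHom_symm (x := x₅) (y := x₁) ⟨U ++ [F], J, H, V, by simp [h₅], by simp [h₁]⟩)
    (L.genHom_symm (x := x₆) (y := x₅) ⟨U, J, F, H :: V, h₆, h₅⟩)
    (L.genHom_symm (x := x₄) (y := x₆) ⟨U ++ [J], H, F, V, by simp [h₄], by simp [h₆]⟩)).symm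

theorem three_chain {p u v w u' v' w' : List G.E} {F H J : G.IFace} (hp : G.IsPath G.s p G.t)
    (h : p = u ++ (G.upper F.1 ++ (v ++ (G.upper H.1 ++ w))))
    (h' : p = u' ++ (G.upper H.1 ++ (v' ++ (G.upper J.1 ++ w')))) :
    ∃ u v w z, p = u ++ (G.upper F.1 ++ (v ++ (G.upper H.1 ++ (w ++ (G.upper J.1 ++ z))))) := by
  have e1 := h
  rw [regroup] at e1
  have a1 : G.after p H = w := by
    subst e1
    exact after_eq hp
  have a2 : G.after p H = v' ++ (G.upper J.1 ++ w') := by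
    subst h'
    exact after_eq hp
  rw [a1] at a2
  exact ⟨u, v, v', w', by rw [h, a2]⟩

variable (h₁ h₂ h₃ h₄ h₅ h₆) in
theorem hexagon : L.Hexagon h₁ h₂ h₃ h₄ h₅ h₆ := by
  let g12 : Swap x₁ x₂ := ⟨U, F, H, J :: V, h₁, h₂⟩
  let g34 : Swap x₃ x₄ := ⟨U, H, J, F :: V, h₃, h₄⟩
  let g56 : Swap x₅ x₆ := ⟨U, F, J, H :: V, h₅, h₆⟩
  have hp := g12.isPath
  have a12 : Apart (U.foldl G.cross G.top) F H := g12.apart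
  have a34 : Apart (U.foldl G.cross G.top) H J := g34.apart
  have a56 : Apart (U.foldl G.cross G.top) F J := g56.apart
  have base : ∀ {y₁ y₂ y₃ y₄ y₅ y₆ : G.LinExt} {A B C : G.IFace}
      (k₁ : y₁.toList = U ++ A :: B :: C :: V) (k₂ : y₂.toList = U ++ B :: A :: C :: V)
      (k₃ : y₃.toList = U ++ B :: C :: A :: V) (k₄ : y₄.toList = U ++ C :: B :: A :: V)
      (k₅ : y₅.toList = U ++ A :: C :: B :: V) (k₆ : y₆.toList = U ++ C :: A :: B :: V)
      {u v w u' v' w' : List G.E},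
      (U.foldl G.cross G.top) = u ++ (G.upper A.1 ++ (v ++ (G.upper B.1 ++ w))) →
      (U.foldl G.cross G.top) = u' ++ (G.upper B.1 ++ (v' ++ (G.upper C.1 ++ w'))) →
      L.Hexagon k₁ k₂ k₃ k₄ k₅ k₆ := fun k₁ k₂ k₃ k₄ k₅ k₆ _ _ _ _ _ _ h h' =>
    Subtype.ext (genCell_braid k₁ k₂ k₃ k₄ k₅ k₆ (three_chain hp h h'))
  rcases a12 with ⟨u, v, w, hFH⟩ | ⟨u, v, w, hHF⟩
  · rcases a34 with ⟨u', v', w', hHJ⟩ | ⟨u', v', w', hJH⟩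
    · exact base h₁ h₂ h₃ h₄ h₅ h₆ hFH hHJ
    · rcases a56 with ⟨u'', v'', w'', hFJ⟩ | ⟨u'', v'', w'', hJF⟩
      · exact (base h₅ h₆ h₄ h₃ h₁ h₂ hFJ hJH).reverse.swap.reverse
      · exact (base h₆ h₅ h₁ h₂ h₄ h₃ hJF hFH).reverse.swap
  · rcases a34 with ⟨u', v', w', hHJ⟩ | ⟨u', v', w', hJH⟩
    · rcases a56 with ⟨u'', v'', w'', hFJ⟩ | ⟨u'', v'', w'', hJF⟩
      · exact (base h₂ h₁ h₅ h₆ h₃ h₄ hHF hFJ).swap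
      · exact (base h₃ h₄ h₆ h₅ h₂ h₁ hHJ hJF).swap.reverse
    · exact (base h₄ h₃ h₂ h₁ h₆ h₅ hJH hHF).reverse

end braid

/-- The exchanges of neighbouring faces as interchange isomorphisms. -/
noncomputable def prefunctor : G.LinExt ⥤q L.Target where
  obj := L.obj
  map g := L.genHom g

theorem lift_toPath {x y : G.LinExt} (g : Swap x y) :
    (Paths.lift L.prefunctor).map g.toPath = L.genHom g :=
  Paths.lift_toPath L.prefunctor g

/-- The canonical functor `𝒞_𝒢 ⥤ K(S, T)[p, q]` of a labelling: an order of the faces is sent to the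
corresponding composite 2-cell, and the exchange of two neighbouring faces is sent to the
whiskered interchange isomorphism. -/
noncomputable def functor : G.Orders ⥤ L.Target :=
  CategoryTheory.Quotient.lift (OrderRel (G := G)) (Paths.lift L.prefunctor) (by
    intro x y f₁ f₂ h
    cases h with
    | inv g =>
      rw [Functor.map_comp, CategoryTheory.Functor.map_id, L.lift_toPath, L.lift_toPath]
      exact L.genHom_symm g
    | far U V W F H J M h₁ h₂ h₃ h₄ =>
      rw [Functor.map_comp, Functor.map_comp, L.lift_toPath, L.lift_toPath, L.lift_toPath,
        L.lift_toPath]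
      exact Subtype.ext (genCell_far U V W F H J M h₁ h₂ h₃ h₄)
    | braid U V F H J h₁ h₂ h₃ h₄ h₅ h₆ =>
      rw [Functor.map_comp, Functor.map_comp, Functor.map_comp, Functor.map_comp, L.lift_toPath,
        L.lift_toPath, L.lift_toPath, L.lift_toPath, L.lift_toPath, L.lift_toPath]
      exact hexagon h₁ h₂ h₃ h₄ h₅ h₆)

end Labelling

namespace Labelling

open CategoryTheory

variable {G : PastingScheme.{u}} {K : GrayCategory.{w₀, w₁, w₂, w₃}} (L : Labelling G K)

/-- The labelling with the same vertices and edges and with new 2-cells. -/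
abbrev relabel (c : G.IFace → K.C2)
    (hc : ∀ F, K.s1 (c F) = K.s1 (L.cell F) ∧ K.t1 (c F) = K.t1 (L.cell F)) : Labelling G K where
  vert := L.vert
  edge := L.edge
  cell := c
  edge_src := L.edge_src
  edge_tgt := L.edge_tgt
  cell_src F := (hc F).1.trans (L.cell_src F)
  cell_tgt F := (hc F).2.trans (L.cell_tgt F)

section trans

variable {L} {c : G.IFace → K.C2}
    {hc : ∀ F, K.s1 (c F) = K.s1 (L.cell F) ∧ K.t1 (c F) = K.t1 (L.cell F)}
    {Θ : G.IFace → K.C3} {p : List G.E} {F H : G.IFace} {l m : List G.IFace}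

theorem s2_step3_relabel (hs : ∀ F, K.s2 (Θ F) = L.cell F) (ht : ∀ F, K.t2 (Θ F) = c F)
    (h : Valid p (F :: l)) : K.s2 (L.step3 p F (Θ F)) = L.step p F ∧
      K.t2 (L.step3 p F (Θ F)) = (L.relabel c hc).step p F := by
  refine ⟨s2_step3 h.2.1 h.1 (hs F), ?_⟩
  obtain ⟨⟨u, w, rfl⟩, hp, -⟩ := h
  rw [step3_eq hp, step_eq hp, t2_whisk3 (by rw [hs, t0_before hp]) (by rw [hs, s0_after hp]), ht]

theorem s2_evalHom (hs : ∀ F, K.s2 (Θ F) = L.cell F) (ht : ∀ F, K.t2 (Θ F) = c F)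
    (h : Valid p l) : K.s2 (L.evalHom Θ p l) = L.eval p l ∧
      K.t2 (L.evalHom Θ p l) = (L.relabel c hc).eval p l := by
  induction l generalizing p with
  | nil => exact ⟨K.s2_id2 _, K.t2_id2 _⟩
  | cons F l ih =>
    obtain ⟨i1, i2⟩ := ih h.2.2
    obtain ⟨j1, j2⟩ := s2_step3_relabel (hc := hc) hs ht h
    have e : K.t1 (K.s2 (L.step3 p F (Θ F))) = K.s1 (K.s2 (L.evalHom Θ (G.cross p F) l)) := by
      rw [i1, j1, t1_step h.2.1 h.1, (s1_eval h.2.2).1]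
    unfold evalHom
    rw [K.s2_hcomp _ _ e, K.t2_hcomp _ _ e, i1, i2, j1, j2]
    exact ⟨rfl, rfl⟩

theorem s1_step3 (hs : ∀ F, K.s2 (Θ F) = L.cell F) (h : Valid p (F :: l)) :
    K.s1 (K.s2 (L.step3 p F (Θ F))) = L.path G.s p ∧
      K.t1 (K.s2 (L.step3 p F (Θ F))) = L.path G.s (G.cross p F) := by
  rw [s2_step3 h.2.1 h.1 (hs F)]
  exact ⟨s1_step h.2.1 h.1, t1_step h.2.1 h.1⟩

theorem s1_evalHom (hs : ∀ F, K.s2 (Θ F) = L.cell F) (h : Valid p l) :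
    K.s1 (K.s2 (L.evalHom Θ p l)) = L.path G.s p ∧
      K.t1 (K.s2 (L.evalHom Θ p l)) = L.path G.s (l.foldl G.cross p) := by
  rw [(s2_evalHom (c := fun F => K.t2 (Θ F)) (hc := fun F => by simp [← hs]) hs (fun _ => rfl) h).1]
  exact s1_eval h

theorem evalHom_append (hs : ∀ F, K.s2 (Θ F) = L.cell F) (h : Valid p (l ++ m)) :
    L.evalHom Θ p (l ++ m) = K.hcomp (L.evalHom Θ p l) (L.evalHom Θ (l.foldl G.cross p) m) := by
  induction l generalizing p with
  | nil =>
    have := (s1_evalHom (L := L) hs h).1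
    change L.evalHom Θ p m = K.hcomp (K.id2 (K.id1 (L.path G.s p))) (L.evalHom Θ p m)
    rw [List.nil_append] at this
    rw [← this, K.id_hcomp]
  | cons F l ih =>
    have h1 := valid_append.1 h.2.2
    have i1 := s1_evalHom (L := L) hs h1.1
    have i2 := s1_evalHom (L := L) hs h1.2
    change K.hcomp (L.step3 p F (Θ F)) (L.evalHom Θ (G.cross p F) (l ++ m)) =
      K.hcomp (K.hcomp (L.step3 p F (Θ F)) (L.evalHom Θ (G.cross p F) l)) _
    rw [ih h.2.2, K.hcomp_assoc]
    · rfl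
    · rw [(s1_step3 hs h).2, i1.1]
    · rw [i1.2, List.foldl_cons, i2.1]

theorem evalHom_cons_cons (hs : ∀ F, K.s2 (Θ F) = L.cell F) (h : Valid p (F :: H :: l)) :
    L.evalHom Θ p (F :: H :: l) =
      K.hcomp (K.hcomp (L.step3 p F (Θ F)) (L.step3 (G.cross p F) H (Θ H)))
        (L.evalHom Θ (G.cross (G.cross p F) H) l) := by
  rw [K.hcomp_assoc]
  · rfl
  · rw [(s1_step3 hs h).2, (s1_step3 hs h.2.2).1]
  · rw [(s1_step3 hs h.2.2).2, (s1_evalHom hs h.2.2.2.2).1]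

theorem s2_two (hs : ∀ F, K.s2 (Θ F) = L.cell F) (ht : ∀ F, K.t2 (Θ F) = c F)
    (h : Valid p (F :: H :: l)) :
    K.s2 (K.hcomp (L.step3 p F (Θ F)) (L.step3 (G.cross p F) H (Θ H))) =
      K.vcomp (L.step p F) (L.step (G.cross p F) H) ∧
    K.t2 (K.hcomp (L.step3 p F (Θ F)) (L.step3 (G.cross p F) H (Θ H))) =
      K.vcomp ((L.relabel c hc).step p F) ((L.relabel c hc).step (G.cross p F) H) := by
  have e : K.t1 (K.s2 (L.step3 p F (Θ F))) = K.s1 (K.s2 (L.step3 (G.cross p F) H (Θ H))) := by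
    rw [(s1_step3 hs h).2, (s1_step3 hs h.2.2).1]
  obtain ⟨i1, i2⟩ := s2_step3_relabel (hc := hc) hs ht h
  obtain ⟨j1, j2⟩ := s2_step3_relabel (hc := hc) hs ht h.2.2
  rw [K.s2_hcomp _ _ e, K.t2_hcomp _ _ e, i1, i2, j1, j2]
  exact ⟨rfl, rfl⟩

theorem swap_natural_pos {u v w : List G.E} (hs : ∀ F, K.s2 (Θ F) = L.cell F)
    (ht : ∀ F, K.t2 (Θ F) = c F) (hp : G.IsPath G.s p G.t)
    (h : p = u ++ (G.upper F.1 ++ (v ++ (G.upper H.1 ++ w)))) :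
    K.tcomp (K.hcomp (L.step3 p F (Θ F)) (L.step3 (G.cross p F) H (Θ H)))
        ((L.relabel c hc).swapCell p F H) =
      K.tcomp (L.swapCell p F H)
        (K.hcomp (L.step3 p H (Θ H)) (L.step3 (G.cross p H) F (Θ F))) := by
  obtain ⟨⟨a1, a2⟩, ⟨b1, b2⟩, ⟨c1, c2⟩, ⟨d1, d2⟩⟩ := wings (L := L) hp h
  have hb : K.Beside (L.path G.s u) (L.cell F) (L.path (G.faceTgt F.1) v) (L.cell H)
      (L.path (G.faceTgt H.1) w) := beside (by rw [← h]; exact hp)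
  have key := whisk3_γ_natural (K := K) (Γ := Θ F) (Δ := Θ H) (by rw [hs, hs]; exact hb)
  rw [hs, hs, ht, ht] at key
  rw [swapCell_pos hp h, swapCell_pos hp h]
  unfold step3
  rw [a1, a2, b1, b2, c1, c2, d1, d2]
  exact key

theorem swap_natural (hs : ∀ F, K.s2 (Θ F) = L.cell F) (ht : ∀ F, K.t2 (Θ F) = c F)
    (hv : Valid p (F :: H :: l)) (hv' : Valid p (H :: F :: l)) (h : Apart p F H) :
    K.tcomp (K.hcomp (L.step3 p F (Θ F)) (L.step3 (G.cross p F) H (Θ H)))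
        ((L.relabel c hc).swapCell p F H) =
      K.tcomp (L.swapCell p F H)
        (K.hcomp (L.step3 p H (Θ H)) (L.step3 (G.cross p H) F (Θ F))) := by
  have hp := hv.2.1
  rcases id h with ⟨u, v, w, h'⟩ | ⟨u, v, w, h'⟩
  · exact swap_natural_pos hs ht hp h'
  · have key := swap_natural_pos (hc := hc) hs ht hp h'
    obtain ⟨i1, i2⟩ := s2_two (hc := hc) hs ht hv
    obtain ⟨j1, j2⟩ := s2_two (hc := hc) hs ht hv'
    refine tcomp_inv_square key ?_ ?_ ?_ ?_ ?_ ?_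
    · rw [swapCell_swapCell hp h, s2_swapCell hp h, t2_swapCell hp h.symm]
    · rw [swapCell_swapCell hp h.symm]
    · rw [j2, s2_swapCell hp h.symm]
    · rw [i1, t2_swapCell hp h.symm]
    · rw [t2_swapCell hp h, s2_swapCell hp h.symm]
    · rw [t2_swapCell hp h.symm, s2_swapCell hp h]

theorem genCell_natural (hs : ∀ F, K.s2 (Θ F) = L.cell F) (ht : ∀ F, K.t2 (Θ F) = c F)
    {x y : G.LinExt} (g : Swap x y) :
    K.tcomp (L.evalHom Θ G.top x.toList) ((L.relabel c hc).genCell g) =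
      K.tcomp (L.genCell g) (L.evalHom Θ G.top y.toList) := by
  have hx : Valid G.top (g.pre ++ g.F :: g.H :: g.post) := g.hx ▸ x.valid
  have hy : Valid G.top (g.pre ++ g.H :: g.F :: g.post) := g.hy ▸ y.valid
  have hvx := g.valid
  have hvy := g.symm.valid
  have key := swap_natural (hc := hc) hs ht hvx hvy g.apart
  obtain ⟨i1, i2⟩ := s2_two (hc := hc) hs ht hvx
  obtain ⟨j1, j2⟩ := s2_two (hc := hc) hs ht hvy
  have e1 : L.evalHom Θ G.top (g.pre ++ g.F :: g.H :: g.post) =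
      K.hcomp (L.evalHom Θ G.top g.pre) (L.evalHom Θ g.front (g.F :: g.H :: g.post)) :=
    evalHom_append hs hx
  have e2 : L.evalHom Θ G.top (g.pre ++ g.H :: g.F :: g.post) =
      K.hcomp (L.evalHom Θ G.top g.pre) (L.evalHom Θ g.front (g.H :: g.F :: g.post)) :=
    evalHom_append hs hy
  have e3 : L.evalHom Θ g.front (g.F :: g.H :: g.post) = _ := evalHom_cons_cons hs hvx
  have e4 : L.evalHom Θ g.front (g.H :: g.F :: g.post) = _ := evalHom_cons_cons hs hvy
  rw [g.hx, g.hy, e1, e2, e3, e4]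
  have cc := g.apart.cross_comm g.isPath
  change _ = K.tcomp _ (K.hcomp _ (K.hcomp _
    (L.evalHom Θ (G.cross (G.cross g.front g.H) g.F) g.post)))
  rw [← cc]
  obtain ⟨k1, k2⟩ := s2_evalHom (hc := hc) hs ht g.valid_pre
  obtain ⟨m1, m2⟩ := s2_evalHom (hc := hc) hs ht hvx.2.2.2.2
  refine sand_natural key k1 k2 m1 m2 ?_ ?_ ?_ ?_
  · rw [i2, s2_swapCell g.isPath g.apart]
  · rw [t2_swapCell g.isPath g.apart]
    exact j1.symm
  · rw [t1_pre, i1, (s1_two hvx).1]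
  · rw [i1, (s1_two hvx).2, s1_post]

end trans

/-- The composite of the labelling with 3-cells `Θ` in place of the 2-cells, for a given order of the
faces. -/
noncomputable def transApp (c : G.IFace → K.C2)
    (hc : ∀ F, K.s1 (c F) = K.s1 (L.cell F) ∧ K.t1 (c F) = K.t1 (L.cell F))
    (Θ : G.IFace → K.C3) (hs : ∀ F, K.s2 (Θ F) = L.cell F) (ht : ∀ F, K.t2 (Θ F) = c F)
    (x : G.LinExt) : L.obj x ⟶ (show L.Target from (L.relabel c hc).obj x) :=
  ⟨L.evalHom Θ G.top x.toList, (s2_evalHom (hc := hc) hs ht x.valid).1,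
    (s2_evalHom hs ht x.valid).2⟩

theorem transApp_natural (c : G.IFace → K.C2)
    (hc : ∀ F, K.s1 (c F) = K.s1 (L.cell F) ∧ K.t1 (c F) = K.t1 (L.cell F))
    (Θ : G.IFace → K.C3) (hs : ∀ F, K.s2 (Θ F) = L.cell F) (ht : ∀ F, K.t2 (Θ F) = c F)
    {x y : G.LinExt} (f : Quiver.Path x y) :
    (show L.obj x ⟶ L.obj y from (Paths.lift L.prefunctor).map f) ≫ L.transApp c hc Θ hs ht y =
      L.transApp c hc Θ hs ht x ≫ (show (show L.Target from (L.relabel c hc).obj x) ⟶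
        (L.relabel c hc).obj y from (Paths.lift (L.relabel c hc).prefunctor).map f) := by
  induction f with
  | nil => exact (Category.id_comp _).trans (Category.comp_id _).symm
  | cons f g ih =>
    have e : L.genHom g ≫ L.transApp c hc Θ hs ht _ = L.transApp c hc Θ hs ht _ ≫
        (show (show L.Target from (L.relabel c hc).obj _) ⟶
          (L.relabel c hc).obj _ from (L.relabel c hc).genHom g) :=
      Subtype.ext (genCell_natural hs ht g).symm
    exact (Category.assoc _ _ _).trans ((congrArg _ e).trans ((Category.assoc _ _ _).symm.trans
      ((congrArg (fun z => z ≫ _) ih).trans (Category.assoc _ _ _))))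

/-- The natural transformation induced by a family `Θ` of 3-cells, one for each face. -/
noncomputable def trans (c : G.IFace → K.C2)
    (hc : ∀ F, K.s1 (c F) = K.s1 (L.cell F) ∧ K.t1 (c F) = K.t1 (L.cell F))
    (Θ : G.IFace → K.C3) (hs : ∀ F, K.s2 (Θ F) = L.cell F) (ht : ∀ F, K.t2 (Θ F) = c F) :
    L.functor ⟶ (L.relabel c hc).functor where
  app x := L.transApp c hc Θ hs ht x.as
  naturality := by
    rintro ⟨x⟩ ⟨y⟩ ⟨f⟩
    exact L.transApp_natural c hc Θ hs ht f

open Classical in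
theorem parallel_update {F : G.IFace} {α' : K.C2}
    (h : K.s1 α' = K.s1 (L.cell F) ∧ K.t1 α' = K.t1 (L.cell F)) (H : G.IFace) :
    K.s1 (Function.update L.cell F α' H) = K.s1 (L.cell H) ∧
      K.t1 (Function.update L.cell F α' H) = K.t1 (L.cell H) := by
  by_cases hH : H = F
  · subst hH
    simpa using h
  · simp [hH]

open Classical in
/-- The labelling `𝓛^{α'}`, with the 2-cell `α'` in place of the 2-cell of the face `F`. -/
noncomputable abbrev replace (F : G.IFace) (α' : K.C2)
    (h : K.s1 α' = K.s1 (L.cell F) ∧ K.t1 α' = K.t1 (L.cell F)) : Labelling G K :=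
  L.relabel (Function.update L.cell F α') (L.parallel_update h)

end Labelling

namespace Labelling

open CategoryTheory

variable {G : PastingScheme.{u}} {K : GrayCategory.{w₀, w₁, w₂, w₃}} (L : Labelling G K)

open Classical in
theorem replace_cell_of_ne {F H : G.IFace} (h : H ≠ F) {α' : K.C2}
    (hα : K.s1 α' = K.s1 (L.cell F) ∧ K.t1 α' = K.t1 (L.cell F)) :
    (L.replace F α' hα).cell H = L.cell H :=
  Function.update_of_ne h _ _

variable {L} in
theorem parallel {F : G.IFace} {Γ : K.C3} (hΓ : K.s2 Γ = L.cell F) :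
    K.s1 (K.t2 Γ) = K.s1 (L.cell F) ∧ K.t1 (K.t2 Γ) = K.t1 (L.cell F) := by
  simp [← hΓ]

/-- The labelling `𝓛^{α'}` for a 3-cell `Γ : α ⇛ α'`, where `α` is the 2-cell of the face `F`. -/
noncomputable abbrev act (F : G.IFace) (Γ : K.C3) (hΓ : K.s2 Γ = L.cell F) : Labelling G K :=
  L.replace F (K.t2 Γ) (parallel hΓ)

open Classical in
/-- The natural transformation `Γ* : 𝓛 ⇒ 𝓛^{α'}` induced by a 3-cell `Γ : α ⇛ α'`, where `α` is the
2-cell of the face `F`: its components are whiskerings of `Γ` with the 2-cells of the other faces. -/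
noncomputable def star (F : G.IFace) (Γ : K.C3) (hΓ : K.s2 Γ = L.cell F) :
    L.functor ⟶ (L.act F Γ hΓ).functor :=
  L.trans (Function.update L.cell F (K.t2 Γ)) (L.parallel_update (parallel hΓ))
    (Function.update (fun H => K.id2 (L.cell H)) F Γ)
    (fun H => by
      by_cases hH : H = F
      · subst hH
        simpa using hΓ
      · simp [hH])
    (fun H => by
      by_cases hH : H = F
      · subst hH
        simp
      · simp [hH])

theorem evalHom_id2 {Θ : G.IFace → K.C3} {p : List G.E} {l : List G.IFace}
    (h : Valid p l) (hΘ : ∀ F ∈ l, Θ F = K.id2 (L.cell F)) :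
    L.evalHom Θ p l = K.id2 (L.eval p l) := by
  induction l generalizing p with
  | nil => rfl
  | cons F l ih =>
    have i := ih h.2.2 (fun H hH => hΘ H (List.mem_cons_of_mem _ hH))
    unfold evalHom
    rw [i, hΘ F (List.mem_cons_self), eval, ← K.hcomp_id2 _ _
      (by rw [t1_step h.2.1 h.1, (s1_eval h.2.2).1])]
    congr 1
    obtain ⟨⟨u, w, rfl⟩, hp, -⟩ := h
    rw [step3_eq hp, step_eq hp, whisk3_id2 (t0_before hp) (s0_after hp)]

/-- The component of `Γ*` at an order `U F V` of the faces is the 3-cell `Γ`, whiskered first with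
1-cells and then with the composite 2-cells of the faces in `U` and in `V`. -/
theorem star_app (F : G.IFace) (Γ : K.C3) (hΓ : K.s2 Γ = L.cell F) (x : G.Orders)
    {U V : List G.IFace} (hx : x.as.toList = U ++ F :: V) :
    ((L.star F Γ hΓ).app x).1 = K.sand (L.eval G.top U)
      (L.step3 (U.foldl G.cross G.top) F Γ)
      (L.eval (G.cross (U.foldl G.cross G.top) F) V) := by
  classical
  have hv := x.as.valid
  have hn := x.as.nodup
  rw [hx] at hv hn
  have hU : F ∉ U := fun h => (List.disjoint_of_nodup_append hn) h (by simp)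
  have hV : F ∉ V := (List.nodup_cons.1 (List.nodup_append.1 hn).2.1).1
  have hs : ∀ H, K.s2 (Function.update (fun H => K.id2 (L.cell H)) F Γ H) = L.cell H := by
    intro H
    by_cases hH : H = F
    · subst hH
      simpa using hΓ
    · simp [hH]
  have e : ((L.star F Γ hΓ).app x).1 =
      L.evalHom (Function.update (fun H => K.id2 (L.cell H)) F Γ) G.top x.as.toList := by
    change L.evalHom _ _ _ = _
    congr 2
  rw [e, hx, evalHom_append hs hv, L.evalHom_id2 (valid_append.1 hv).1]
  · unfold sand
    congr 1
    unfold evalHom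
    rw [L.evalHom_id2 (valid_append.1 hv).2.2.2]
    · simp
    · intro H hH
      rw [Function.update_of_ne]
      rintro rfl
      exact hV hH
  · intro H hH
    rw [Function.update_of_ne]
    rintro rfl
    exact hU hH

open Classical in
/-- `(𝓛^{α'})^{β'} = (𝓛^{β'})^{α'}`. -/
theorem replace_comm {F H : G.IFace} (hne : F ≠ H) {α' β' : K.C2}
    (hα : K.s1 α' = K.s1 (L.cell F) ∧ K.t1 α' = K.t1 (L.cell F))
    (hβ : K.s1 β' = K.s1 (L.cell H) ∧ K.t1 β' = K.t1 (L.cell H)) :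
    (L.replace F α' hα).replace H β' (by rwa [L.replace_cell_of_ne hne.symm]) =
      (L.replace H β' hβ).replace F α' (by rwa [L.replace_cell_of_ne hne]) := by
  have e := Function.update_comm hne α' β' L.cell
  unfold replace relabel
  congr 1

/-- The functors of the labellings `(𝓛^{α'})^{β'}` and `(𝓛^{β'})^{α'}` coincide. -/
theorem functor_act_comm {F H : G.IFace} (hne : F ≠ H) {Γ Δ : K.C3} (hΓ : K.s2 Γ = L.cell F)
    (hΔ : K.s2 Δ = L.cell H) (hΓ' : K.s2 Γ = (L.act H Δ hΔ).cell F)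
    (hΔ' : K.s2 Δ = (L.act F Γ hΓ).cell H) :
    (show G.Orders ⥤ L.Target from ((L.act F Γ hΓ).act H Δ hΔ').functor) =
      ((L.act H Δ hΔ).act F Γ hΓ').functor :=
  eq_of_heq (congr_arg_heq Labelling.functor (L.replace_comm hne (parallel hΓ) (parallel hΔ)))

end Labelling

open CategoryTheory

/-! ### Transport of arrows in the hom-category -/

namespace GrayCategory

open CategoryTheory

/-! An equality of natural transformations is an equality of components, so one may fix an order of
the faces. Say that Fα comes before Fβ in it; the other case is symmetric. The composite 2-cell is
then a vertical composite, in the 2-category K(S, T), of one whiskered 2-cell per face. Both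
transformations at this order are whiskerings: Γ acts on the factor of Fα, Δ acts on the factor of
Fβ, and all other factors stay fixed. Since the two factors are different, the order of the two
actions is irrelevant by the interchange law of the strict 2-category K(S, T). The isomorphisms γ
play no part in this. They are needed only for the naturality of Γ* and Δ*, which is part of those
transformations and has already been settled. In particular Fα and Fβ need not be neighbours in the
order, and the order need not be rearranged.

The argument is made uniform in the position of the two faces by treating Γ* as the evaluation of a
whole family of 3-cells, one per face: Γ at Fα and identities elsewhere (`single`). Evaluation
`evalHom` whiskers every member of the family with 1-cells and composes the results along the order.
Two facts about it carry the proof. It depends on the labelling only through vertices and edges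
(`evalHom_relabel`), so the second of two successive transformations, which is built over a changed
labelling, can be evaluated over the original one. And it takes facewise composites of families to
composites of 3-cells (`evalHom_tcomp`), by induction along the order, using the interchange law and
the strictness of whiskering.

Each of the two composites is therefore the evaluation of a facewise composite of two families
(`star_comp_star_app`). Facewise the claim is only a unit law: as the two faces are distinct, at
every face at least one of the two factors is an identity (`tcomp_single_comm`).

There remains a matter of types. The labellings obtained by replacing the two 2-cells in either
order are equal but not definitionally so, hence one of the composites is followed by a transport.
It does not change the 3-cell of a component (`HomCat.comp_eqToHom_val`). -/

/-- An arrow of K(S, T)[p, q] is a 3-cell together with proofs about its boundary, and the set of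
3-cells does not depend on that boundary. Transport along an equality of objects thus alters only
the proofs. -/
theorem HomCat.comp_eqToHom_val {K : GrayCategory.{w₀, w₁, w₂, w₃}} {p q : K.C1}
    {α β δ : K.HomCat p q} (Γ : α ⟶ β) (h : β = δ) : (Γ ≫ eqToHom h).1 = Γ.1 := by
  subst h
  rw [eqToHom_refl, Category.comp_id]

end GrayCategory

/-! ### Evaluation of families of 3-cells along an order of the faces -/

namespace Labelling

open CategoryTheory

variable {G : PastingScheme.{u}} {K : GrayCategory.{w₀, w₁, w₂, w₃}} (L : Labelling G K)

/-- The 3-cells being composed are supplied by `Θ`; the labelling contributes only the 1-cells used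
for whiskering, that is, its vertices and edges, which relabelling keeps. This makes 3-cells that
belong to different stages of replacement comparable over one and the same labelling. -/
theorem evalHom_relabel (c : G.IFace → K.C2)
    (hc : ∀ F, K.s1 (c F) = K.s1 (L.cell F) ∧ K.t1 (c F) = K.t1 (L.cell F))
    (Θ : G.IFace → K.C3) (p : List G.E) (l : List G.IFace) :
    (L.relabel c hc).evalHom Θ p l = L.evalHom Θ p l := by
  induction l generalizing p with
  | nil => rfl
  -- The whiskered 3-cell of the first face is the same for both labellings by definition, so only
  -- the tail needs the induction hypothesis.
  | cons F l ih => exact congrArg (K.hcomp _) (ih (G.cross p F))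

/-- Whiskering with 1-cells on either side is a strict 2-functor. As its laws hold for composable
cells only, the splitting of `p` at the uppermost path of `F` is needed: it identifies the wings and
matches their end points with those of the 2-cell. -/
theorem step3_tcomp {p : List G.E} {F : G.IFace} {Γ Δ : K.C3} (hp : G.IsPath G.s p G.t)
    (hF : ∃ u w, p = u ++ (G.upper F.1 ++ w)) (hΓ : K.s2 Γ = L.cell F) (h : K.t2 Γ = K.s2 Δ) :
    L.step3 p F (K.tcomp Γ Δ) = K.tcomp (L.step3 p F Γ) (L.step3 p F Δ) := by
  obtain ⟨u, w, rfl⟩ := hF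
  rw [step3_eq hp, step3_eq hp, step3_eq hp,
    whisk3_tcomp (by rw [hΓ, t0_before hp]) (by rw [hΓ, s0_after hp]) h]

/-- The composites of families of 3-cells along an order of the faces are functorial in the
families, by the interchange law of the hom 2-categories. -/
theorem evalHom_tcomp {Θ Ξ : G.IFace → K.C3} {p : List G.E} {l : List G.IFace}
    (hs : ∀ F, K.s2 (Θ F) = L.cell F) (h : ∀ F, K.t2 (Θ F) = K.s2 (Ξ F)) (hv : Valid p l) :
    L.evalHom (fun F => K.tcomp (Θ F) (Ξ F)) p l =
      K.tcomp (L.evalHom Θ p l) (L.evalHom Ξ p l) := by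
  -- The 2-cells in the middle, which are the targets of `Θ` and the sources of `Ξ`, are parallel to
  -- the cells of `L`, because the source and the target of a 3-cell are parallel. They therefore
  -- form a labelling on the same vertices and edges, through which all composability conditions
  -- below are checked.
  have hc : ∀ F, K.s1 (K.s2 (Ξ F)) = K.s1 (L.cell F) ∧ K.t1 (K.s2 (Ξ F)) = K.t1 (L.cell F) :=
    fun F => by simp [← h, ← hs]
  induction l generalizing p with
  | nil =>
    -- With no faces left, all three evaluations are the identity 3-cell of an identity 2-cell,
    -- which is idempotent.
    have e := K.id2_tcomp (K.id2 (K.id1 (L.path G.s p)))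
    rw [K.s2_id2] at e
    exact e.symm
  | cons F l ih =>
    -- The interchange law is applied to a two by two array: first face and tail in one direction,
    -- `Θ` and `Ξ` in the other. Its first two conditions ask that the target of the `Θ` part be the
    -- source of the `Ξ` part, once for the first face (`i` and `i'`) and once for the tail (`j` and
    -- `j'`). In each case both boundaries are the value of the middle labelling.
    have i := s2_step3_relabel (hc := hc) hs h hv
    have j := s2_evalHom (hc := hc) hs h hv.2.2
    have i' : K.s2 (L.step3 p F (Ξ F)) = (L.relabel _ hc).step p F :=
      s2_step3 (L := L.relabel _ hc) hv.2.1 hv.1 rfl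
    -- For the source of `Ξ` only the middle labelling matters. The targets of `Ξ` are supplied as
    -- new cells because the boundary lemma treats source and target together; that half is
    -- discarded.
    have j' := (s2_evalHom (L := L.relabel _ hc) (c := fun F => K.t2 (Ξ F))
      (hc := fun F => by simp) (Θ := Ξ) (fun _ => rfl) (fun _ => rfl) hv.2.2).1
    rw [L.evalHom_relabel] at j'
    unfold evalHom
    rw [ih hv.2.2, L.step3_tcomp hv.2.1 hv.1 (hs F) (h F),
      K.local_interchange _ _ _ _ (i.2.trans i'.symm) (j.2.trans j'.symm)]
    -- The remaining condition of the interchange law is that first face and tail meet along a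
    -- 1-cell: both boundaries are the composite of the path reached after crossing `F`.
    rw [(s1_step3 hs hv).2, (s1_evalHom hs hv.2.2).1]

/-! ### Families concentrated at one face -/

open Classical in
/-- The identity 3-cells of a labelling, with the 3-cell `Γ` in place of the one of the face `F`. -/
noncomputable def single (F : G.IFace) (Γ : K.C3) : G.IFace → K.C3 :=
  Function.update (fun H => K.id2 (L.cell H)) F Γ

open Classical in
theorem single_self (F : G.IFace) (Γ : K.C3) : L.single F Γ F = Γ :=
  Function.update_self _ _ _

open Classical in
theorem single_of_ne {F H : G.IFace} (h : H ≠ F) (Γ : K.C3) :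
    L.single F Γ H = K.id2 (L.cell H) :=
  Function.update_of_ne h _ _

/-- Away from `F` the members are identities, so the only boundary condition that has to be imposed
is the one on `Γ`. This makes the family eligible for evaluation over `L`. -/
theorem s2_single {F : G.IFace} {Γ : K.C3} (hΓ : K.s2 Γ = L.cell F) (H : G.IFace) :
    K.s2 (L.single F Γ H) = L.cell H := by
  by_cases hH : H = F
  · subst hH
    rw [single_self, hΓ]
  · rw [L.single_of_ne hH, K.s2_id2]

open Classical in
theorem act_cell_self (F : G.IFace) (Γ : K.C3) (hΓ : K.s2 Γ = L.cell F) :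
    (L.act F Γ hΓ).cell F = K.t2 Γ :=
  Function.update_self _ _ _

/-- The targets are exactly the cells of the labelling after the action of `Γ`. Hence a second
family which starts at that labelling can be composed with this one at every face, whichever face it
is concentrated at. -/
theorem t2_single {F : G.IFace} {Γ : K.C3} (hΓ : K.s2 Γ = L.cell F) (H : G.IFace) :
    K.t2 (L.single F Γ H) = (L.act F Γ hΓ).cell H := by
  by_cases hH : H = F
  · subst hH
    rw [single_self, act_cell_self]
  · rw [L.single_of_ne hH, K.t2_id2, L.replace_cell_of_ne hH]

/-! ### Two successive replacements -/

/-- Both components are evaluations by construction, the second one over the labelling already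
changed by `Γ`. Once it is moved back to `L`, functoriality of evaluation merges the two into one,
and the comparison of transformations becomes a comparison of families, independent of the order
`x`. The source of `Δ` is prescribed in the changed labelling, so this covers also the case of two
successive 3-cells at the same face. -/
theorem star_comp_star_app {F H : G.IFace} {Γ Δ : K.C3} (hΓ : K.s2 Γ = L.cell F)
    (hΔ : K.s2 Δ = (L.act F Γ hΓ).cell H) (x : G.Orders) :
    K.tcomp ((L.star F Γ hΓ).app x).1 (((L.act F Γ hΓ).star H Δ hΔ).app x).1 =
      L.evalHom (fun J => K.tcomp (L.single F Γ J) ((L.act F Γ hΓ).single H Δ J)) G.top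
        x.as.toList := by
  -- Both sides are the cell at `J` of the intermediate labelling.
  have h : ∀ J, K.t2 (L.single F Γ J) = K.s2 ((L.act F Γ hΓ).single H Δ J) := fun J => by
    rw [L.t2_single hΓ, s2_single _ hΔ]
  -- The components of `star` unfold definitionally to evaluations of `single`, since both use the
  -- same update of the family of identities. So the relabelling lemma applies to the second factor
  -- as it stands.
  exact (congrArg (K.tcomp _)
    (L.evalHom_relabel _ (L.parallel_update (parallel hΓ)) _ G.top _)).trans
    (L.evalHom_tcomp (L.s2_single hΓ) h x.as.valid).symm

/-- Since the faces are distinct, at least one of the two factors at `J` is an identity, whichever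
action comes first. Changing the order of the actions moves this identity from one side of the other
factor to the other side, and replaces the identity on its target by the identity on its source, or
conversely. The two unit laws of composition of 3-cells absorb it in either place. -/
theorem tcomp_single_comm {F H : G.IFace} (hne : F ≠ H) {Γ Δ : K.C3} (hΓ : K.s2 Γ = L.cell F)
    (hΔ : K.s2 Δ = L.cell H) (J : G.IFace) :
    K.tcomp (L.single F Γ J) ((L.act F Γ hΓ).single H Δ J) =
      K.tcomp (L.single H Δ J) ((L.act H Δ hΔ).single F Γ J) := by
  by_cases hF : J = F
  · subst hF
    -- On the left `Δ` acts second and contributes the identity on the target of `Γ`, as the cell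
    -- has already been replaced. On the right it acts first and contributes the identity on the
    -- original cell, which is the source of `Γ`.
    rw [single_self, single_self, single_of_ne _ hne, single_of_ne _ hne, act_cell_self,
      K.tcomp_id2, ← hΓ, K.id2_tcomp]
  · by_cases hH : J = H
    · subst hH
      -- The mirror image: now `Γ` contributes the identity, on the source of `Δ` on the left and on
      -- its target on the right.
      rw [single_self, single_self, single_of_ne _ hF, single_of_ne _ hF, act_cell_self,
        K.tcomp_id2, ← hΔ, K.id2_tcomp]
    -- At any other face neither action changes the cell, and both sides are the same composite of
    -- two identities on it.
    · rw [single_of_ne _ hF, single_of_ne _ hF, single_of_ne _ hH, single_of_ne _ hH,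
        L.replace_cell_of_ne hF, L.replace_cell_of_ne hH]

end Labelling

/-! ### Generalised local interchange -/

open CategoryTheory

/-- The transport `eqToHom` expresses the identification of the labellings obtained by replacing the
two 2-cells in either order. The functors they determine are equal because updates at distinct faces
commute, but not by definition. The target category needs no such correction: the composites of the
top and of the bottom path involve only vertices and edges. Distinctness of the faces also makes the
second 3-cell of each composite applicable, for it starts at a cell which the first replacement has
left alone. -/
theorem mainTheorem2 (G : PastingScheme.{u}) (K : GrayCategory.{w₀, w₁, w₂, w₃})
    (L : Labelling G K) (Fα Fβ : G.IFace) (hne : Fα ≠ Fβ) (Γ Δ : K.C3)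
    (hΓ : K.s2 Γ = L.cell Fα) (hΔ : K.s2 Δ = L.cell Fβ) :
    L.star Fα Γ hΓ ≫
        (L.act Fα Γ hΓ).star Fβ Δ (hΔ.trans (L.replace_cell_of_ne hne.symm _).symm) ≫
        eqToHom (L.functor_act_comm hne hΓ hΔ _ _) =
      L.star Fβ Δ hΔ ≫
        (L.act Fβ Δ hΔ).star Fα Γ (hΓ.trans (L.replace_cell_of_ne hne _).symm) := by
  -- Naturality is a property, so it suffices to compare components, and for these it suffices to
  -- compare the underlying 3-cells.
  ext x
  refine Subtype.ext ?_
  have hΔ' := hΔ.trans (L.replace_cell_of_ne hne.symm (Labelling.parallel hΓ)).symm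
  have hΓ' := hΓ.trans (L.replace_cell_of_ne hne (Labelling.parallel hΔ)).symm
  -- At the object `x` the equality of functors becomes an equality of two composite 2-cells;
  -- composing with the transport along it leaves the 3-cell of `Δ*` at `x` unchanged.
  have e := HomCat.comp_eqToHom_val (((L.act Fα Γ hΓ).star Fβ Δ hΔ').app x)
    (Functor.congr_obj (L.functor_act_comm hne hΓ hΔ hΓ' hΔ') x)
  rw [NatTrans.comp_app, NatTrans.comp_app, NatTrans.comp_app, eqToHom_app]
  -- Composition in the hom-category is `tcomp` on underlying 3-cells by definition, so the
  -- transport can be removed inside the second factor.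
  refine (congrArg (K.tcomp _) e).trans ?_
  refine (L.star_comp_star_app hΓ hΔ' x).trans (Eq.trans ?_ (L.star_comp_star_app hΔ hΓ' x).symm)
  -- Both sides are now evaluations over `L` along the same order and from the same top path. They
  -- differ only in the family, and the two families agree at every face.
  rw [funext (L.tcomp_single_comm hne hΓ hΔ)]
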